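/- **Model.** Let $n\ge 1$. A dynamic $n$-node radio network has a fixed set $V$ of $n$ nodes and communication graphs $G_1,G_2,\dots$ on $V$, one for each synchronous round; it is *$\infty$-interval connected* if for every $r\ge1$ the graph on $V$ with edge set $\bigcap_{r'\ge r}E(G_{r'})$ is connected. A randomized algorithm is a collection of $n$ processes, one per node, each drawing fresh independent random coins in every round. In each round each node either transmits one packet or listens; a listening node receives the packet of a neighbor in $G_r$ if that is its only neighbor transmitting in round $r$, and otherwise it receives silence (no collision detection). The graphs are chosen by a *$0$-oblivious* (strongly adaptive) adversary: $G_r$ may depend on the algorithm, on the input and on all random choices of rounds $1,\dots,r$. In *$s$-multi-message broadcast*, $s\ge 1$ distinct broadcast messages of $B\ge1$ bits each are given to nodes, each message to one (arbitrary) source node, and all $n$ nodes have to learn all $s$ messages. The algorithm is *store-and-forward* if it treats broadcast messages as black boxes that nodes can only store and forward; the *communication capacity* is $c\ge 1$ if a packet contains at most $c$ broadcast messages plus $O(cB)$ bits of control information. The algorithm may depend on $n$, $s$, $c$ and $B$. **Theorem.** For every constant $\gamma>0$ there is a constant $C>0$, depending only on $\gamma$, such that for all $n,s,B\ge 1$ the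 following holds against every $0$-oblivious adversary whose dynamic networks are $\infty$-interval connected. 1. For communication capacity $c=1$, there is a store-and-forward algorithm that solves $s$-multi-message broadcast with probability at least $1-n^{-\gamma}$ within $C\, n\, s\, \log^2 n$ rounds. 2. For every communication capacity $c\ge 1$, there is a store-and-forward algorithm that solves $s$-multi-message broadcast with probability at least $1-n^{-\gamma}$ within $C\left(1+\frac sc\right) n\log^4 n$ rounds. In both parts the algorithm does not depend on the adversary or the input, and the constant in the $O(cB)$ bound on the control information is absolute. -/

import Mathlib

open MeasureTheory

namespace RadioNetwork

/-- The content of one transmission: a list of broadcast messages and a string of control bits.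
On the network, `M` is the type of broadcast messages; inside a process, which treats broadcast
messages as black boxes, `M = ℕ` and the entries are local handles (see `Algorithm`). -/
structure Packet (M : Type) where
  msgs : List M
  ctrl : List Bool

/-- A randomized store-and-forward algorithm for `n` nodes: a collection of `n` processes, one for
each node, which is also the identifier of the node. The broadcast messages are black boxes. Each
node keeps the list of the broadcast messages it knows, in the order in which it got them, and its
process refers to a broadcast message only by its position (its handle) in that list; it never
sees the content. In every round each process draws a fresh coin according to `law`, and then

* `send v st x` is its action in state `st` with coin `x`: `none` means to listen, `some p` means to
  transmit the broadcast messages with handles `p.msgs` and the control bits `p.ctrl`;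
* `next v st x y` is the state after the round, where `y` is what it received (`none` is silence,
  broadcast messages in `y` are again given by handles).

`init v k` is the initial state of the process of `v` if `k` broadcast messages are given to `v`. -/
structure Algorithm (n : ℕ) where
  Coin : Type
  coinFintype : Fintype Coin
  law : PMF Coin
  State : Type
  init : Fin n → ℕ → State
  send : Fin n → State → Coin → Option (Packet ℕ)
  next : Fin n → State → Coin → Option (Packet ℕ) → State

/-- Every transmission contains at most `c` broadcast messages and at most `b` control bits. -/
def Algorithm.HasCapacity {n : ℕ} (A : Algorithm n) (c b : ℕ) : Prop :=
  ∀ (v : Fin n) (st : A.State) (x : A.Coin) (p : Packet ℕ),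
    A.send v st x = some p → p.msgs.length ≤ c ∧ p.ctrl.length ≤ b

/-- The local configuration of a node: the broadcast messages it knows and the state of its
process. -/
structure NodeConfig (σ M : Type) where
  known : List M
  st : σ

/-- Append to the list `known` those entries of the second list that are new. -/
def learn {M : Type} [DecidableEq M] (known : List M) : List M → List M
  | [] => known
  | m :: ms => learn (if m ∈ known then known else known ++ [m]) ms

section Execution

variable {n : ℕ} {M : Type} [DecidableEq M] (A : Algorithm n)

/-- What node `v` puts on the channel. Handles that are out of range are dropped, so a node can
only transmit broadcast messages that it knows. -/
def transmission (cfg : Fin n → NodeConfig A.State M) (x : Fin n → A.Coin) (v : Fin n) :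
    Option (Packet M) :=
  (A.send v (cfg v).st (x v)).map fun p =>
    { msgs := p.msgs.filterMap fun i => (cfg v).known[i]?
      ctrl := p.ctrl }

open Classical in
/-- What node `v` receives in communication graph `G` if `tr u` is the transmission of node `u`:
if `v` listens and exactly one neighbor transmits, the packet of that neighbor, else silence. -/
noncomputable def reception (G : SimpleGraph (Fin n)) (tr : Fin n → Option (Packet M))
    (v : Fin n) : Option (Packet M) :=
  if h : tr v = none ∧ ∃! u, G.Adj v u ∧ tr u ≠ none then tr h.2.choose else none

/-- The configuration of node `v` after it received `y` in a round with coin `x`. -/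
def updateNode (v : Fin n) (nc : NodeConfig A.State M) (x : A.Coin) :
    Option (Packet M) → NodeConfig A.State M
  | none => { known := nc.known, st := A.next v nc.st x none }
  | some p =>
    { known := learn nc.known p.msgs
      st := A.next v nc.st x (some
        { msgs := p.msgs.map fun m => (learn nc.known p.msgs).idxOf m
          ctrl := p.ctrl }) }

/-- The configuration after `r` rounds, where `inp v` is the list of the broadcast messages given
to `v`, `G r` is the communication graph and `ω r v` the coin of node `v` in the round with index
`r` (so `G 0` belongs to the first round). -/
noncomputable def run (inp : Fin n → List M) (G : ℕ → SimpleGraph (Fin n))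
    (ω : ℕ → Fin n → A.Coin) : ℕ → Fin n → NodeConfig A.State M
  | 0 => fun v => { known := inp v, st := A.init v (inp v).length }
  | r + 1 => fun v =>
    updateNode A v (run inp G ω r v) (ω r v)
      (reception (G r) (transmission A (run inp G ω r) (ω r)) v)

/-- The law of all the coins: they are independent with law `A.law`. -/
noncomputable def coinMeasure : @Measure (ℕ → Fin n → A.Coin)
    (@MeasurableSpace.pi ℕ (fun _ => Fin n → A.Coin)
      fun _ => @MeasurableSpace.pi (Fin n) (fun _ => A.Coin) fun _ => ⊤) :=
  letI : MeasurableSpace A.Coin := ⊤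
  Measure.infinitePi fun _ : ℕ => Measure.pi fun _ : Fin n => A.law.toMeasure

end Execution

/-- The graph of the edges that are present in all the rounds `r, …, r + T - 1`. -/
def stableGraph {V : Type} (G : ℕ → SimpleGraph V) (r : ℕ) (T : ℕ∞) : SimpleGraph V where
  Adj u v := u ≠ v ∧ ∀ r' : ℕ, r ≤ r' → (r' : ℕ∞) < r + T → (G r').Adj u v
  symm := ⟨fun _ _ h => ⟨h.1.symm, fun r' h₁ h₂ => (h.2 r' h₁ h₂).symm⟩⟩
  loopless := ⟨fun _ h => h.1 rfl⟩

/-- The dynamic graph `G` is `T`-interval connected. -/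
def IntervalConnected {V : Type} (G : ℕ → SimpleGraph V) (T : ℕ∞) : Prop :=
  ∀ r : ℕ, (stableGraph G r T).Connected

/-- An adversary determines a dynamic graph from the random choices of the algorithm. It is
`τ`-oblivious if the graph of each round `r = 1, 2, …` is determined by the random choices of the
rounds `1, …, r - τ` (rounds are indexed from `0` here). -/
def IsOblivious {n : ℕ} {R : Type} (adv : (ℕ → Fin n → R) → ℕ → SimpleGraph (Fin n)) (τ : ℕ) :
    Prop :=
  ∀ (ω ω' : ℕ → Fin n → R) (r : ℕ),
    (∀ r' : ℕ, r' + τ ≤ r → ω r' = ω' r') → adv ω r = adv ω' r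

/-- An input of the `s`-multi-message broadcast problem: `s` distinct broadcast messages, each of
which is given to one node. -/
structure IsInput {n : ℕ} {M : Type} (inp : Fin n → List M) (s : ℕ) : Prop where
  nodup : ∀ v, (inp v).Nodup
  disjoint : ∀ u v, u ≠ v → (inp u).Disjoint (inp v)
  card : ∑ v, (inp v).length = s

/-- All nodes know all the broadcast messages. -/
def Disseminated {n : ℕ} {σ M : Type} (inp : Fin n → List M) (cfg : Fin n → NodeConfig σ M) :
    Prop :=
  ∀ u v : Fin n, ∀ m ∈ inp u, m ∈ (cfg v).known

/-- In every `T`-interval connected network controlled by a `τ`-oblivious adversary, `A` solves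
`s`-multi-message broadcast with messages of `B` bits within `t` rounds with probability at
least `p`. -/
def Solves {n : ℕ} (A : Algorithm n) (T : ℕ∞) (τ s B t : ℕ) (p : ℝ) : Prop :=
  ∀ (inp : Fin n → List (BitVec B)) (adv : (ℕ → Fin n → A.Coin) → ℕ → SimpleGraph (Fin n)),
    IsInput inp s → IsOblivious adv τ → (∀ ω, IntervalConnected (adv ω) T) →
      p ≤ ((coinMeasure A) {ω | Disseminated inp (run A inp (adv ω) ω t)}).toReal

end RadioNetwork

/-! Let `H` be the graph of the edges present in all rounds; it is connected and lies in every `G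
r`. If a node is the only transmitter in the whole network, all its `H`-neighbors receive its
packet, whatever graph is chosen. Only such rounds are counted as progress. The probability of such
an event in round `r` is bounded in terms of the configuration before round `r`, so it does not
matter that the adversary sees the coins of round `r`. The probabilistic core is
`measure_no_success_le`: if the conditional success probabilities are at least `q r`, then `exp (∑
q)` times the indicator of no success is a supermartingale.

Harmonic broadcast: an agent awake since round `w` transmits with probability `1 / (1 + ⌊(r - w) /
Θ⌋)`. A round is busy if the expected number of transmissions exceeds `1 / 2`, and free otherwise.
In a free round an agent with probability `p` is alone with probability at least `p / 2`. If half of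
the rounds since its wake-up are free, these values add up to `Θ / 8`
(`le_sum_free_of_sum_score_nonpos`), so except with probability `exp (-Θ / 8)` it has been alone and
has informed its neighbors. Hence at least half of all rounds are busy until everyone is informed
(`sum_score_nonneg_of_spread`). But in `Θ * m` rounds an agent contributes at most `Θ * H_m`
expected transmissions, so `k` agents cannot keep half of a window busy that is longer than `4 * k *
Θ * H_m` (`informed_eq_univ_of_long_window`).

Three algorithms are combined, none of which sends control bits. If `s` is large (`s > n` for part
1, `s ≥ c * n` for part 2), deterministic round robin with pipelining needs only `n * (n + s / c)`
rounds (`pipeline_progress`). For `c = 1` and `s ≤ n`, harmonic broadcast is run with one agent for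
each pair of a node and a message: `n * s` agents, and one logarithm each for `Θ` and for `H_m`
(`multi_solves`).

For `s < c * n`, `samplingBroadcast` repeats harmonic broadcasts of packets from random sources. Let
`X` be a set of messages that fits into one packet. If a node that knows `X` is the only source and
selects a chunk of its pool that contains `X`, then every node that wakes up in this broadcast
learns `X`; and a window too long for `k` awake nodes wakes at least `min (k + 1) n` of them
(`sampling_broadcast_reaches`). If `a` nodes know `X`, such a selection has probability of order `a
/ (n * (g + 1))`, where `g + 1` is the number of chunks. Stage `i` makes about `2 ^ (ℓ - i) * K`
attempts with windows of length `2 ^ i * L`. As more nodes know `X`, attempts succeed more often but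
have to last longer, so all stages cost the same, and each one doubles the number of nodes that know
`X` (`sampling_stage`, `sampling_epoch`). The four logarithms are the number of stages, the
confidence in `K`, and the two in `L`, which is of order `Θ * H_m`. -/

namespace RadioNetwork

/-! ### Waiting for a success in an adapted sequence of trials -/

section AdaptedSuccess

variable {X : Type*} [MeasurableSpace X]

theorem measurable_update_prod (r : ℕ) :
    Measurable fun p : (ℕ → X) × X => Function.update p.1 r p.2 := by
  refine measurable_pi_lambda _ fun i => ?_
  by_cases h : i = r
  · subst h; simpa using measurable_snd
  · simp only [Function.update_of_ne h]
    exact (measurable_pi_apply i).comp measurable_fst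

/-- Resampling one coordinate does not change an infinite product measure. -/
theorem map_update_infinitePi_prod (ν : Measure X) [IsProbabilityMeasure ν] (r : ℕ) :
    ((Measure.infinitePi fun _ : ℕ => ν).prod ν).map (fun p => Function.update p.1 r p.2) =
      Measure.infinitePi fun _ : ℕ => ν := by
  have hm := measurable_update_prod (X := X) r
  refine Measure.eq_infinitePi _ fun s t ht => ?_
  rw [Measure.map_apply hm (MeasurableSet.pi s.countable_toSet fun i _ => ht i)]
  by_cases hr : r ∈ s
  · have : (fun p : (ℕ → X) × X => Function.update p.1 r p.2) ⁻¹' (s : Set ℕ).pi t =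
        ((s.erase r : Finset ℕ) : Set ℕ).pi t ×ˢ t r := by
      ext p
      simp only [Set.mem_preimage, Set.mem_pi, Finset.mem_coe, Set.mem_prod, Finset.mem_erase]
      constructor
      · intro h
        refine ⟨fun i hi => by simpa [Function.update_of_ne hi.1] using h i hi.2, ?_⟩
        simpa using h r hr
      · rintro ⟨h1, h2⟩ i hi
        by_cases h : i = r
        · subst h; simpa using h2
        · simpa [Function.update_of_ne h] using h1 i ⟨h, hi⟩
    rw [this, Measure.prod_prod, Measure.infinitePi_pi _ fun i _ => ht i, mul_comm,
      Finset.mul_prod_erase s (fun i => ν (t i)) hr]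
  · have : (fun p : (ℕ → X) × X => Function.update p.1 r p.2) ⁻¹' (s : Set ℕ).pi t =
        (s : Set ℕ).pi t ×ˢ Set.univ := by
      ext p
      simp only [Set.mem_preimage, Set.mem_pi, Finset.mem_coe, Set.mem_prod, Set.mem_univ, and_true]
      refine forall₂_congr fun i hi => ?_
      rw [Function.update_of_ne (ne_of_mem_of_not_mem hi hr)]
    rw [this, Measure.prod_prod, Measure.infinitePi_pi _ fun i _ => ht i, measure_univ, mul_one]

/-- Plays the role of conditional expectation given the other rounds: the coin of round `r` is
integrated first, with everything else fixed. -/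
theorem lintegral_infinitePi_update (ν : Measure X) [IsProbabilityMeasure ν] (r : ℕ)
    {f : (ℕ → X) → ENNReal} (hf : Measurable f) :
    ∫⁻ ω, f ω ∂(Measure.infinitePi fun _ : ℕ => ν) =
      ∫⁻ ω, ∫⁻ x, f (Function.update ω r x) ∂ν ∂(Measure.infinitePi fun _ : ℕ => ν) := by
  have hm := measurable_update_prod (X := X) r
  conv_lhs => rw [← map_update_infinitePi_prod ν r]
  rw [lintegral_map hf hm]
  exact lintegral_prod _ (hf.comp hm).aemeasurable

variable [Finite X] [MeasurableSingletonClass X]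

/-- Only finitely many coordinates with finitely many values matter, so the function factors through
a finite discrete space. -/
theorem measurable_of_dependsOn_Iio {β : Type*} [MeasurableSpace β] [Nonempty β]
    {f : (ℕ → X) → β} {r : ℕ} (hf : DependsOn f (Set.Iio r)) : Measurable f := by
  obtain ⟨g, rfl⟩ := dependsOn_iff_exists_comp.1 hf
  have : Finite (Set.Iio r) := inferInstance
  exact (measurable_of_countable g).comp (by fun_prop)

/-- If in each round, conditionally on the past, a success has probability at least `q`, then with
probability at least `1 - exp (-lam)` there is a success by the time the values of `q` add
up to `lam`; version at a fixed time. -/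
theorem measure_no_success_le_of_fixed_time (ν : Measure X) [IsProbabilityMeasure ν]
    (q : (ℕ → X) → ℕ → ℝ) (S : (ℕ → X) → ℕ → Prop)
    (hq : ∀ r, DependsOn (fun ω => q ω r) (Set.Iio r))
    (hS : ∀ r, DependsOn (fun ω => S ω r) (Set.Iio (r + 1)))
    (hle : ∀ ω r, ENNReal.ofReal (q ω r) ≤ ν {x | S (Function.update ω r x) r})
    (lam : ℝ) (T : ℕ) :
    (Measure.infinitePi fun _ : ℕ => ν)
        {ω | (∀ r < T, ¬ S ω r) ∧ lam ≤ ∑ r ∈ Finset.range T, q ω r} ≤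
      ENNReal.ofReal (Real.exp (-lam)) := by
  classical
  set P := Measure.infinitePi fun _ : ℕ => ν with hP
  -- The supermartingale. `hstep` bounds its expectation by `1`, by resampling the coin of the last
  -- round.
  let M : ℕ → (ℕ → X) → ENNReal := fun t ω =>
    if ∀ r < t, ¬ S ω r then ENNReal.ofReal (Real.exp (∑ r ∈ Finset.range t, q ω r)) else 0
  have hMdep : ∀ t, DependsOn (M t) (Set.Iio t) := by
    intro t ω ω' h
    have h1 : ∀ r < t, S ω r = S ω' r := fun r hr =>
      hS r fun i hi => h i (Set.mem_Iio.2 (lt_of_lt_of_le (Set.mem_Iio.1 hi) hr))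
    have h2 : ∑ r ∈ Finset.range t, q ω r = ∑ r ∈ Finset.range t, q ω' r :=
      Finset.sum_congr rfl fun r hr => hq r fun i hi =>
        h i (lt_trans hi (Finset.mem_range.1 hr))
    have h3 : (∀ r < t, ¬ S ω r) ↔ ∀ r < t, ¬ S ω' r :=
      forall₂_congr fun r hr => by rw [h1 r hr]
    simp only [M, h2, h3]
  have hMmeas : ∀ t, Measurable (M t) := fun t => measurable_of_dependsOn_Iio (hMdep t)
  have hstep : ∀ t, ∫⁻ ω, M t ω ∂P ≤ 1 := by
    intro t
    induction t with
    | zero => simp [M]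
    | succ t ih =>
      refine le_trans ?_ ih
      rw [hP, lintegral_infinitePi_update ν t (hMmeas (t + 1))]
      refine lintegral_mono fun ω => ?_
      have hup : ∀ x, ∀ r < t, Function.update ω t x r = ω r := fun x r hr =>
        Function.update_of_ne hr.ne _ _
      have hSx : ∀ x, ∀ r < t, S (Function.update ω t x) r ↔ S ω r := fun x r hr => by
        rw [show S (Function.update ω t x) r = S ω r from hS r fun i hi =>
          hup x i (lt_of_lt_of_le hi hr)]
      have hqx : ∀ x, ∀ r ≤ t, q (Function.update ω t x) r = q ω r := fun x r hr =>
        hq r fun i hi => hup x i (lt_of_lt_of_le hi hr)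
      have hval : ∀ x, M (t + 1) (Function.update ω t x) =
          M t ω * ENNReal.ofReal (Real.exp (q ω t)) *
            Set.indicator {x | ¬ S (Function.update ω t x) t} 1 x := by
        intro x
        have hsum : ∑ r ∈ Finset.range (t + 1), q (Function.update ω t x) r =
            ∑ r ∈ Finset.range t, q ω r + q ω t := by
          rw [Finset.sum_range_succ, hqx x t le_rfl]
          congr 1
          exact Finset.sum_congr rfl fun r hr => hqx x r (Finset.mem_range.1 hr).le
        have hall : (∀ r < t + 1, ¬ S (Function.update ω t x) r) ↔
            (∀ r < t, ¬ S ω r) ∧ ¬ S (Function.update ω t x) t := by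
          rw [Nat.forall_lt_succ_right]
          exact and_congr_left fun _ => forall₂_congr fun r hr => by rw [hSx x r hr]
        simp only [M, hall, hsum]
        by_cases h1 : ∀ r < t, ¬ S ω r <;> by_cases h2 : S (Function.update ω t x) t <;>
          simp [h1, h2, Real.exp_add, ENNReal.ofReal_mul (Real.exp_pos _).le, -not_forall]
      simp_rw [hval]
      rw [lintegral_const_mul _ (measurable_one.indicator (Set.toFinite _).measurableSet),
        lintegral_indicator_one (Set.toFinite _).measurableSet, mul_assoc]
      refine mul_le_of_le_one_right' ?_
      have hc : ν {x | ¬ S (Function.update ω t x) t} ≤ ENNReal.ofReal (1 - q ω t) := by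
        rw [show {x | ¬ S (Function.update ω t x) t} = {x | S (Function.update ω t x) t}ᶜ from rfl,
          prob_compl_eq_one_sub (Set.toFinite _).measurableSet]
        by_cases h0 : 0 ≤ q ω t
        · rw [ENNReal.ofReal_sub _ h0, ENNReal.ofReal_one]
          exact tsub_le_tsub_left (hle ω t) _
        · refine tsub_le_self.trans ?_
          rw [ENNReal.one_le_ofReal]; linarith
      refine (mul_le_mul_right hc _).trans ?_
      rw [← ENNReal.ofReal_mul (Real.exp_pos _).le, ENNReal.ofReal_le_one]
      -- The growth of the exponential is compensated by the probability `1 - q` of another failure.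
      calc Real.exp (q ω t) * (1 - q ω t)
          ≤ Real.exp (q ω t) * Real.exp (-q ω t) :=
            mul_le_mul_of_nonneg_left (by linarith [Real.add_one_le_exp (-q ω t)])
              (Real.exp_pos _).le
        _ = 1 := by rw [← Real.exp_add]; simp
  -- Markov's inequality: on the event in question `M T` is at least `exp lam`.
  have hmarkov := mul_meas_ge_le_lintegral (μ := P) (hMmeas T) (ENNReal.ofReal (Real.exp lam))
  have hsub : {ω | (∀ r < T, ¬ S ω r) ∧ lam ≤ ∑ r ∈ Finset.range T, q ω r} ⊆
      {ω | ENNReal.ofReal (Real.exp lam) ≤ M T ω} := by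
    rintro ω ⟨h1, h2⟩
    simp only [M, Set.mem_ofPred_eq]
    rw [if_pos h1]
    exact ENNReal.ofReal_le_ofReal (Real.exp_le_exp.2 h2)
  have hfin := (mul_le_mul_right (measure_mono (μ := P) hsub) _).trans
    (hmarkov.trans (hstep T))
  rw [Real.exp_neg, ENNReal.ofReal_inv_of_pos (Real.exp_pos _), ENNReal.le_inv_iff_mul_le, mul_comm]
  exact hfin

/-- If in each round, conditionally on the past, a success has probability at least `q`, then with
probability at least `1 - exp (-lam)` there is a success by the time the values of `q` add
up to `lam`. -/
theorem measure_no_success_le (ν : Measure X) [IsProbabilityMeasure ν]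
    (q : (ℕ → X) → ℕ → ℝ) (S : (ℕ → X) → ℕ → Prop)
    (hq : ∀ r, DependsOn (fun ω => q ω r) (Set.Iio r))
    (hS : ∀ r, DependsOn (fun ω => S ω r) (Set.Iio (r + 1))) (hq0 : ∀ ω r, 0 ≤ q ω r)
    (hle : ∀ ω r, ENNReal.ofReal (q ω r) ≤ ν {x | S (Function.update ω r x) r})
    (lam : ℝ) (T : ℕ) :
    (Measure.infinitePi fun _ : ℕ => ν)
        {ω | ∃ t ≤ T, (∀ r < t, ¬ S ω r) ∧ lam ≤ ∑ r ∈ Finset.range t, q ω r} ≤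
      ENNReal.ofReal (Real.exp (-lam)) := by
  classical
  have hsumdep : ∀ t, DependsOn (fun ω => ∑ r ∈ Finset.range t, q ω r) (Set.Iio t) := by
    intro t ω ω' h
    exact Finset.sum_congr rfl fun r hr => hq r fun i hi =>
        h i (lt_trans hi (Finset.mem_range.1 hr))
  -- Stop as soon as the sum has reached `lam`: `q` becomes `0`, and later successes no longer
  -- count. The existential over `t ≤ T` is then covered by the single time `T`, with no union
  -- bound.
  refine (measure_mono ?_).trans (measure_no_success_le_of_fixed_time ν
    (fun ω r => if ∑ i ∈ Finset.range r, q ω i < lam then q ω r else 0)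
    (fun ω r => S ω r ∧ ∑ i ∈ Finset.range r, q ω i < lam) ?_ ?_ ?_ lam T)
  · rintro ω ⟨t, htT, hno, hsum⟩
    have hex : ∃ t, lam ≤ ∑ r ∈ Finset.range t, q ω r := ⟨t, hsum⟩
    have hmono : Monotone fun t => ∑ r ∈ Finset.range t, q ω r := fun a b hab =>
      Finset.sum_le_sum_of_subset_of_nonneg (Finset.range_mono hab) fun _ _ _ => hq0 _ _
    have hfind : Nat.find hex ≤ t := Nat.find_min' hex hsum
    refine ⟨fun r _ hr => ?_, ?_⟩
    · have : r < t := by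
        by_contra h
        exact absurd (hsum.trans (hmono (not_lt.1 h))) (not_le.2 hr.2)
      exact hno r this hr.1
    · refine (Nat.find_spec hex).trans (le_trans (le_of_eq ?_)
        (Finset.sum_le_sum_of_subset_of_nonneg (Finset.range_mono (hfind.trans htT))
          fun r _ _ => ?_))
      · refine Finset.sum_congr rfl fun r hr => ?_
        rw [if_pos (not_le.1 (Nat.find_min hex (Finset.mem_range.1 hr)))]
      · split_ifs
        exacts [hq0 _ _, le_rfl]
  · intro r ω ω' h
    have h1 := hsumdep r h
    have h2 := hq r h
    simp only at h1 h2 ⊢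
    rw [h1, h2]
  · intro r ω ω' h
    have h1 := hsumdep r fun i hi => h i (lt_trans hi (Nat.lt_succ_self r))
    have h2 := hS r h
    simp only at h1 h2 ⊢
    rw [h1, h2]
  · intro ω r
    have h1 : ∀ x, ∑ i ∈ Finset.range r, q (Function.update ω r x) i =
        ∑ i ∈ Finset.range r, q ω i := fun x =>
      hsumdep r fun i hi => Function.update_of_ne (Set.mem_Iio.1 hi).ne _ _
    simp only [h1]
    split_ifs with h
    · simpa [h] using hle ω r
    · simp

end AdaptedSuccess

/-! ### Probabilities of single-round events -/

section RoundProb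

/-- The probability of a set of coin vectors of a single round. -/
noncomputable def roundProb {C : Type} (law : PMF C) (n : ℕ) (S : Set (Fin n → C)) : ℝ :=
  letI : MeasurableSpace C := ⊤
  (Measure.pi fun _ : Fin n => law.toMeasure).real S

/-- The bound of `measure_no_success_le` for the coins of an algorithm. -/
theorem coinMeasure_no_success_le {n : ℕ} (A : Algorithm n)
    (q : (ℕ → Fin n → A.Coin) → ℕ → ℝ) (S : (ℕ → Fin n → A.Coin) → ℕ → Prop)
    (hq : ∀ r, DependsOn (fun ω => q ω r) (Set.Iio r))
    (hS : ∀ r, DependsOn (fun ω => S ω r) (Set.Iio (r + 1))) (hq0 : ∀ ω r, 0 ≤ q ω r)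
    (hle : ∀ ω r, q ω r ≤ roundProb A.law n {x | S (Function.update ω r x) r})
    (lam : ℝ) (T : ℕ) :
    coinMeasure A {ω | ∃ t ≤ T, (∀ r < t, ¬ S ω r) ∧ lam ≤ ∑ r ∈ Finset.range t, q ω r} ≤
      ENNReal.ofReal (Real.exp (-lam)) := by
  let _ : MeasurableSpace A.Coin := ⊤
  have : MeasurableSingletonClass A.Coin := ⟨fun _ => trivial⟩
  have := A.coinFintype
  refine measure_no_success_le (Measure.pi fun _ : Fin n => A.law.toMeasure) q S hq hS hq0
    (fun ω r => ?_) lam T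
  refine (ENNReal.ofReal_le_ofReal (hle ω r)).trans ?_
  rw [roundProb, measureReal_def, ENNReal.ofReal_toReal (measure_ne_top _ _)]

variable {C : Type}

theorem roundProb_mono [Finite C] (law : PMF C) (n : ℕ) {S S' : Set (Fin n → C)} (h : S ⊆ S') :
    roundProb law n S ≤ roundProb law n S' := by
  let _ : MeasurableSpace C := ⊤
  exact measureReal_mono h

theorem roundProb_nonneg (law : PMF C) (n : ℕ) (S : Set (Fin n → C)) :
    0 ≤ roundProb law n S := by
  let _ : MeasurableSpace C := ⊤
  exact measureReal_nonneg

theorem roundProb_biUnion [Finite C] (law : PMF C) (n : ℕ) {ι : Type*} (s : Finset ι)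
    (S : ι → Set (Fin n → C)) (h : (s : Set ι).PairwiseDisjoint S) :
    roundProb law n (⋃ i ∈ s, S i) = ∑ i ∈ s, roundProb law n (S i) := by
  let _ : MeasurableSpace C := ⊤
  have : MeasurableSingletonClass C := ⟨fun _ => trivial⟩
  exact measureReal_biUnion_finset h (fun i _ => (Set.toFinite _).measurableSet)

theorem roundProb_uniform_pi [Fintype C] [Nonempty C] (n : ℕ) (B : Fin n → Finset C) :
    roundProb (PMF.uniformOfFintype C) n (Set.univ.pi fun v => (B v : Set C)) =
      ∏ v, ((B v).card : ℝ) / Fintype.card C := by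
  let _ : MeasurableSpace C := ⊤
  have : MeasurableSingletonClass C := ⟨fun _ => trivial⟩
  rw [roundProb, measureReal_def, Measure.pi_pi, ENNReal.toReal_prod]
  refine Finset.prod_congr rfl fun v _ => ?_
  rw [PMF.toMeasure_uniformOfFintype_apply _ (Set.toFinite _).measurableSet, ENNReal.toReal_div,
    ENNReal.toReal_natCast, ENNReal.toReal_natCast]
  simp

/-- The Weierstrass product inequality. -/
theorem one_sub_sum_le_prod {ι : Type*} (s : Finset ι) (f : ι → ℝ)
    (h0 : ∀ i ∈ s, 0 ≤ f i) (h1 : ∀ i ∈ s, f i ≤ 1) :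
    1 - ∑ i ∈ s, (1 - f i) ≤ ∏ i ∈ s, f i := by
  classical
  induction s using Finset.induction_on with
  | empty => simp
  | insert a s ha ih =>
    rw [Finset.sum_insert ha, Finset.prod_insert ha]
    have hih := ih (fun i hi => h0 i (Finset.mem_insert_of_mem hi))
      (fun i hi => h1 i (Finset.mem_insert_of_mem hi))
    have hp0 : 0 ≤ ∏ i ∈ s, f i :=
      Finset.prod_nonneg fun i hi => h0 i (Finset.mem_insert_of_mem hi)
    have hp1 : ∏ i ∈ s, f i ≤ 1 := Finset.prod_le_one
      (fun i hi => h0 i (Finset.mem_insert_of_mem hi))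
      (fun i hi => h1 i (Finset.mem_insert_of_mem hi))
    nlinarith [h0 a (Finset.mem_insert_self a s), h1 a (Finset.mem_insert_self a s)]

/-- The product of probabilities of which one is `a` and the others are close to one. -/
theorem mul_one_sub_sum_le_prod {ι : Type*} [Fintype ι] [DecidableEq ι] (f g : ι → ℝ) (i : ι)
    (hg0 : ∀ j, 0 ≤ g j) (hg1 : ∀ j, g j ≤ 1) (hi : f i = g i) (hf : ∀ j, j ≠ i → f j = 1 - g j) :
    g i * (1 - ∑ j, g j) ≤ ∏ j, f j := by
  rw [← Finset.mul_prod_erase Finset.univ f (Finset.mem_univ i), hi]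
  refine mul_le_mul_of_nonneg_left ?_ (hg0 i)
  refine le_trans ?_ (one_sub_sum_le_prod _ _ ?_ ?_)
  · have : ∑ j ∈ Finset.univ.erase i, (1 - f j) = ∑ j ∈ Finset.univ.erase i, g j :=
      Finset.sum_congr rfl fun j hj => by rw [hf j (Finset.ne_of_mem_erase hj)]; ring
    rw [this]
    have := Finset.sum_le_sum_of_subset_of_nonneg (Finset.erase_subset i Finset.univ)
      (fun j _ _ => hg0 j)
    linarith
  · intro j hj
    rw [hf j (Finset.ne_of_mem_erase hj)]; linarith [hg1 j]
  · intro j hj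
    rw [hf j (Finset.ne_of_mem_erase hj)]; linarith [hg0 j]

/-- A fair coin with a uniform number from `Fin N` for each of `σ` slots, and a uniform element
of `D`. -/
abbrev SlotCoin (σ N : ℕ) (D : Type) : Type := (Fin σ → Fin N) × D

variable {σ N : ℕ} {D : Type} [NeZero N] [Fintype D] [Nonempty D]

theorem card_fin_lt {N t : ℕ} (ht : t ≤ N) :
    (Finset.univ.filter fun y : Fin N => y.val < t).card = t := by
  rw [Fin.card_filter_val_lt, min_eq_right ht]

theorem card_fin_not_lt {N t : ℕ} (ht : t ≤ N) :
    (Finset.univ.filter fun y : Fin N => ¬ y.val < t).card = N - t := by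
  have := Finset.card_filter_add_card_filter_not (s := (Finset.univ : Finset (Fin N)))
    (fun y : Fin N => y.val < t)
  rw [card_fin_lt ht, Finset.card_univ, Fintype.card_fin] at this
  omega

/-- The probability that exactly one given slot is below its threshold. -/
theorem le_roundProb_only_slot (n : ℕ) (th : Fin n → Fin σ → ℕ) (hth : ∀ u i, th u i ≤ N)
    (v : Fin n) (k : Fin σ) :
    (th v k : ℝ) / N * (1 - ∑ u, ∑ i, (th u i : ℝ) / N) ≤
      roundProb (PMF.uniformOfFintype (SlotCoin σ N D)) n
        {x | ∀ u i, ((x u).1 i).val < th u i ↔ u = v ∧ i = k} := by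
  classical
  have hN : (0 : ℝ) < N := by exact_mod_cast Nat.pos_of_ne_zero (NeZero.ne N)
  let F : Fin n → Fin σ → Finset (Fin N) := fun u i =>
    Finset.univ.filter fun y => y.val < th u i ↔ u = v ∧ i = k
  have hset : {x : Fin n → SlotCoin σ N D | ∀ u i, ((x u).1 i).val < th u i ↔ u = v ∧ i = k} =
      Set.univ.pi fun u =>
        ((Fintype.piFinset (F u) ×ˢ (Finset.univ : Finset D) : Finset (SlotCoin σ N D)) :
          Set (SlotCoin σ N D)) := by
    ext x; simp [Set.mem_pi, F]
  rw [hset, roundProb_uniform_pi]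
  have hcard : ∀ u, ((Fintype.piFinset (F u) ×ˢ (Finset.univ : Finset D)).card : ℝ) /
        Fintype.card (SlotCoin σ N D) = ∏ i, ((F u i).card : ℝ) / N := by
    intro u
    rw [Finset.card_product, Fintype.card_piFinset, Fintype.card_prod, Fintype.card_fun,
      Fintype.card_fin, Fintype.card_fin, Finset.prod_div_distrib, Finset.card_univ]
    have hD : (Fintype.card D : ℝ) ≠ 0 := by exact_mod_cast Fintype.card_ne_zero
    push_cast
    rw [mul_div_mul_right _ _ hD]
    simp
  rw [Finset.prod_congr rfl fun u _ => hcard u, ← Fintype.prod_prod_type']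
  -- All slots of all nodes are independent, so they are treated as one family indexed by pairs.
  rw [← Fintype.sum_prod_type' (f := fun u i => (th u i : ℝ) / N)]
  refine mul_one_sub_sum_le_prod (fun a : Fin n × Fin σ => ((F a.1 a.2).card : ℝ) / N)
    (fun a => (th a.1 a.2 : ℝ) / N) (v, k) (fun a => by positivity) (fun a => ?_) ?_ ?_
  · rw [div_le_one hN]; exact_mod_cast hth _ _
  · simp only [F, and_self, iff_true]
    rw [card_fin_lt (hth v k)]
  · rintro ⟨u, i⟩ hne
    have : ¬ (u = v ∧ i = k) := fun h => hne (Prod.ext h.1 h.2)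
    simp only [F, this, iff_false]
    rw [card_fin_not_lt (hth u i), Nat.cast_sub (hth u i)]
    field_simp

/-- The probability that exactly one node draws `0` in the first component, that the node is in
`s`, and that its second component is the prescribed one. -/
theorem le_roundProb_lone_source (n g : ℕ) (s : Finset (Fin n)) (j : Fin n → Fin (g + 1)) :
    (s.card : ℝ) / (2 * (2 * n + 1) * (g + 1)) ≤
      roundProb (PMF.uniformOfFintype (SlotCoin σ N (Fin (2 * n + 1) × Fin (g + 1)))) n
        {x | ∃ v ∈ s, (x v).2 = (0, j v) ∧ ∀ u, u ≠ v → (x u).2.1 ≠ 0} := by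
  classical
  let B : Fin n → Fin n → Finset (SlotCoin σ N (Fin (2 * n + 1) × Fin (g + 1))) := fun v u =>
    if u = v then Finset.univ ×ˢ {(0, j v)}
    else Finset.univ ×ˢ (Finset.univ.erase 0 ×ˢ Finset.univ)
  have hB : ∀ v c, c ∈ B v v ↔ c.2 = (0, j v) := by
    intro v c
    simp only [B, if_true, Finset.mem_product, Finset.mem_univ, true_and, Finset.mem_singleton]
  have hB' : ∀ v u c, u ≠ v → (c ∈ B v u ↔ c.2.1 ≠ 0) := by
    intro v u c hu
    simp [B, hu]
  have hset : {x : Fin n → SlotCoin σ N (Fin (2 * n + 1) × Fin (g + 1)) |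
      ∃ v ∈ s, (x v).2 = (0, j v) ∧ ∀ u, u ≠ v → (x u).2.1 ≠ 0} =
      ⋃ v ∈ s, Set.univ.pi fun u => (B v u : Set _) := by
    ext x
    simp only [Set.mem_ofPred_eq, Set.mem_iUnion, Set.mem_pi, Set.mem_univ, true_imp_iff,
      exists_prop]
    refine exists_congr fun v => and_congr_right fun _ => ?_
    constructor
    · rintro ⟨h1, h2⟩ u
      by_cases h : u = v
      · subst h; exact (hB u _).2 h1
      · exact (hB' v u _ h).2 (h2 u h)
    · intro h
      exact ⟨(hB v _).1 (h v), fun u hu => (hB' v u _ hu).1 (h u)⟩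
  rw [hset, roundProb_biUnion]
  swap
  -- The events for different lone sources are disjoint, so their probabilities add up.
  · intro v _ w _ hvw
    rw [Function.onFun, Set.disjoint_left]
    intro x hv hw
    exact (hB' w v _ hvw).1 (hw v trivial) (by rw [(hB v _).1 (hv v trivial)])
  have hD : (Fintype.card (Fin σ → Fin N) : ℝ) ≠ 0 := by
    exact_mod_cast Fintype.card_ne_zero
  have hn : (0 : ℝ) < 2 * n + 1 := by positivity
  have hg : (0 : ℝ) < g + 1 := by positivity
  have hterm : ∀ v, 1 / (2 * (2 * n + 1) * (g + 1) : ℝ) ≤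
      roundProb (PMF.uniformOfFintype (SlotCoin σ N (Fin (2 * n + 1) × Fin (g + 1)))) n
        (Set.univ.pi fun u => (B v u : Set _)) := by
    intro v
    rw [roundProb_uniform_pi, ← Finset.mul_prod_erase Finset.univ _ (Finset.mem_univ v)]
    have h1 : ((B v v).card : ℝ) /
        Fintype.card (SlotCoin σ N (Fin (2 * n + 1) × Fin (g + 1))) =
        1 / ((2 * n + 1) * (g + 1)) := by
      simp only [B, if_true]
      rw [Finset.card_product, Finset.card_univ, Finset.card_singleton, Fintype.card_prod,
        Fintype.card_prod, Fintype.card_fin, Fintype.card_fin]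
      push_cast
      rw [mul_div_mul_left _ _ hD]
    have h2 : ∀ u, u ≠ v → ((B v u).card : ℝ) /
        Fintype.card (SlotCoin σ N (Fin (2 * n + 1) × Fin (g + 1))) = 1 - 1 / (2 * n + 1) := by
      intro u hu
      simp only [B, if_neg hu]
      rw [Finset.card_product, Finset.card_univ, Finset.card_product,
        Finset.card_erase_of_mem (Finset.mem_univ _), Finset.card_univ, Finset.card_univ,
        Fintype.card_prod, Fintype.card_prod, Fintype.card_fin, Fintype.card_fin]
      push_cast
      rw [mul_div_mul_left _ _ hD]
      field_simp
      simp
    rw [h1, Finset.prod_congr rfl fun u hu => h2 u (Finset.ne_of_mem_erase hu)]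
    -- At most `n - 1` other nodes draw `0` with probability `1 / (2 * n + 1)` each, so by the union
    -- bound none does with probability at least `1 / 2`.
    have h3 : (1 : ℝ) / 2 ≤ ∏ u ∈ Finset.univ.erase v, (1 - 1 / (2 * n + 1 : ℝ)) := by
      refine le_trans ?_ (one_sub_sum_le_prod _ _ ?_ ?_)
      · rw [Finset.sum_const, Finset.card_erase_of_mem (Finset.mem_univ _), Finset.card_univ,
          Fintype.card_fin, nsmul_eq_mul]
        have : ((n - 1 : ℕ) : ℝ) ≤ n := by exact_mod_cast Nat.sub_le n 1
        rw [le_sub_comm, sub_sub_cancel, mul_one_div, div_le_iff₀ hn]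
        linarith
      · intro u _
        rw [sub_nonneg, div_le_one hn]; linarith [(Nat.cast_nonneg n : (0 : ℝ) ≤ n)]
      · intro u _
        have : (0 : ℝ) ≤ 1 / (2 * n + 1) := by positivity
        linarith
    calc 1 / (2 * (2 * n + 1) * (g + 1) : ℝ) = 1 / ((2 * n + 1) * (g + 1)) * (1 / 2) := by
          field_simp
      _ ≤ _ := mul_le_mul_of_nonneg_left h3 (by positivity)
  calc (s.card : ℝ) / (2 * (2 * n + 1) * (g + 1)) =
      ∑ v ∈ s, 1 / (2 * (2 * n + 1) * (g + 1) : ℝ) := by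
        rw [Finset.sum_const, nsmul_eq_mul, mul_one_div]
    _ ≤ _ := Finset.sum_le_sum fun v _ => hterm v

end RoundProb

/-! ### Lists of known messages -/

section Learn

variable {M : Type} [DecidableEq M]

theorem prefix_learn (l ms : List M) : l <+: learn l ms := by
  induction ms generalizing l with
  | nil => exact List.prefix_rfl
  | cons m ms ih =>
    rw [learn]
    split_ifs
    · exact ih l
    · exact (List.prefix_append l [m]).trans (ih _)

theorem mem_learn {l ms : List M} {m : M} : m ∈ learn l ms ↔ m ∈ l ∨ m ∈ ms := by
  induction ms generalizing l with
  | nil => simp [learn]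
  | cons a ms ih =>
    rw [learn, ih]
    split_ifs with h
    · constructor
      · rintro (h' | h')
        exacts [Or.inl h', Or.inr (List.mem_cons_of_mem _ h')]
      · rintro (h' | h')
        · exact Or.inl h'
        · rcases List.mem_cons.1 h' with rfl | h'
          exacts [Or.inl h, Or.inr h']
    · simp [or_assoc]

theorem nodup_learn {l : List M} (hl : l.Nodup) (ms : List M) : (learn l ms).Nodup := by
  induction ms generalizing l with
  | nil => exact hl
  | cons a ms ih =>
    rw [learn]
    split_ifs with h
    · exact ih hl
    · refine ih (List.nodup_append.2 ⟨hl, List.nodup_singleton a, ?_⟩)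
      rintro x hx y hy rfl
      rw [List.mem_singleton] at hy
      exact h (hy ▸ hx)

theorem getElem?_of_prefix {α : Type*} {l l' : List α} (h : l <+: l') {i : ℕ} {m : α}
    (hi : l[i]? = some m) :
    l'[i]? = some m := by
  obtain ⟨t, rfl⟩ := h
  have : i < l.length := (List.getElem?_eq_some_iff.1 hi).1
  rw [List.getElem?_append_left this, hi]

theorem getElem?_idxOf_of_mem {l : List M} {m : M} (h : m ∈ l) : l[l.idxOf m]? = some m := by
  rw [List.getElem?_eq_some_iff]
  exact ⟨List.idxOf_lt_length_of_mem h, List.getElem_idxOf _⟩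

end Learn

/-! ### The channel -/

section Reception

variable {n : ℕ} {M : Type} {G : SimpleGraph (Fin n)} {tr : Fin n → Option (Packet M)}

/-- With a single transmitter in the whole network there are no collisions, so the rest of `G` is
irrelevant. This is what defeats the adaptive adversary. -/
theorem reception_of_sole_transmitter {u v : Fin n} {p : Packet M} (hv : tr v = some p)
    (hu : ∀ u, u ≠ v → tr u = none) (huv : G.Adj u v) : reception G tr u = some p := by
  have h : tr u = none ∧ ∃! w, G.Adj u w ∧ tr w ≠ none := by
    refine ⟨hu u huv.ne, v, ⟨huv, by simp [hv]⟩, fun w hw => ?_⟩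
    by_contra hne
    exact hw.2 (hu w hne)
  rw [reception, dif_pos h]
  have hc := h.2.choose_spec.1
  have : h.2.choose = v := by
    by_contra hne
    exact hc.2 (hu _ hne)
  rw [this, hv]

theorem exists_transmitter_of_reception {v : Fin n} {p : Packet M}
    (h : reception G tr v = some p) : ∃ u, G.Adj v u ∧ tr u = some p := by
  rw [reception] at h
  split_ifs at h with hh
  exact ⟨_, hh.2.choose_spec.1.1, h⟩

end Reception

/-! ### Invariants of executions -/

section Execution

variable {n : ℕ} {M : Type} (A : Algorithm n)

theorem transmission_eq_some {cfg : Fin n → NodeConfig A.State M} {x : Fin n → A.Coin} {v : Fin n}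
    {p : Packet M} : transmission A cfg x v = some p ↔ ∃ p', A.send v (cfg v).st (x v) = some p' ∧
      p = { msgs := p'.msgs.filterMap fun i => (cfg v).known[i]?, ctrl := p'.ctrl } := by
  rw [transmission, Option.map_eq_some_iff]
  exact exists_congr fun _ => and_congr_right fun _ => eq_comm

theorem transmission_eq_none {cfg : Fin n → NodeConfig A.State M} {x : Fin n → A.Coin}
    {v : Fin n} : transmission A cfg x v = none ↔ A.send v (cfg v).st (x v) = none := by
  rw [transmission, Option.map_eq_none_iff]

theorem mem_transmission_msgs {cfg : Fin n → NodeConfig A.State M} {x : Fin n → A.Coin}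
    {v : Fin n} {p : Packet M} (h : transmission A cfg x v = some p) {m : M} (hm : m ∈ p.msgs) :
    m ∈ (cfg v).known := by
  obtain ⟨p', _, rfl⟩ := (transmission_eq_some A).1 h
  obtain ⟨i, _, hi⟩ := List.mem_filterMap.1 hm
  exact List.mem_of_getElem? hi

theorem stableGraph_adj {V : Type} {G : ℕ → SimpleGraph V} {u v : V}
    (h : (stableGraph G 0 ⊤).Adj u v) (r : ℕ) : (G r).Adj u v :=
  h.2 r (Nat.zero_le r) (by simp)

variable [DecidableEq M]

theorem updateNode_known_prefix (v : Fin n) (nc : NodeConfig A.State M) (x : A.Coin)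
    (y : Option (Packet M)) : nc.known <+: (updateNode A v nc x y).known := by
  cases y with
  | none => exact List.prefix_rfl
  | some p => exact prefix_learn _ _

variable (inp : Fin n → List M) (G : ℕ → SimpleGraph (Fin n)) (ω : ℕ → Fin n → A.Coin)

theorem run_succ (r : ℕ) (v : Fin n) : run A inp G ω (r + 1) v =
    updateNode A v (run A inp G ω r v) (ω r v)
      (reception (G r) (transmission A (run A inp G ω r) (ω r)) v) := rfl

/-- Known messages are only appended, so a handle keeps its meaning forever. -/
theorem run_known_prefix {r r' : ℕ} (h : r ≤ r') (v : Fin n) :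
    (run A inp G ω r v).known <+: (run A inp G ω r' v).known := by
  induction r', h using Nat.le_induction with
  | base => exact List.prefix_rfl
  | succ r' _ ih => exact ih.trans (updateNode_known_prefix A v _ _ _)

theorem run_known_nodup (h : ∀ v, (inp v).Nodup) (r : ℕ) (v : Fin n) :
    (run A inp G ω r v).known.Nodup := by
  induction r with
  | zero => exact h v
  | succ r ih =>
    rw [run_succ]
    rcases reception (G r) (transmission A (run A inp G ω r) (ω r)) v with _ | p
    exacts [ih, nodup_learn ih _]

theorem exists_source_of_mem_known (r : ℕ) (v : Fin n) {m : M}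
    (hm : m ∈ (run A inp G ω r v).known) : ∃ u, m ∈ inp u := by
  induction r generalizing v with
  | zero => exact ⟨v, hm⟩
  | succ r ih =>
    rw [run_succ] at hm
    rcases hy : reception (G r) (transmission A (run A inp G ω r) (ω r)) v with _ | p
    · rw [hy] at hm; exact ih v hm
    · rw [hy] at hm
      rcases mem_learn.1 hm with h | h
      · exact ih v h
      · obtain ⟨u, _, hu⟩ := exists_transmitter_of_reception hy
        exact ih u (mem_transmission_msgs A hu h)

theorem nodup_length_le_of_subset_inp {inp : Fin n → List M} {s : ℕ}
    (hinp : IsInput inp s) {l : List M}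
    (hl : l.Nodup) (h : ∀ m ∈ l, ∃ u, m ∈ inp u) : l.length ≤ s := by
  have h1 : l.toFinset ⊆ Finset.univ.biUnion fun u => (inp u).toFinset := by
    intro m hm
    obtain ⟨u, hu⟩ := h m (List.mem_toFinset.1 hm)
    exact Finset.mem_biUnion.2 ⟨u, Finset.mem_univ u, List.mem_toFinset.2 hu⟩
  calc l.length = l.toFinset.card := (List.toFinset_card_of_nodup hl).symm
    _ ≤ _ := Finset.card_le_card h1
    _ ≤ ∑ u, (inp u).toFinset.card := Finset.card_biUnion_le
    _ ≤ ∑ u, (inp u).length := Finset.sum_le_sum fun u _ => List.toFinset_card_le _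
    _ = s := hinp.card

theorem run_known_length_le {s : ℕ} (hinp : IsInput inp s) (r : ℕ) (v : Fin n) :
    (run A inp G ω r v).known.length ≤ s :=
  nodup_length_le_of_subset_inp hinp (run_known_nodup A inp G ω hinp.nodup r v)
    fun _ hm => exists_source_of_mem_known A inp G ω r v hm

/-- The configuration after `r` rounds is determined by the coins of these rounds. -/
theorem run_dependsOn {adv : (ℕ → Fin n → A.Coin) → ℕ → SimpleGraph (Fin n)}
    (hadv : IsOblivious adv 0) (r : ℕ) :
    DependsOn (fun ω => run A inp (adv ω) ω r) (Set.Iio r) := by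
  induction r with
  | zero => intro ω ω' _; rfl
  | succ r ih =>
    intro ω ω' h
    have h1 : run A inp (adv ω) ω r = run A inp (adv ω') ω' r :=
      ih fun i hi => h i (lt_trans hi (Nat.lt_succ_self r))
    -- A `0`-oblivious graph may use the coins of round `r` itself, which are among those that
    -- determine the configuration after that round.
    have h2 : adv ω r = adv ω' r := hadv ω ω' r fun r' hr' => h r' (Nat.lt_succ_of_le hr')
    have h3 : ω r = ω' r := h r (Nat.lt_succ_self r)
    funext v
    simp only [run_succ, h1, h2, h3]

/-- It suffices to bound the probability of a set that contains all failures. -/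
theorem le_coinMeasure_of_compl_subset {S bad : Set (ℕ → Fin n → A.Coin)} {ε : ℝ} (hε : 0 ≤ ε)
    (hsub : ∀ ω, ω ∉ bad → ω ∈ S) (hbad : coinMeasure A bad ≤ ENNReal.ofReal ε) :
    1 - ε ≤ (coinMeasure A S).toReal := by
  let _ : MeasurableSpace A.Coin := ⊤
  have hP : IsProbabilityMeasure (coinMeasure A) :=
    inferInstanceAs (IsProbabilityMeasure
      (Measure.infinitePi fun _ : ℕ => Measure.pi fun _ : Fin n => A.law.toMeasure))
  have h1 : (1 : ENNReal) ≤ coinMeasure A S + ENNReal.ofReal ε := by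
    calc (1 : ENNReal) = coinMeasure A Set.univ := hP.measure_univ.symm
      _ ≤ coinMeasure A (S ∪ bad) := measure_mono fun ω _ => by
          by_cases h : ω ∈ bad
          exacts [Or.inr h, Or.inl (hsub ω h)]
      _ ≤ coinMeasure A S + coinMeasure A bad := measure_union_le _ _
      _ ≤ _ := by gcongr
  have h2 : coinMeasure A S ≠ ⊤ := measure_ne_top _ _
  have h3 := ENNReal.toReal_mono (by simp [h2]) h1
  rw [ENNReal.toReal_add h2 (by simp), ENNReal.toReal_ofReal hε, ENNReal.toReal_one] at h3
  linarith

end Execution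

/-! ### Harmonic broadcast: busy and free rounds -/

section Harmonic

/-- The threshold below which the number drawn from `Fin N` has to be for a transmission in
round `r` by an agent that is awake since round `w`: it is reached with probability
`1 / (1 + (r - w) / Θ)` (rounded). An agent that is not awake never transmits. -/
def threshold (N Θ : ℕ) (w : Option ℕ) (r : ℕ) : ℕ :=
  w.elim 0 fun w => N / (1 + (r - w) / Θ)

theorem threshold_le (N Θ : ℕ) (w : Option ℕ) (r : ℕ) : threshold N Θ w r ≤ N := by
  cases w with
  | none => exact Nat.zero_le _
  | some w => exact Nat.div_le_self _ _

variable {n σ : ℕ}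

/-- The expected number of transmissions in round `r`. -/
noncomputable def mass (N Θ : ℕ) (W : Fin n → Fin σ → Option ℕ) (r : ℕ) : ℝ :=
  ∑ u, ∑ i, (threshold N Θ (W u i) r : ℝ) / N

open Classical in
/-- `1` if the round is busy and `-1` if it is free. -/
noncomputable def score (N Θ : ℕ) (W : Fin n → Fin σ → Option ℕ) (r : ℕ) : ℤ :=
  if 1 / 2 < mass N Θ W r then 1 else -1

theorem neg_one_le_score (N Θ : ℕ) (W : Fin n → Fin σ → Option ℕ) (r : ℕ) :
    -1 ≤ score N Θ W r := by
  rw [score]; split_ifs <;> norm_num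

theorem mass_nonneg (N Θ : ℕ) (W : Fin n → Fin σ → Option ℕ) (r : ℕ) : 0 ≤ mass N Θ W r :=
  Finset.sum_nonneg fun _ _ => Finset.sum_nonneg fun _ _ => by positivity

theorem le_mass (N Θ : ℕ) (W : Fin n → Fin σ → Option ℕ) (r : ℕ) (v : Fin n) (k : Fin σ) :
    (threshold N Θ (W v k) r : ℝ) / N ≤ mass N Θ W r :=
  (Finset.single_le_sum (f := fun i => (threshold N Θ (W v i) r : ℝ) / N)
    (fun _ _ => by positivity) (Finset.mem_univ k)).trans
    (Finset.single_le_sum (f := fun u => ∑ i, (threshold N Θ (W u i) r : ℝ) / N)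
      (fun _ _ => Finset.sum_nonneg fun _ _ => by positivity) (Finset.mem_univ v))

/-- A round is busy if an agent is awake for less than `Θ` rounds. -/
theorem score_eq_one_of_recent {N Θ : ℕ} (hN : N ≠ 0) {W : Fin n → Fin σ → Option ℕ} {r : ℕ}
    {v : Fin n} {k : Fin σ} {w : ℕ} (hw : W v k = some w) (hwr : w ≤ r) (hr : r < w + Θ) :
    score N Θ W r = 1 := by
  have h1 := le_mass N Θ W r v k
  have h2 : threshold N Θ (W v k) r = N := by
    rw [hw]; simp only [threshold, Option.elim]
    rw [Nat.div_eq_of_lt (by omega : r - w < Θ)]; simp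
  rw [h2, div_self (by exact_mod_cast hN)] at h1
  rw [score, if_pos (by linarith)]

/-- Only the given agent transmits. -/
def OnlyFires {N : ℕ} {D : Type} (Θ : ℕ) (W : Fin n → Fin σ → Option ℕ) (r : ℕ) (v : Fin n)
    (k : Fin σ) (x : Fin n → SlotCoin σ N D) : Prop :=
  ∀ u i, ((x u).1 i).val < threshold N Θ (W u i) r ↔ u = v ∧ i = k

/-- If at least half of the rounds since `w` are free then the transmission probabilities of an
agent awake since `w` in free rounds add up. -/
theorem le_sum_free_of_sum_score_nonpos {N Θ : ℕ} (hN : N ≠ 0) {T : ℕ}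
    (hdvd : ∀ j, 1 ≤ j → j ≤ T → j ∣ N) (W : ℕ → Fin n → Fin σ → Option ℕ) {v : Fin n} {k : Fin σ}
    {w e : ℕ} (hwe : w < e) (heT : e ≤ T) (hW : ∀ r, w ≤ r → r < e → W r v k = some w)
    (hs : ∑ r ∈ Finset.Ico w e, score N Θ (W r) r ≤ 0) :
    (Θ : ℝ) / 8 ≤ ∑ r ∈ Finset.Ico w e,
      if 1 / 2 < mass N Θ (W r) r then 0 else (threshold N Θ (W r v k) r : ℝ) / N / 2 := by
  classical
  -- During its first `Θ` rounds the agent transmits with certainty, so these rounds are busy. If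
  -- there were no others, the sum of the scores would be positive.
  have hlen : w + Θ < e := by
    by_contra hcon
    have : ∑ r ∈ Finset.Ico w e, score N Θ (W r) r = ∑ r ∈ Finset.Ico w e, 1 :=
      Finset.sum_congr rfl fun r hr => by
        rw [Finset.mem_Ico] at hr
        exact score_eq_one_of_recent hN (hW r hr.1 hr.2) hr.1 (by omega)
    rw [this] at hs
    simp only [Finset.sum_const, Nat.card_Ico, nsmul_eq_mul, mul_one] at hs
    omega
  set F := (Finset.Ico w e).filter fun r => ¬ 1 / 2 < mass N Θ (W r) r with hF
  have hcount : ((e - w : ℕ) : ℝ) ≤ 2 * F.card := by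
    have h1 : ∑ r ∈ Finset.Ico w e, score N Θ (W r) r =
        ((Finset.Ico w e).card : ℤ) - 2 * F.card := by
      have : ∀ r, score N Θ (W r) r = 1 - 2 * (if ¬ 1 / 2 < mass N Θ (W r) r then 1 else 0) := by
        intro r
        rw [score]
        split_ifs <;> simp_all
      simp only [this]
      rw [Finset.sum_sub_distrib, ← Finset.mul_sum, Finset.sum_boole, ← hF]
      simp
    rw [h1, Nat.card_Ico] at hs
    have : ((e - w : ℕ) : ℤ) ≤ 2 * F.card := by linarith
    exact_mod_cast this
  -- The probability is `1 / (1 + ⌊(r - w) / Θ⌋)`, exactly, because the denominator divides `N`; the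
  -- denominator is at most `2 * (e - w) / Θ` since `Θ < e - w`. The last factor `1 / 2` is the
  -- price for being alone in a free round. With at least `(e - w) / 2` free rounds the total is `Θ
  -- / 8`.
  have hterm : ∀ r ∈ F, (Θ : ℝ) / (4 * (e - w : ℕ)) ≤ (threshold N Θ (W r v k) r : ℝ) / N / 2 := by
    intro r hr
    rw [hF, Finset.mem_filter, Finset.mem_Ico] at hr
    have hj : 1 + (r - w) / Θ ≤ T := by
      have := Nat.div_le_self (r - w) Θ
      omega
    have hN' : (N : ℝ) ≠ 0 := by exact_mod_cast hN
    rw [hW r hr.1.1 hr.1.2]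
    simp only [threshold, Option.elim]
    rw [Nat.cast_div (hdvd _ (Nat.le_add_right 1 _) hj) (by positivity), div_div_cancel_left' hN']
    have h2 : ((1 + (r - w) / Θ : ℕ) : ℝ) * Θ ≤ 2 * (e - w : ℕ) := by
      have : (1 + (r - w) / Θ) * Θ ≤ 2 * (e - w) := by
        have := Nat.div_mul_le_self (r - w) Θ
        rw [add_mul, one_mul]
        omega
      exact_mod_cast this
    have h3 : (0 : ℝ) < (e - w : ℕ) := by exact_mod_cast (by omega : 0 < e - w)
    have h4 : (0 : ℝ) < (1 + (r - w) / Θ : ℕ) := by positivity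
    rw [inv_eq_one_div, div_div, div_le_div_iff₀ (by positivity) (by positivity)]
    linarith
  have hsum : ∑ r ∈ F, (threshold N Θ (W r v k) r : ℝ) / N / 2 = ∑ r ∈ Finset.Ico w e,
      if 1 / 2 < mass N Θ (W r) r then 0 else (threshold N Θ (W r v k) r : ℝ) / N / 2 := by
    rw [hF, Finset.sum_filter]
    exact Finset.sum_congr rfl fun r _ => by split_ifs <;> simp_all
  rw [← hsum]
  refine le_trans ?_ (Finset.card_nsmul_le_sum F _ _ hterm)
  have h3 : (0 : ℝ) < (e - w : ℕ) := by exact_mod_cast (by omega : 0 < e - w)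
  rw [nsmul_eq_mul, ← mul_div_assoc, div_le_div_iff₀ (by norm_num) (by positivity)]
  nlinarith [hcount, (Nat.cast_nonneg Θ : (0 : ℝ) ≤ Θ)]

/-- An algorithm with fair coins. -/
noncomputable abbrev slotAlgorithm (n σ N : ℕ) (D : Type) [NeZero N] [Fintype D] [Nonempty D]
    (State : Type) (init : Fin n → ℕ → State)
    (send : Fin n → State → SlotCoin σ N D → Option (Packet ℕ))
    (next : Fin n → State → SlotCoin σ N D → Option (Packet ℕ) → State) : Algorithm n where
  Coin := SlotCoin σ N D
  coinFintype := inferInstance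
  law := PMF.uniformOfFintype _
  State := State
  init := init
  send := send
  next := next

variable {N : ℕ} {D : Type} [NeZero N] [Fintype D] [Nonempty D] {State : Type}
  {init : Fin n → ℕ → State} {send : Fin n → State → SlotCoin σ N D → Option (Packet ℕ)}
  {next : Fin n → State → SlotCoin σ N D → Option (Packet ℕ) → State}

/-- The set of coins for which an agent that is awake since some round of the window `[t₀, T)` is
not the only one to transmit in any round until at least half of the rounds have been free. -/
def notIsolated (Θ t₀ T : ℕ) (W : (ℕ → Fin n → SlotCoin σ N D) → ℕ → Fin n → Fin σ → Option ℕ)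
    (v : Fin n) (k : Fin σ) : Set (ℕ → Fin n → SlotCoin σ N D) :=
  {ω | ∃ w e, t₀ ≤ w ∧ w < e ∧ e ≤ T ∧ (∀ r, w ≤ r → r < e → W ω r v k = some w) ∧
    (∀ r, t₀ ≤ r → r < w → W ω r v k = none) ∧
    ∑ r ∈ Finset.Ico w e, score N Θ (W ω r) r ≤ 0 ∧
    ∀ r, w ≤ r → r < e → ¬ OnlyFires Θ (W ω r) r v k (ω r)}

theorem measure_notIsolated_le (Θ t₀ : ℕ) {T : ℕ}
    (hdvd : ∀ j, 1 ≤ j → j ≤ T → j ∣ N)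
    (W : (ℕ → Fin n → SlotCoin σ N D) → ℕ → Fin n → Fin σ → Option ℕ)
    (hW : ∀ r, DependsOn (fun ω => W ω r) (Set.Iio r)) (v : Fin n) (k : Fin σ) :
    coinMeasure (slotAlgorithm n σ N D State init send next) (notIsolated Θ t₀ T W v k) ≤
      ENNReal.ofReal (Real.exp (-(Θ / 8))) := by
  classical
  have hN : N ≠ 0 := NeZero.ne N
  -- The trial of round `r` is that the agent is alone. Its bound `p / 2` is used in free rounds
  -- only, and whether a round is free is decided by the past.
  refine (measure_mono ?_).trans (coinMeasure_no_success_le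
    (slotAlgorithm n σ N D State init send next)
    (fun ω r => if t₀ ≤ r ∧ ¬ 1 / 2 < mass N Θ (W ω r) r then
      (threshold N Θ (W ω r v k) r : ℝ) / N / 2 else 0)
    (fun ω r => t₀ ≤ r ∧ OnlyFires Θ (W ω r) r v k (ω r)) ?_ ?_ ?_ ?_ (Θ / 8) T)
  · rintro ω ⟨w, e, htw, hwe, heT, hawake, hnone, hs, hno⟩
    refine ⟨e, heT, ?_, ?_⟩
    · rintro r hr ⟨htr, hfire⟩
      by_cases hrw : w ≤ r
      · exact hno r hrw hr hfire
      · have := (hfire v k).2 ⟨rfl, rfl⟩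
        rw [hnone r htr (not_le.1 hrw)] at this
        simp [threshold] at this
    · refine (le_sum_free_of_sum_score_nonpos hN hdvd (W ω) hwe heT hawake hs).trans ?_
      refine le_trans (Finset.sum_le_sum (g := fun r =>
        if t₀ ≤ r ∧ ¬ 1 / 2 < mass N Θ (W ω r) r then
          (threshold N Θ (W ω r v k) r : ℝ) / N / 2 else 0) fun r hr => ?_)
        (Finset.sum_le_sum_of_subset_of_nonneg ?_ fun r _ _ => ?_)
      · have : t₀ ≤ r := htw.trans (Finset.mem_Ico.1 hr).1
        simp only [this, true_and]
        split_ifs <;> simp_all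
      · intro r hr
        exact Finset.mem_range.2 (Finset.mem_Ico.1 hr).2
      · split_ifs <;> positivity
  · intro r ω ω' h
    have := hW r h
    simp only at this ⊢
    rw [this]
  · intro r ω ω' h
    have h1 := hW r fun i hi => h i (lt_trans (Set.mem_Iio.1 hi) (Nat.lt_succ_self r))
    have h2 := h r (Nat.lt_succ_self r)
    simp only at h1 ⊢
    rw [h1, h2]
  · intro ω r
    split_ifs <;> positivity
  · intro ω r
    have h1 : ∀ x, W (Function.update ω r x) r = W ω r := fun x =>
      hW r fun i hi => Function.update_of_ne (Set.mem_Iio.1 hi).ne _ _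
    simp only [h1, Function.update_self]
    split_ifs with h
    · simp only [h.1, true_and]
      refine le_trans ?_ (le_roundProb_only_slot n (fun u i => threshold N Θ (W ω r u i) r)
        (fun u i => threshold_le N Θ _ r) v k)
      rw [div_eq_mul_one_div _ (2 : ℝ)]
      refine mul_le_mul_of_nonneg_left ?_ (by positivity)
      have := not_lt.1 h.2
      rw [mass] at this
      linarith
    · exact roundProb_nonneg _ _ _

/-- If every informed node spreads the information to its neighbors by the time at least half of
the rounds since it was informed have been free, and the rounds in which a node was just
informed are busy, then at least half of the rounds are busy until all nodes are informed. -/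
theorem sum_score_nonneg_of_spread {V : Type} {H : SimpleGraph V} (hH : H.Connected)
    {I : ℕ → Set V} (hI : Monotone I) {t₀ T : ℕ} (h0 : (I t₀).Nonempty) {sc : ℕ → ℤ}
    (hsc : ∀ r, -1 ≤ sc r)
    (hnew : ∀ v w, t₀ ≤ w → w < T → v ∈ I w → (w = t₀ ∨ v ∉ I (w - 1)) → sc w = 1)
    (hspread : ∀ v w e, t₀ ≤ w → w < e → e ≤ T → v ∈ I w → (w = t₀ ∨ v ∉ I (w - 1)) →
      ∑ r ∈ Finset.Ico w e, sc r ≤ 0 → ∀ u, H.Adj v u → u ∈ I e) (τ : ℕ) (htτ : t₀ ≤ τ)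
    (hτT : τ ≤ T) (hτ : τ = t₀ ∨ I (τ - 1) ≠ Set.univ) : 0 ≤ ∑ r ∈ Finset.Ico t₀ τ, sc r := by
  induction τ using Nat.strong_induction_on with
  | _ τ ih =>
    rcases eq_or_lt_of_le htτ with rfl | hlt
    · simp
    have hne : I (τ - 1) ≠ Set.univ := hτ.resolve_left (by omega)
    -- An edge from an informed to an uninformed node just before `τ`. The rounds are split at the
    -- time `w` at which `v` was informed; before `w` the induction hypothesis applies.
    obtain ⟨v, hv, u, hu, hadj⟩ : ∃ v ∈ I (τ - 1), ∃ u, u ∉ I (τ - 1) ∧ H.Adj v u := by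
      obtain ⟨a, ha⟩ := h0
      obtain ⟨b, hb⟩ := (Set.ne_univ_iff_exists_notMem _).1 hne
      obtain ⟨p⟩ := hH.preconnected a b
      obtain ⟨d, hd, h1, h2⟩ := p.exists_boundary_dart (I (τ - 1)) (hI (by omega) ha) hb
      exact ⟨d.fst, h1, d.snd, h2, d.adj⟩
    classical
    have hex : ∃ w, t₀ ≤ w ∧ v ∈ I w := ⟨τ - 1, by omega, hv⟩
    obtain ⟨htw, hvw⟩ := Nat.find_spec hex
    set w := Nat.find hex with hw
    have hwτ : w ≤ τ - 1 := Nat.find_min' hex ⟨by omega, hv⟩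
    have hfirst : w = t₀ ∨ v ∉ I (w - 1) := by
      rcases eq_or_lt_of_le htw with h | h
      · exact Or.inl h.symm
      · refine Or.inr fun hmem => ?_
        exact Nat.find_min hex (m := w - 1) (by omega) ⟨by omega, hmem⟩
    have h1 : 0 ≤ ∑ r ∈ Finset.Ico t₀ w, sc r := by
      refine ih w (by omega) htw (by omega) (hfirst.imp_right fun h h' => h (h' ▸ Set.mem_univ v))
    rw [← Finset.sum_Ico_consecutive _ htw (by omega : w ≤ τ)]
    have h2 : 0 ≤ ∑ r ∈ Finset.Ico w τ, sc r := by
      have hsplit : ∑ r ∈ Finset.Ico w τ, sc r =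
          ∑ r ∈ Finset.Ico w (τ - 1), sc r + sc (τ - 1) := by
        conv_lhs => rw [show τ = τ - 1 + 1 by omega]
        rw [Finset.sum_Ico_succ_top hwτ]
      rw [hsplit]
      -- Either `τ - 1` is the busy round in which `v` was just informed, or the scores on `[w, τ -
      -- 1)` have a positive sum because `u` is still uninformed; being integers they sum to at
      -- least `1`, which pays for a last score of `-1`.
      rcases eq_or_lt_of_le hwτ with h | h
      · rw [h]
        simp only [Finset.Ico_self, Finset.sum_empty, zero_add]
        rw [← h, hnew v w htw (by omega) hvw hfirst]
        norm_num
      · have : ¬ ∑ r ∈ Finset.Ico w (τ - 1), sc r ≤ 0 := fun hle =>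
          hu (hspread v w (τ - 1) htw h (by omega) hvw hfirst hle u hadj)
        linarith [hsc (τ - 1)]
    linarith

/-- The rounds after the wake-up form blocks of length `Θ`, and in the `j`-th block the probability
is at most `1 / j`, so each block contributes at most `Θ / j`. -/
theorem sum_threshold_le {N Θ m : ℕ} (hΘ : 0 < Θ) {t₀ T : ℕ} (hT : T ≤ t₀ + Θ * m)
    {w : ℕ} {W : ℕ → Option ℕ} (hW : ∀ r, t₀ ≤ r → r < T → W r = none ∨ W r = some w) (hw : t₀ ≤ w)
    (hwr : ∀ r, t₀ ≤ r → r < w → W r = none) :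
    ∑ r ∈ Finset.Ico t₀ T, (threshold N Θ (W r) r : ℝ) / N ≤ Θ * (harmonic m : ℚ) := by
  have h1 : ∀ r ∈ Finset.Ico t₀ T, (threshold N Θ (W r) r : ℝ) / N ≤
      if w ≤ r then 1 / ((1 + (r - w) / Θ : ℕ) : ℝ) else 0 := by
    intro r hr
    rw [Finset.mem_Ico] at hr
    split_ifs with h
    · rcases hW r hr.1 hr.2 with h' | h'
      · rw [h']; simp only [threshold, Option.elim]; simp; positivity
      · rw [h']; simp only [threshold, Option.elim]
        rcases eq_or_ne N 0 with rfl | hN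
        · simp; positivity
        have hN' : (0 : ℝ) < N := by exact_mod_cast Nat.pos_of_ne_zero hN
        rw [div_le_iff₀ hN', one_div_mul_eq_div]
        exact Nat.cast_div_le
    · rw [hwr r hr.1 (not_le.1 h)]; simp [threshold]
  refine (Finset.sum_le_sum h1).trans ?_
  rw [← Finset.sum_filter]
  have h2 : ∑ r ∈ (Finset.Ico t₀ T).filter (w ≤ ·), 1 / ((1 + (r - w) / Θ : ℕ) : ℝ) ≤
      ∑ d ∈ Finset.range (Θ * m), 1 / ((1 + d / Θ : ℕ) : ℝ) := by
    have hinj : Set.InjOn (fun r => r - w) ((Finset.Ico t₀ T).filter (w ≤ ·) : Finset ℕ) := by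
      intro a ha b hb hab
      simp only [Finset.coe_filter, Finset.mem_Ico, Set.mem_ofPred_eq] at ha hb hab
      omega
    rw [← Finset.sum_image (f := fun d => 1 / ((1 + d / Θ : ℕ) : ℝ)) hinj]
    refine Finset.sum_le_sum_of_subset_of_nonneg ?_ fun _ _ _ => by positivity
    intro d hd
    obtain ⟨r, hr, rfl⟩ := Finset.mem_image.1 hd
    rw [Finset.mem_filter, Finset.mem_Ico] at hr
    rw [Finset.mem_range]
    omega
  refine h2.trans (le_of_eq ?_)
  clear hT h2
  induction m with
  | zero => simp
  | succ m ih =>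
    rw [Nat.mul_succ, Finset.sum_range_add, ih, harmonic_succ]
    have : ∀ d ∈ Finset.range Θ, 1 / ((1 + (Θ * m + d) / Θ : ℕ) : ℝ) = ((m + 1 : ℕ) : ℝ)⁻¹ := by
      intro d hd
      rw [Nat.mul_add_div hΘ, Nat.div_eq_of_lt (Finset.mem_range.1 hd), add_zero, add_comm, one_div]
    rw [Finset.sum_congr rfl this]
    simp
    ring

/-- The harmonic broadcast is complete by the end of the window `[t₀, T)`. Here `k v` is the agent
of node `v` that spreads the information, and `s` contains all agents that are ever awake. -/
theorem informed_eq_univ_of_long_window {N Θ m : ℕ} (hN : N ≠ 0) (hΘ : 0 < Θ) {t₀ T : ℕ}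
    (htT : t₀ < T) (hT : T ≤ t₀ + Θ * m) {H : SimpleGraph (Fin n)} (hH : H.Connected)
    {I : ℕ → Set (Fin n)} (hI : Monotone I) (h0 : (I t₀).Nonempty)
    {W : ℕ → Fin n → Fin σ → Option ℕ} (k : Fin n → Fin σ)
    (hawake : ∀ v w, t₀ ≤ w → w < T → v ∈ I w → (w = t₀ ∨ v ∉ I (w - 1)) → W w v (k v) = some w)
    (hspread : ∀ v w e, t₀ ≤ w → w < e → e ≤ T → v ∈ I w → (w = t₀ ∨ v ∉ I (w - 1)) →
      ∑ r ∈ Finset.Ico w e, score N Θ (W r) r ≤ 0 → ∀ u, H.Adj v u → u ∈ I e)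
    (s : Finset (Fin n × Fin σ))
    (hs : ∀ u i, (u, i) ∉ s → ∀ r, t₀ ≤ r → r < T → W r u i = none)
    (hwake : ∀ u i, ∃ w, t₀ ≤ w ∧ (∀ r, t₀ ≤ r → r < T → W r u i = none ∨ W r u i = some w) ∧
      ∀ r, t₀ ≤ r → r < w → W r u i = none)
    (hlong : 4 * (s.card * (Θ * (harmonic m : ℚ))) < ((T - t₀ : ℕ) : ℝ)) :
    I (T - 1) = Set.univ := by
  classical
  by_contra hne
  have hscore := sum_score_nonneg_of_spread hH hI h0 (sc := fun r => score N Θ (W r) r)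
    (T := T) (fun r => neg_one_le_score N Θ _ r)
    (fun v w h1 h2 h3 h4 => score_eq_one_of_recent hN (hawake v w h1 h2 h3 h4) le_rfl (by omega))
    hspread T htT.le le_rfl (Or.inr hne)
  have hmass : ∑ r ∈ Finset.Ico t₀ T, mass N Θ (W r) r ≤ s.card * (Θ * (harmonic m : ℚ)) := by
    have h1 : ∀ r ∈ Finset.Ico t₀ T, mass N Θ (W r) r =
        ∑ a ∈ s, (threshold N Θ (W r a.1 a.2) r : ℝ) / N := by
      intro r hr
      rw [Finset.mem_Ico] at hr
      rw [mass, ← Fintype.sum_prod_type' (f := fun u i => (threshold N Θ (W r u i) r : ℝ) / N)]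
      refine (Finset.sum_subset (Finset.subset_univ s) fun a _ ha => ?_).symm
      rw [hs a.1 a.2 ha r hr.1 hr.2]
      simp [threshold]
    rw [Finset.sum_congr rfl h1, Finset.sum_comm, ← nsmul_eq_mul]
    refine Finset.sum_le_card_nsmul s _ _ fun a _ => ?_
    obtain ⟨w, h1, h2, h3⟩ := hwake a.1 a.2
    exact sum_threshold_le hΘ hT h2 h1 h3
  -- A busy round has mass above `1 / 2`. Summed up, nonnegative total score forces the length of
  -- the window to be at most four times its total mass.
  have hpoint : ∀ r, (score N Θ (W r) r : ℝ) ≤ 4 * mass N Θ (W r) r - 1 := by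
    intro r
    have := mass_nonneg N Θ (W r) r
    rw [score]
    split_ifs with h
    · push_cast; linarith
    · push_cast; linarith
  have h1 : (0 : ℝ) ≤ ∑ r ∈ Finset.Ico t₀ T, (score N Θ (W r) r : ℝ) := by exact_mod_cast hscore
  have h2 := h1.trans (Finset.sum_le_sum fun r _ => hpoint r)
  rw [Finset.sum_sub_distrib, ← Finset.mul_sum, Finset.sum_const, Nat.card_Ico, nsmul_eq_mul,
    mul_one] at h2
  linarith

end Harmonic

/-! ### Counting known messages from handles -/

section Count

theorem foldr_max_le {l : List ℕ} {a b : ℕ} : l.foldr max a ≤ b ↔ a ≤ b ∧ ∀ x ∈ l, x ≤ b := by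
  induction l with
  | nil => simp
  | cons x l ih =>
    simp only [List.foldr_cons, max_le_iff, ih, List.mem_cons, forall_eq_or_imp]
    tauto

variable {M : Type} [DecidableEq M]

/-- The number of known messages after a reception can be computed from the handles. -/
theorem foldr_max_idxOf_learn {l : List M} (hl : l.Nodup) (ms : List M) :
    ((ms.map fun m => (learn l ms).idxOf m).map (· + 1)).foldr max l.length =
      (learn l ms).length := by
  apply le_antisymm
  · rw [foldr_max_le]
    refine ⟨(prefix_learn l ms).length_le, fun x hx => ?_⟩
    simp only [List.map_map, List.mem_map, Function.comp_apply] at hx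
    obtain ⟨m, hm, rfl⟩ := hx
    exact List.idxOf_lt_length_of_mem (mem_learn.2 (Or.inr hm))
  · obtain ⟨h1, h2⟩ := (foldr_max_le (b := ((ms.map fun m => (learn l ms).idxOf m).map
      (· + 1)).foldr max l.length)).1 le_rfl
    by_contra hlt
    rw [not_le] at hlt
    set b := ((ms.map fun m => (learn l ms).idxOf m).map (· + 1)).foldr max l.length with hb
    have hnd := nodup_learn hl ms
    -- Position `b` lies beyond the old list and entries are distinct, so the message there is new
    -- and its handle occurs in the packet.
    have hmem : (learn l ms)[b] ∈ ms := by
      rcases mem_learn.1 (List.getElem_mem hlt) with h | h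
      · exfalso
        obtain ⟨i, hi, hi'⟩ := List.getElem_of_mem h
        have h3 := (prefix_learn l ms).getElem hi
        have h4 := (hnd.getElem_inj_iff).1 (h3.symm.trans hi')
        omega
      · exact h
    have := h2 ((learn l ms).idxOf (learn l ms)[b] + 1)
      (List.mem_map.2 ⟨_, List.mem_map.2 ⟨_, hmem, rfl⟩, rfl⟩)
    rw [hnd.idxOf_getElem] at this
    omega

end Count

/-! ### Deterministic round robin with pipelining -/

section Pipeline

/-- `count` is the number of known messages and `sent` the length of the initial segment of them
already sent. -/
structure PipelineState where
  round : ℕ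
  count : ℕ
  sent : ℕ

/-- Round robin: in its turn, a node sends the next `c` messages that it has not sent. -/
noncomputable abbrev pipeline (n c : ℕ) : Algorithm n where
  Coin := Unit
  coinFintype := inferInstance
  law := PMF.pure ()
  State := PipelineState
  init _ k := ⟨0, k, 0⟩
  send v st _ :=
    if st.round % n = v then some ⟨(List.range c).map (st.sent + ·), []⟩ else none
  next v st _ y :=
    { round := st.round + 1
      count := y.elim st.count fun p => (p.msgs.map (· + 1)).foldr max st.count
      sent := if st.round % n = v then min (st.sent + c) st.count else st.sent }

theorem pipeline_send {n c : ℕ} (v : Fin n) (st : PipelineState) (x : Unit) :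
    (pipeline n c).send v st x =
      if st.round % n = v then some ⟨(List.range c).map (st.sent + ·), []⟩ else none := rfl

theorem pipeline_hasCapacity (n c b : ℕ) : (pipeline n c).HasCapacity c b := by
  intro v st x p h
  rw [pipeline_send] at h
  split_ifs at h
  obtain rfl := Option.some.inj h
  simp

variable {n c : ℕ} {M : Type} [DecidableEq M] (inp : Fin n → List M)
  (G : ℕ → SimpleGraph (Fin n)) (ω : ℕ → Fin n → (pipeline n c).Coin)

local notation "cfg" => run (pipeline n c) inp G ω

theorem pipeline_round (r : ℕ) (v : Fin n) : (cfg r v).st.round = r := by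
  induction r with
  | zero => rfl
  | succ r ih =>
    rw [run_succ]
    rcases reception (G r) (transmission (pipeline n c) (cfg r) (ω r)) v with _ | p <;>
      exact congrArg (· + 1) ih

theorem pipeline_count (hinp : ∀ v, (inp v).Nodup) (r : ℕ) (v : Fin n) :
    (cfg r v).st.count = (cfg r v).known.length := by
  induction r with
  | zero => rfl
  | succ r ih =>
    rw [run_succ]
    rcases reception (G r) (transmission (pipeline n c) (cfg r) (ω r)) v with _ | p
    · exact ih
    · refine Eq.trans ?_ (foldr_max_idxOf_learn (run_known_nodup _ inp G ω hinp r v) p.msgs)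
      rw [← ih]
      rfl

theorem pipeline_sent_succ (hinp : ∀ v, (inp v).Nodup) (r : ℕ) (v : Fin n) :
    (cfg (r + 1) v).st.sent = if r % n = v then
      min ((cfg r v).st.sent + c) (cfg r v).known.length else (cfg r v).st.sent := by
  have h : (cfg (r + 1) v).st.sent = if (cfg r v).st.round % n = v then
      min ((cfg r v).st.sent + c) (cfg r v).st.count else (cfg r v).st.sent := by
    rw [run_succ]
    rcases reception (G r) (transmission (pipeline n c) (cfg r) (ω r)) v with _ | p <;> rfl
  rw [h, pipeline_round, pipeline_count inp G ω hinp]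

theorem pipeline_sent_le (hinp : ∀ v, (inp v).Nodup) (r : ℕ) (v : Fin n) :
    (cfg r v).st.sent ≤ (cfg r v).known.length := by
  induction r with
  | zero => exact Nat.zero_le _
  | succ r ih =>
    have := (run_known_prefix (pipeline n c) inp G ω (show r ≤ r + 1 by omega) v).length_le
    rw [pipeline_sent_succ inp G ω hinp]
    split_ifs <;> omega

theorem pipeline_sent_mono (hinp : ∀ v, (inp v).Nodup) (v : Fin n) :
    Monotone fun r => (cfg r v).st.sent := by
  refine monotone_nat_of_le_succ fun r => ?_
  have := pipeline_sent_le inp G ω hinp r v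
  rw [pipeline_sent_succ inp G ω hinp]
  split_ifs <;> omega

/-- What a node has sent is known to its neighbors. -/
theorem pipeline_mem_known_of_sent (hinp : ∀ v, (inp v).Nodup) {u v : Fin n}
    (huv : ∀ r, (G r).Adj v u) (r : ℕ) {i : ℕ} (hi : i < (cfg r u).st.sent) {m : M}
    (hm : (cfg r u).known[i]? = some m) : m ∈ (cfg r v).known := by
  induction r with
  | zero => exact absurd hi (Nat.not_lt_zero i)
  | succ r ih =>
    have hpre := run_known_prefix (pipeline n c) inp G ω (show r ≤ r + 1 by omega)
    have hle := pipeline_sent_le inp G ω hinp r u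
    have hm' : i < (cfg r u).known.length → (cfg r u).known[i]? = some m := by
      intro hlt
      rw [List.getElem?_eq_getElem hlt, ← hm]
      exact (getElem?_of_prefix (hpre u) (List.getElem?_eq_getElem hlt)).symm
    by_cases hold : i < (cfg r u).st.sent
    · exact (hpre v).subset (ih hold (hm' (by omega)))
    · rw [pipeline_sent_succ inp G ω hinp] at hi
      split_ifs at hi with hturn
      swap
      · exact absurd hi hold
      have hmi := hm' (by omega)
      have hru := pipeline_round inp G ω r u
      have hsend : transmission (pipeline n c) (cfg r) (ω r) u =
          some ⟨((List.range c).map ((cfg r u).st.sent + ·)).filterMap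
            fun i => (cfg r u).known[i]?, []⟩ := by
        refine (transmission_eq_some _).2
          ⟨⟨(List.range c).map ((cfg r u).st.sent + ·), []⟩, ?_, rfl⟩
        rw [pipeline_send, hru, if_pos hturn]
      have hsole : ∀ w, w ≠ u → transmission (pipeline n c) (cfg r) (ω r) w = none := by
        intro w hw
        rw [transmission_eq_none, pipeline_send, pipeline_round inp G ω r w, hturn]
        refine if_neg ?_
        exact fun h => hw (Fin.ext h.symm)
      rw [run_succ, reception_of_sole_transmitter hsend hsole (huv r)]
      refine mem_learn.2 (Or.inr (List.mem_filterMap.2 ⟨i, ?_, hmi⟩))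
      exact List.mem_map.2 ⟨i - (cfg r u).st.sent, List.mem_range.2 (by omega), by omega⟩

/-- Each phase of `n` rounds contains exactly one turn of `v`. -/
theorem pipeline_sent_phase (hinp : ∀ v, (inp v).Nodup) (τ : ℕ) (v : Fin n) :
    min ((cfg (n * τ) v).st.sent + c) (cfg (n * τ) v).known.length ≤
      (cfg (n * (τ + 1)) v).st.sent := by
  have h1 := pipeline_sent_mono inp G ω hinp v (show n * τ ≤ n * τ + v by omega)
  have h2 := pipeline_sent_mono inp G ω hinp v
    (show n * τ + v + 1 ≤ n * (τ + 1) by have := v.2; rw [Nat.mul_succ]; omega)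
  have h3 := (run_known_prefix (pipeline n c) inp G ω (show n * τ ≤ n * τ + v by omega) v).length_le
  have h4 := pipeline_sent_succ inp G ω hinp (n * τ + v) v
  rw [Nat.mul_add_mod, Nat.mod_eq_of_lt v.2, if_pos rfl] at h4
  simp only at h1 h2
  omega

/-- Pipelining along a walk from `v` to `u`: each edge delays the flow by one phase, and afterwards
each phase delivers `c` messages or has already delivered everything that `u` started with. It does
not matter which messages come through, since their number is bounded by `s`. -/
theorem pipeline_progress (hinp : ∀ v, (inp v).Nodup) {H : SimpleGraph (Fin n)}
    (hH : ∀ r u v, H.Adj u v → (G r).Adj u v) {u v : Fin n} (p : H.Walk v u) (τ : ℕ) :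
    (∀ m ∈ inp u, m ∈ (cfg (n * τ) v).known) ∨
      c * (τ + 1) ≤ (cfg (n * τ) v).known.length + c * p.length := by
  induction p generalizing τ with
  | nil => exact Or.inl fun m hm =>
      (run_known_prefix (pipeline n c) inp G ω (Nat.zero_le _) _).subset hm
  | @cons v w u hvw p ih =>
    -- The same alternative for what the next node `w` has sent. If `w` sends fewer than `c`
    -- messages in a phase, it has sent all that it knew at the start of the phase, and the
    -- induction hypothesis for the shorter walk applies.
    have key : ∀ τ, (∀ m ∈ inp u, ∃ i < (cfg (n * τ) w).st.sent,
        (cfg (n * τ) w).known[i]? = some m) ∨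
        c * τ ≤ (cfg (n * τ) w).st.sent + c * p.length := by
      intro τ
      induction τ with
      | zero => right; simp
      | succ τ ihτ =>
        have hmono := pipeline_sent_mono inp G ω hinp w
          (show n * τ ≤ n * (τ + 1) from Nat.mul_le_mul_left n (Nat.le_succ τ))
        have hpre := run_known_prefix (pipeline n c) inp G ω
          (show n * τ ≤ n * (τ + 1) from Nat.mul_le_mul_left n (Nat.le_succ τ)) w
        have hphase := pipeline_sent_phase inp G ω hinp τ w
        simp only at hmono
        rcases ihτ with h | h
        · left
          intro m hm
          obtain ⟨i, hi, hi'⟩ := h m hm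
          exact ⟨i, by omega, getElem?_of_prefix hpre hi'⟩
        · rcases le_total ((cfg (n * τ) w).st.sent + c) (cfg (n * τ) w).known.length with h' | h'
          · right
            rw [min_eq_left h'] at hphase
            rw [Nat.mul_succ]; omega
          · rw [min_eq_right h'] at hphase
            rcases ih τ with h'' | h''
            · left
              intro m hm
              obtain ⟨i, hi, hi'⟩ := List.getElem_of_mem (h'' m hm)
              refine ⟨i, by omega, getElem?_of_prefix hpre ?_⟩
              rw [List.getElem?_eq_getElem hi, hi']
            · right; omega
    have hadj : ∀ r, (G r).Adj v w := fun r => hH r v w hvw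
    rcases key τ with h | h
    · left
      intro m hm
      obtain ⟨i, hi, hi'⟩ := h m hm
      exact pipeline_mem_known_of_sent inp G ω hinp hadj _ hi hi'
    · right
      have hle : (cfg (n * τ) w).st.sent ≤ (cfg (n * τ) v).known.length := by
        have hsub : (cfg (n * τ) w).known.take (cfg (n * τ) w).st.sent ⊆ (cfg (n * τ) v).known := by
          intro m hm
          obtain ⟨i, hi, hi'⟩ := List.getElem_of_mem hm
          rw [List.length_take] at hi
          refine pipeline_mem_known_of_sent inp G ω hinp hadj _ (i := i) (by omega) ?_
          rw [← hi', List.getElem_take, List.getElem?_eq_getElem]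
        have hnd := (run_known_nodup (pipeline n c) inp G ω hinp (n * τ) w).sublist
          (List.take_sublist (cfg (n * τ) w).st.sent _)
        have := (hnd.subperm hsub).length_le
        rwa [List.length_take, min_eq_left (pipeline_sent_le inp G ω hinp _ _)] at this
      rw [SimpleGraph.Walk.length_cons, Nat.mul_succ, Nat.mul_succ]
      omega

theorem pipeline_solves {s B : ℕ} {p : ℝ} (hc : 1 ≤ c) (hp : p ≤ 1) :
    Solves (pipeline n c) ⊤ 0 s B (n * (n + s / c)) p := by
  intro inp adv hinp hobl hconn
  refine (hp.trans (le_of_eq (sub_zero 1).symm)).trans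
    (le_coinMeasure_of_compl_subset _ le_rfl (bad := ∅) (fun ω _ => ?_) (by simp))
  intro u v m hm
  obtain ⟨p, hp⟩ := ((hconn ω 0).preconnected v u).exists_isPath
  have hlen : p.length < n := by simpa using hp.length_lt
  -- Otherwise, after `n + s / c` phases, `v` would know more than `s` messages, as the path has
  -- fewer than `n` edges.
  rcases pipeline_progress inp (adv ω) ω hinp.nodup (fun r u v h => stableGraph_adj h r) p
    (n + s / c) with h | h
  · exact h m hm
  · exfalso
    have h1 := run_known_length_le (pipeline n c) inp (adv ω) ω hinp (n * (n + s / c)) v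
    have h2 : c * p.length + c ≤ c * n := by
      rw [← Nat.mul_succ]; exact Nat.mul_le_mul_left c hlen
    have h3 := Nat.lt_mul_div_succ s hc
    rw [Nat.mul_succ, Nat.mul_add] at h
    rw [Nat.mul_succ] at h3
    omega

end Pipeline

/-! ### Wake-up times -/

section Wake

/-- In the rounds `t₀, …, T - 1`, `f` is the wake-up round of an agent, `none` until then. -/
structure IsWake (f : ℕ → Option ℕ) (t₀ T : ℕ) : Prop where
  start : f t₀ = none ∨ f t₀ = some t₀
  keep : ∀ r w, t₀ ≤ r → r + 1 < T → f r = some w → f (r + 1) = some w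
  wake : ∀ r, t₀ ≤ r → r + 1 < T → f r = none → f (r + 1) = none ∨ f (r + 1) = some (r + 1)

variable {f : ℕ → Option ℕ} {t₀ T : ℕ}

theorem IsWake.eq_some (h : IsWake f t₀ T) {w r : ℕ} (hw : t₀ ≤ w) (hwr : w ≤ r) (hr : r < T)
    (hf : f w = some w) : f r = some w := by
  induction r, hwr using Nat.le_induction with
  | base => exact hf
  | succ r hwr ih => exact h.keep r w (hw.trans hwr) hr (ih (by omega))

theorem IsWake.eq_none (h : IsWake f t₀ T) {r r' : ℕ} (hr : t₀ ≤ r) (hrr : r ≤ r') (hr' : r' < T)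
    (hf : f r' = none) : f r = none := by
  induction r', hrr using Nat.le_induction with
  | base => exact hf
  | succ r' hrr ih =>
    refine ih (by omega) ?_
    by_contra hne
    obtain ⟨w, hw⟩ := Option.ne_none_iff_exists'.1 hne
    rw [h.keep r' w (hr.trans hrr) hr' hw] at hf
    cases hf

theorem IsWake.self_of_first (h : IsWake f t₀ T) {r : ℕ} (hr : t₀ ≤ r) (hrT : r < T)
    (hf : f r ≠ none) (hfirst : r = t₀ ∨ f (r - 1) = none) : f r = some r := by
  rcases eq_or_lt_of_le hr with rfl | hlt
  · exact h.start.resolve_left hf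
  · have h1 := hfirst.resolve_left hlt.ne'
    have h2 := h.wake (r - 1) (by omega) (by omega) h1
    rw [Nat.sub_add_cancel (by omega)] at h2
    exact h2.resolve_left hf

/-- An agent has at most one wake-up time in the window. If it never wakes up, the end of the window
serves as a default. -/
theorem IsWake.exists_wake (h : IsWake f t₀ T) : ∃ w, t₀ ≤ w ∧
    (∀ r, t₀ ≤ r → r < T → f r = none ∨ f r = some w) ∧ ∀ r, t₀ ≤ r → r < w → f r = none := by
  classical
  by_cases hex : ∃ r, t₀ ≤ r ∧ r < T ∧ f r ≠ none
  · obtain ⟨h1, h2, h3⟩ := Nat.find_spec hex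
    set w := Nat.find hex with hw
    have hbefore : ∀ r, t₀ ≤ r → r < w → f r = none := by
      intro r hr hrw
      by_contra hne
      exact Nat.find_min hex hrw ⟨hr, by omega, hne⟩
    have hself : f w = some w := h.self_of_first h1 h2 h3 (by
      by_cases heq : w = t₀
      exacts [Or.inl heq, Or.inr (hbefore _ (by omega) (by omega))])
    refine ⟨w, h1, fun r hr hrT => ?_, hbefore⟩
    rcases lt_or_ge r w with hlt | hge
    exacts [Or.inl (hbefore r hr hlt), Or.inr (h.eq_some h1 hge hrT hself)]
  · have hnone : ∀ r, t₀ ≤ r → r < T → f r = none := fun r hr hrT => by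
      by_contra hne
      exact hex ⟨r, hr, hrT, hne⟩
    rcases lt_or_ge t₀ T with hlt | hge
    · exact ⟨T, hlt.le, fun r hr hrT => Or.inl (hnone r hr hrT), hnone⟩
    · exact ⟨t₀, le_rfl, fun r hr hrT => by omega, fun r hr hrT => by omega⟩

end Wake

/-! ### Parallel harmonic broadcast of single messages -/

section Multi

/-- Entry `i` of `wake` is the round in which the message with handle `i` became known, that is, the
wake-up round of its agent. -/
structure MultiState where
  round : ℕ
  wake : List ℕ

open Classical in
/-- Harmonic broadcast of all messages in parallel: each known message of a node is an agent of
its own. -/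
noncomputable abbrev harmonicMulti (n s N Θ : ℕ) [NeZero N] : Algorithm n :=
  slotAlgorithm n s N Unit MultiState (fun _ k => ⟨0, List.replicate k 0⟩)
    (fun _ st x =>
      if h : ∃ i, (x.1 i).val < threshold N Θ st.wake[i.val]? st.round then
        some ⟨[h.choose.val], []⟩ else none)
    (fun _ st _ y =>
      { round := st.round + 1
        wake := st.wake ++ List.replicate
          ((y.elim st.wake.length fun p => (p.msgs.map (· + 1)).foldr max st.wake.length) -
            st.wake.length) (st.round + 1) })

theorem harmonicMulti_hasCapacity (n s N Θ b : ℕ) [NeZero N] :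
    (harmonicMulti n s N Θ).HasCapacity 1 b := by
  intro v st x p h
  simp only at h
  split_ifs at h
  obtain rfl := Option.some.inj h
  simp

variable {n s N Θ : ℕ} [NeZero N] {M : Type} [DecidableEq M] (inp : Fin n → List M)
  (G : ℕ → SimpleGraph (Fin n)) (ω : ℕ → Fin n → SlotCoin s N Unit)

local notation "cfg" => run (harmonicMulti n s N Θ) inp G ω

theorem multi_round (r : ℕ) (v : Fin n) : (cfg r v).st.round = r := by
  induction r with
  | zero => rfl
  | succ r ih =>
    rw [run_succ]
    rcases reception (G r) (transmission (harmonicMulti n s N Θ) (cfg r) (ω r)) v with _ | p <;>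
      exact congrArg (· + 1) ih

theorem multi_wake_succ_of_length (hinp : ∀ v, (inp v).Nodup) (r : ℕ) (v : Fin n)
    (h : (cfg r v).st.wake.length = (cfg r v).known.length) :
    (cfg (r + 1) v).st.wake = (cfg r v).st.wake ++ List.replicate
      ((cfg (r + 1) v).known.length - (cfg r v).known.length) (r + 1) := by
  have h2 := multi_round (Θ := Θ) inp G ω r v
  rw [run_succ]
  rcases reception (G r) (transmission (harmonicMulti n s N Θ) (cfg r) (ω r)) v with _ | p
  · simp only [updateNode, Nat.sub_self, List.replicate_zero, List.append_nil]
    exact (congrArg₂ (· ++ ·) rfl (by simp)).trans (List.append_nil _)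
  · have h1 := foldr_max_idxOf_learn (run_known_nodup (harmonicMulti n s N Θ) inp G ω hinp r v)
      p.msgs
    simp only [updateNode]
    rw [← h1, ← h]
    exact congrArg₂ (· ++ ·) rfl (congrArg₂ List.replicate rfl (congrArg (· + 1) h2))

theorem multi_wake_length (hinp : ∀ v, (inp v).Nodup) (r : ℕ) (v : Fin n) :
    (cfg r v).st.wake.length = (cfg r v).known.length := by
  induction r with
  | zero => simp [run]
  | succ r ih =>
    have := (run_known_prefix (harmonicMulti n s N Θ) inp G ω (show r ≤ r + 1 by omega) v).length_le
    rw [multi_wake_succ_of_length inp G ω hinp r v ih, List.length_append, List.length_replicate]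
    omega

theorem multi_isWake (hinp : ∀ v, (inp v).Nodup) (T : ℕ) (v : Fin n) (i : ℕ) :
    IsWake (fun r => (cfg r v).st.wake[i]?) 0 T := by
  have hlen := multi_wake_length (s := s) (N := N) (Θ := Θ) inp G ω hinp
  refine ⟨?_, fun r w _ _ hw => ?_, fun r _ _ hr => ?_⟩
  · simp only [run]
    rcases lt_or_ge i (inp v).length with h | h
    · right; simp [h]
    · left; simp [h]
  · rw [multi_wake_succ_of_length inp G ω hinp r v (hlen r v)]
    exact getElem?_of_prefix (List.prefix_append _ _) hw
  · rw [multi_wake_succ_of_length inp G ω hinp r v (hlen r v)]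
    rw [List.getElem?_eq_none_iff] at hr
    rw [List.getElem?_append_right hr, List.getElem?_replicate]
    split_ifs
    exacts [Or.inr rfl, Or.inl rfl]

theorem multi_wake_ne_none (hinp : ∀ v, (inp v).Nodup) (r : ℕ) (v : Fin n) (i : ℕ) :
    (cfg r v).st.wake[i]? ≠ none ↔ i < (cfg r v).known.length := by
  rw [← multi_wake_length inp G ω hinp, ne_eq, List.getElem?_eq_none_iff, not_le]

/-- If a message is the only one on the channel then it reaches the neighbors. -/
theorem multi_mem_known_of_onlyFires {r : ℕ} {u v : Fin n} {k : Fin s} {m : M}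
    (hfire : OnlyFires Θ (fun u (i : Fin s) => (cfg r u).st.wake[i.val]?) r v k (ω r))
    (hm : (cfg r v).known[k.val]? = some m) (huv : (G r).Adj u v) :
    m ∈ (cfg (r + 1) u).known := by
  have hround := multi_round (s := s) (N := N) (Θ := Θ) inp G ω r
  have hsend : transmission (harmonicMulti n s N Θ) (cfg r) (ω r) v =
      some ⟨[k.val].filterMap fun i => (cfg r v).known[i]?, []⟩ := by
    refine (transmission_eq_some _).2 ⟨⟨[k.val], []⟩, ?_, rfl⟩
    have hex : ∃ i : Fin s, ((ω r v).1 i).val <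
        threshold N Θ (cfg r v).st.wake[i.val]? (cfg r v).st.round := by
      rw [hround]; exact ⟨k, (hfire v k).2 ⟨rfl, rfl⟩⟩
    -- A node with several firing slots sends an arbitrary one of them; here slot `k` is the only
    -- one.
    have hk : hex.choose = k := by
      exact ((hfire v _).1 (hex.choose_spec.trans_eq (congrArg (threshold N Θ _) (hround v)))).2
    refine (dif_pos hex).trans ?_
    rw [hk]
  have hsole : ∀ w, w ≠ v → transmission (harmonicMulti n s N Θ) (cfg r) (ω r) w = none := by
    intro w hw
    rw [transmission_eq_none]
    refine dif_neg ?_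
    rintro ⟨i, hi⟩
    rw [hround] at hi
    exact hw ((hfire w i).1 hi).1
  rw [run_succ, reception_of_sole_transmitter hsend hsole huv]
  exact mem_learn.2 (Or.inr (List.mem_filterMap.2 ⟨k.val, List.mem_singleton_self _, hm⟩))

/-- Follow one message `msg`: its agents have to inform all nodes, while all `n * s` agents
contribute to the mass that can keep rounds busy. -/
theorem multi_disseminated {H : SimpleGraph (Fin n)} (hH : H.Connected)
    (hHG : ∀ r u v, H.Adj u v → (G r).Adj u v) (hinp : IsInput inp s) (hΘ : 0 < Θ) {m : ℕ}
    (hm : 0 < m) (hlong : 4 * (n * s * (harmonic m : ℚ)) < (m : ℝ))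
    (hgood : ∀ v (k : Fin s) w e, w < e → e ≤ Θ * m →
      (∀ r, w ≤ r → r < e → (cfg r v).st.wake[k.val]? = some w) →
      (∀ r, r < w → (cfg r v).st.wake[k.val]? = none) →
      ∑ r ∈ Finset.Ico w e, score N Θ (fun u (i : Fin s) => (cfg r u).st.wake[i.val]?) r ≤ 0 →
      ∃ r, w ≤ r ∧ r < e ∧
        OnlyFires Θ (fun u (i : Fin s) => (cfg r u).st.wake[i.val]?) r v k (ω r)) :
    Disseminated inp (cfg (Θ * m)) := by
  intro a b msg hmsg
  have hpre : ∀ {r r'}, r ≤ r' → ∀ v, (cfg r v).known <+: (cfg r' v).known := fun h v =>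
    run_known_prefix (harmonicMulti n s N Θ) inp G ω h v
  have hnone := multi_wake_ne_none (s := s) (N := N) (Θ := Θ) inp G ω hinp.nodup
  have hT : 0 < Θ * m := Nat.mul_pos hΘ hm
  have hs : 0 < s := by
    rw [← hinp.card]
    exact (List.length_pos_of_mem hmsg).trans_le
      (Finset.single_le_sum (f := fun v => (inp v).length) (fun _ _ => Nat.zero_le _)
        (Finset.mem_univ a))
  let I : ℕ → Set (Fin n) := fun r => {v | msg ∈ (cfg r v).known}
  have hI : Monotone I := fun r r' h v hv => (hpre h v).subset hv
  -- The handle of `msg` at `v`, read off at the end. It never changes, and before `msg` arrives no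
  -- agent of `v` with this handle is awake. If `v` never learns `msg` the value may be a dummy.
  let k : Fin n → Fin s := fun v =>
    if h : (cfg (Θ * m) v).known.idxOf msg < s then ⟨_, h⟩ else ⟨0, hs⟩
  have hk : ∀ r v, r ≤ Θ * m → v ∈ I r → (cfg r v).known[(k v).val]? = some msg ∧
      ∀ r' < r, v ∉ I r' → (cfg r' v).st.wake[(k v).val]? = none := by
    intro r v hr hv
    have h1 : (cfg (Θ * m) v).known.idxOf msg = (cfg r v).known.idxOf msg := by
      obtain ⟨t, ht⟩ := hpre hr v
      rw [← ht, List.idxOf_append_of_mem hv]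
    have h2 : (cfg r v).known.idxOf msg < (cfg r v).known.length := List.idxOf_lt_length_of_mem hv
    have h3 : (k v).val = (cfg r v).known.idxOf msg := by
      have := run_known_length_le (harmonicMulti n s N Θ) inp G ω hinp r v
      simp only [k, h1]
      rw [dif_pos (by omega)]
    rw [h3]
    refine ⟨getElem?_idxOf_of_mem hv, fun r' hr' hv' => ?_⟩
    by_contra hne
    have h4 := (hnone r' v _).1 hne
    apply hv'
    have h5 := getElem?_of_prefix (hpre hr'.le v) (List.getElem?_eq_getElem h4)
    rw [getElem?_idxOf_of_mem hv] at h5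
    exact ((Option.some.inj h5).symm ▸ List.getElem_mem h4 : msg ∈ (cfg r' v).known)
  have hself : ∀ v w, w < Θ * m → v ∈ I w → (w = 0 ∨ v ∉ I (w - 1)) →
      (cfg w v).st.wake[(k v).val]? = some w := by
    intro v w hw hv hfirst
    have hkw := hk w v hw.le hv
    refine (multi_isWake inp G ω hinp.nodup (Θ * m) v (k v)).self_of_first (Nat.zero_le w) hw
      ((hnone w v _).2 (List.getElem?_eq_some_iff.1 hkw.1).1) ?_
    by_cases h0 : w = 0
    · exact Or.inl h0
    · exact Or.inr (hkw.2 (w - 1) (by omega) (hfirst.resolve_left h0))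
  have huniv : I (Θ * m - 1) = Set.univ := by
    refine informed_eq_univ_of_long_window (N := N) (NeZero.ne N) hΘ hT (m := m) (by simp) hH hI
      ⟨a, hmsg⟩ (W := fun r u (i : Fin s) => (cfg r u).st.wake[i.val]?) k
      (fun v w _ hw hv hfirst => hself v w hw hv hfirst) ?_ Finset.univ (by simp)
      (fun u i => (multi_isWake inp G ω hinp.nodup (Θ * m) u i).exists_wake) ?_
    · intro v w e _ hwe heT hv hfirst hsc u huv
      have hw := hself v w (by omega) hv hfirst
      have hwake := multi_isWake (s := s) (N := N) (Θ := Θ) inp G ω hinp.nodup (Θ * m) v (k v)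
      obtain ⟨r, h1, h2, h3⟩ := hgood v (k v) w e hwe heT
        (fun r h1 h2 => hwake.eq_some (Nat.zero_le w) h1 (by omega) hw)
        (fun r hr => by
          have hvr : v ∉ I r := fun h =>
            (hfirst.resolve_left (by omega)) (hI (by omega : r ≤ w - 1) h)
          exact (hk w v (by omega) hv).2 r hr hvr) hsc
      have hvr : v ∈ I r := hI h1 hv
      exact hI (by omega : r + 1 ≤ e) (multi_mem_known_of_onlyFires inp G ω h3
        (hk r v (by omega) hvr).1 (hHG r u v huv.symm))
    · rw [Finset.card_univ, Fintype.card_prod, Fintype.card_fin, Fintype.card_fin, Nat.sub_zero]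
      push_cast
      have hΘ' : (0 : ℝ) < Θ := by exact_mod_cast hΘ
      nlinarith
  exact hI (Nat.sub_le _ 1) (huniv ▸ Set.mem_univ b : b ∈ I (Θ * m - 1))

/-- Union bound over the `n * s` agents, not over rounds: `notIsolated` already allows every wake-up
time. -/
theorem multi_solves {B : ℕ} {ε : ℝ} (hΘ : 0 < Θ) {m : ℕ} (hm : 0 < m)
    (hdvd : ∀ j, 1 ≤ j → j ≤ Θ * m → j ∣ N) (hlong : 4 * (n * s * (harmonic m : ℚ)) < (m : ℝ))
    (hε : n * s * Real.exp (-(Θ / 8)) ≤ ε) :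
    Solves (harmonicMulti n s N Θ) ⊤ 0 s B (Θ * m) (1 - ε) := by
  intro inp adv hinp hobl hconn
  let W : (ℕ → Fin n → SlotCoin s N Unit) → ℕ → Fin n → Fin s → Option ℕ := fun ω r u i =>
    (run (harmonicMulti n s N Θ) inp (adv ω) ω r u).st.wake[i.val]?
  have hW : ∀ r, DependsOn (fun ω => W ω r) (Set.Iio r) := by
    intro r ω ω' h
    have := run_dependsOn (harmonicMulti n s N Θ) inp hobl r h
    simp only at this
    simp only [W, this]
  refine le_coinMeasure_of_compl_subset _ (le_trans (by positivity) hε)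
    (bad := ⋃ a ∈ (Finset.univ : Finset (Fin n × Fin s)), notIsolated Θ 0 (Θ * m) W a.1 a.2)
    (fun ω hω => ?_) ?_
  · refine multi_disseminated inp (adv ω) ω (hconn ω 0) (fun r u v h => stableGraph_adj h r) hinp hΘ
      hm hlong fun v k w e hwe heT h1 h2 h3 => ?_
    by_contra hno
    push Not at hno
    refine hω (Set.mem_biUnion (Finset.mem_univ (v, k)) ?_)
    exact ⟨w, e, Nat.zero_le w, hwe, heT, h1, fun r _ hr => h2 r hr, h3, hno⟩
  · refine (measure_biUnion_finset_le _ _).trans ((Finset.sum_le_card_nsmul _ _ _ fun a _ =>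
      measure_notIsolated_le Θ 0 hdvd W hW a.1 a.2).trans ?_)
    rw [Finset.card_univ, Fintype.card_prod, Fintype.card_fin, Fintype.card_fin, nsmul_eq_mul,
      ← ENNReal.ofReal_natCast, ← ENNReal.ofReal_mul (Nat.cast_nonneg _)]
    refine ENNReal.ofReal_le_ofReal (le_trans (le_of_eq ?_) hε)
    push_cast
    ring

end Multi

/-! ### Broadcasts from random sources: local invariants -/

section Sampling

/-- State of a process of `samplingBroadcast`: `count` is the number of its initial messages, `pool`
the handles of the known messages of the current epoch, `bundle` the handles of the messages that
it spreads in the current broadcast if it is awake, `act` the round in which it woke up. -/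
structure SamplingState where
  round : ℕ
  count : ℕ
  pool : List ℕ
  act : Option ℕ
  bundle : List ℕ

/-- The pool at the start of a round; every `P` rounds a new epoch starts. -/
def SamplingState.currentPool (P E : ℕ) (st : SamplingState) : List ℕ :=
  if P ∣ st.round then (List.range st.count).filter fun i => i % E = st.round / P else st.pool

open Classical in
/-- In a selection round each node becomes a source with probability `1 / (2 * n + 1)`. A source
wakes up and chooses a chunk of its pool. In the other rounds the awake nodes spread their
bundles by a harmonic broadcast. -/
noncomputable def samplingNext (n c g P E : ℕ) (sel : ℕ → Prop) (st : SamplingState)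
    (d : Fin (2 * n + 1) × Fin (g + 1)) (y : Option (Packet ℕ)) : SamplingState :=
  if sel st.round then
    { round := st.round + 1
      count := st.count
      pool := st.currentPool P E
      act := if d.1 = 0 then some (st.round + 1) else none
      bundle := ((st.currentPool P E).drop (d.2 * c)).take c }
  else
    { round := st.round + 1
      count := st.count
      pool := y.elim st.pool fun p => learn st.pool p.msgs
      act := y.elim st.act fun _ => some (st.act.getD (st.round + 1))
      bundle := y.elim st.bundle fun p => if st.act = none then p.msgs else st.bundle }

open Classical in
/-- A sequence of broadcasts from random sources: in the course of an epoch, the messages of the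
epoch spread to more and more nodes. -/
noncomputable abbrev samplingBroadcast (n c g P E N Θ : ℕ) [NeZero N] (sel : ℕ → Prop) :
    Algorithm n :=
  slotAlgorithm n 1 N (Fin (2 * n + 1) × Fin (g + 1)) SamplingState
    (fun _ k => ⟨0, k, [], none, []⟩)
    (fun _ st x =>
      if ¬ sel st.round ∧ (x.1 0).val < threshold N Θ st.act st.round then
        some ⟨st.bundle.take c, []⟩ else none)
    (fun _ st x y => samplingNext n c g P E sel st x.2 y)

theorem samplingBroadcast_hasCapacity (n c g P E N Θ b : ℕ) [NeZero N] (sel : ℕ → Prop) :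
    (samplingBroadcast n c g P E N Θ sel).HasCapacity c b := by
  intro v st x p h
  simp only at h
  split_ifs at h
  obtain rfl := Option.some.inj h
  simp

variable {n c g P E N Θ : ℕ} [NeZero N] {sel : ℕ → Prop} {M : Type} [DecidableEq M]
  (inp : Fin n → List M) (G : ℕ → SimpleGraph (Fin n))
  (ω : ℕ → Fin n → SlotCoin 1 N (Fin (2 * n + 1) × Fin (g + 1)))

local notation "alg" => samplingBroadcast n c g P E N Θ sel

local notation "cfg" => run (samplingBroadcast n c g P E N Θ sel) inp G ω

theorem sampling_next_round (st : SamplingState) (d : Fin (2 * n + 1) × Fin (g + 1))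
    (y : Option (Packet ℕ)) : (samplingNext n c g P E sel st d y).round = st.round + 1 ∧
      (samplingNext n c g P E sel st d y).count = st.count := by
  rw [samplingNext]; split_ifs <;> exact ⟨rfl, rfl⟩

theorem sampling_round_count (r : ℕ) (v : Fin n) :
    (cfg r v).st.round = r ∧ (cfg r v).st.count = (inp v).length := by
  induction r with
  | zero => exact ⟨rfl, rfl⟩
  | succ r ih =>
    rw [run_succ]
    rcases reception (G r) (transmission alg (cfg r) (ω r)) v with _ | p
    all_goals
      refine ⟨(sampling_next_round (c := c) (P := P) (E := E) (sel := sel) _ _ _).1.trans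
        (congrArg (· + 1) ih.1),
        (sampling_next_round (c := c) (P := P) (E := E) (sel := sel) _ _ _).2.trans ih.2⟩

theorem sampling_round (r : ℕ) (v : Fin n) : (cfg r v).st.round = r :=
  (sampling_round_count inp G ω r v).1

theorem sampling_transmission (r : ℕ) (v : Fin n) {p : Packet M}
    (h : transmission alg (cfg r) (ω r) v = some p) :
    ¬ sel r ∧ (cfg r v).st.act ≠ none ∧
      p.msgs = ((cfg r v).st.bundle.take c).filterMap fun i => (cfg r v).known[i]? := by
  obtain ⟨p', h1, rfl⟩ := (transmission_eq_some _).1 h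
  have hround := sampling_round (c := c) (P := P) (E := E) (Θ := Θ) (sel := sel) inp G ω r v
  simp only at h1
  split_ifs at h1 with h2
  obtain rfl := Option.some.inj h1
  rw [hround] at h2
  refine ⟨h2.1, fun hnone => ?_, rfl⟩
  rw [hnone] at h2
  exact absurd h2.2 (by simp [threshold])

theorem sampling_reception {r : ℕ} {v : Fin n} {p : Packet M}
    (h : reception (G r) (transmission alg (cfg r) (ω r)) v = some p) :
    ¬ sel r ∧ ∃ u, (cfg r u).st.act ≠ none ∧
      p.msgs = ((cfg r u).st.bundle.take c).filterMap fun i => (cfg r u).known[i]? := by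
  obtain ⟨u, -, hu⟩ := exists_transmitter_of_reception h
  obtain ⟨h1, h2, h3⟩ := sampling_transmission inp G ω r u hu
  exact ⟨h1, u, h2, h3⟩

theorem sampling_of_sel {r : ℕ} (hr : sel r) (v : Fin n) :
    (cfg (r + 1) v).known = (cfg r v).known ∧
    (cfg (r + 1) v).st.pool = (cfg r v).st.currentPool P E ∧
    (cfg (r + 1) v).st.act = (if (ω r v).2.1 = 0 then some (r + 1) else none) ∧
    (cfg (r + 1) v).st.bundle =
      (((cfg r v).st.currentPool P E).drop ((ω r v).2.2 * c)).take c := by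
  have hrec : reception (G r) (transmission alg (cfg r) (ω r)) v = none := by
    by_contra hne
    obtain ⟨p, hp⟩ := Option.ne_none_iff_exists'.1 hne
    exact (sampling_reception inp G ω hp).1 hr
  have hround := sampling_round (c := c) (P := P) (E := E) (Θ := Θ) (sel := sel) inp G ω r v
  have hst : (cfg (r + 1) v).st = samplingNext n c g P E sel (cfg r v).st (ω r v).2 none := by
    rw [run_succ, hrec]; rfl
  rw [samplingNext, hround, if_pos hr] at hst
  refine ⟨by rw [run_succ, hrec]; rfl, ?_, ?_, ?_⟩ <;> rw [hst]

theorem sampling_of_silence {r : ℕ} (hr : ¬ sel r) {v : Fin n}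
    (h : reception (G r) (transmission alg (cfg r) (ω r)) v = none) :
    (cfg (r + 1) v).known = (cfg r v).known ∧ (cfg (r + 1) v).st.pool = (cfg r v).st.pool ∧
    (cfg (r + 1) v).st.act = (cfg r v).st.act ∧
    (cfg (r + 1) v).st.bundle = (cfg r v).st.bundle := by
  have hround := sampling_round (c := c) (P := P) (E := E) (Θ := Θ) (sel := sel) inp G ω r v
  have hst : (cfg (r + 1) v).st = samplingNext n c g P E sel (cfg r v).st (ω r v).2 none := by
    rw [run_succ, h]; rfl
  rw [samplingNext, hround, if_neg hr] at hst
  refine ⟨by rw [run_succ, h]; rfl, ?_, ?_, ?_⟩ <;> rw [hst] <;> rfl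

theorem sampling_of_packet {r : ℕ} (hr : ¬ sel r) {v : Fin n} {p : Packet M}
    (h : reception (G r) (transmission alg (cfg r) (ω r)) v = some p) :
    (cfg (r + 1) v).known = learn (cfg r v).known p.msgs ∧
    (cfg (r + 1) v).st.pool = learn (cfg r v).st.pool
      (p.msgs.map fun m => (cfg (r + 1) v).known.idxOf m) ∧
    (cfg (r + 1) v).st.act = some ((cfg r v).st.act.getD (r + 1)) ∧
    (cfg (r + 1) v).st.bundle = if (cfg r v).st.act = none then
      p.msgs.map fun m => (cfg (r + 1) v).known.idxOf m else (cfg r v).st.bundle := by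
  have hround := sampling_round (c := c) (P := P) (E := E) (Θ := Θ) (sel := sel) inp G ω r v
  have hkn : (cfg (r + 1) v).known = learn (cfg r v).known p.msgs := by
    rw [run_succ, h]; rfl
  have hst : (cfg (r + 1) v).st = samplingNext n c g P E sel (cfg r v).st (ω r v).2
      (some ⟨p.msgs.map fun m => (cfg (r + 1) v).known.idxOf m, p.ctrl⟩) := by
    rw [hkn, run_succ, h]; rfl
  rw [samplingNext, hround, if_neg hr] at hst
  refine ⟨hkn, ?_, ?_, ?_⟩ <;> rw [hst] <;> rfl

/-- All messages in `X` are among the known messages with handles in `l`. -/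
def Covers {M : Type} (known : List M) (l : List ℕ) (X : Set M) : Prop :=
  ∀ m ∈ X, ∃ i ∈ l, known[i]? = some m

theorem Covers.mono {M : Type} {known known' : List M} {l l' : List ℕ} {X : Set M}
    (h : Covers known l X) (hk : known <+: known') (hl : l ⊆ l') : Covers known' l' X := fun m hm => by
  obtain ⟨i, hi, hi'⟩ := h m hm
  exact ⟨i, hl hi, getElem?_of_prefix hk hi'⟩

theorem covers_map_idxOf {known ms : List M} (h : ms ⊆ known) {X : Set M}
    (hX : ∀ m ∈ X, m ∈ ms) : Covers known (ms.map fun m => known.idxOf m) X := fun m hm =>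
  ⟨known.idxOf m, List.mem_map.2 ⟨m, hX m hm, rfl⟩, getElem?_idxOf_of_mem (h (hX m hm))⟩

/-- The messages of epoch `e`. -/
def epochMessages {M : Type} (E : ℕ) (inp : Fin n → List M) (e : ℕ) : Set M :=
  {m | ∃ u j, (inp u)[j]? = some m ∧ j % E = e}

theorem sampling_act_ne_none_succ {r : ℕ} (hr : ¬ sel r) {v : Fin n}
    (h : (cfg r v).st.act ≠ none) : (cfg (r + 1) v).st.act = (cfg r v).st.act := by
  rcases hy : reception (G r) (transmission alg (cfg r) (ω r)) v with _ | p
  · exact (sampling_of_silence inp G ω hr hy).2.2.1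
  · obtain ⟨w, hw⟩ := Option.ne_none_iff_exists'.1 h
    rw [(sampling_of_packet inp G ω hr hy).2.2.1, hw]; rfl

theorem sampling_pool_subset {r : ℕ} (hr : ¬ sel r) (v : Fin n) :
    (cfg r v).st.pool ⊆ (cfg (r + 1) v).st.pool := by
  rcases hy : reception (G r) (transmission alg (cfg r) (ω r)) v with _ | p
  · rw [(sampling_of_silence inp G ω hr hy).2.1]; exact List.Subset.refl _
  · rw [(sampling_of_packet inp G ω hr hy).2.1]; exact (prefix_learn _ _).subset

theorem sampling_currentPool_valid_of {r : ℕ} {v : Fin n} (h : ¬ P ∣ r →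
      (cfg r v).st.pool.Nodup ∧ ∀ i ∈ (cfg r v).st.pool,
        ∃ m ∈ epochMessages E inp (r / P), (cfg r v).known[i]? = some m) :
    ((cfg r v).st.currentPool P E).Nodup ∧
      ∀ i ∈ (cfg r v).st.currentPool P E, ∃ m ∈ epochMessages E inp (r / P),
        (cfg r v).known[i]? = some m := by
  obtain ⟨hround, hcount⟩ := sampling_round_count (c := c) (P := P) (E := E) (Θ := Θ)
    (sel := sel) inp G ω r v
  rw [SamplingState.currentPool, hround, hcount]
  split_ifs with hP
  · refine ⟨List.nodup_range.filter _, fun i hi => ?_⟩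
    simp only [List.mem_filter, List.mem_range, decide_eq_true_eq] at hi
    have hget := List.getElem?_eq_getElem hi.1
    exact ⟨_, ⟨v, i, hget, hi.2⟩, getElem?_of_prefix
      (run_known_prefix alg inp G ω (Nat.zero_le r) v) hget⟩
  · exact h hP

/-- During an epoch, pools and bundles are handles of messages of the epoch. -/
theorem sampling_pool_valid (hsel : ∀ r, P ∣ r → sel r) (r : ℕ) (hr : ¬ P ∣ r) (v : Fin n) :
    (cfg r v).st.pool.Nodup ∧
    (∀ i ∈ (cfg r v).st.pool, ∃ m ∈ epochMessages E inp (r / P), (cfg r v).known[i]? = some m) ∧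
    ∀ i ∈ (cfg r v).st.bundle, ∃ m ∈ epochMessages E inp (r / P),
      (cfg r v).known[i]? = some m := by
  induction r generalizing v with
  | zero => exact absurd (dvd_zero P) hr
  | succ r ih =>
    have hdiv : (r + 1) / P = r / P := by rw [Nat.succ_div, if_neg hr, add_zero]
    rw [hdiv]
    have hpre := run_known_prefix alg inp G ω (show r ≤ r + 1 by omega)
    by_cases hs : sel r
    · obtain ⟨h1, h2, -, h4⟩ := sampling_of_sel (c := c) (P := P) (E := E) (Θ := Θ) inp G ω hs v
      have hcur := sampling_currentPool_valid_of (c := c) (Θ := Θ) (sel := sel) inp G ω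
        fun hP => ⟨(ih hP v).1, (ih hP v).2.1⟩
      rw [h1, h2, h4]
      exact ⟨hcur.1, hcur.2, fun i hi => hcur.2 i
        (List.mem_of_mem_drop (List.mem_of_mem_take hi))⟩
    · have hP : ¬ P ∣ r := fun h => hs (hsel r h)
      obtain ⟨i1, i2, i3⟩ := ih hP v
      have hlift : ∀ i : ℕ, (∃ m ∈ epochMessages E inp (r / P), (cfg r v).known[i]? = some m) →
          ∃ m ∈ epochMessages E inp (r / P), (cfg (r + 1) v).known[i]? = some m := by
        rintro i ⟨m, hm, him⟩
        exact ⟨m, hm, getElem?_of_prefix (hpre v) him⟩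
      rcases hy : reception (G r) (transmission alg (cfg r) (ω r)) v with _ | p
      · obtain ⟨-, h2, -, h4⟩ := sampling_of_silence inp G ω hs hy
        rw [h2, h4]
        exact ⟨i1, fun i hi => hlift i (i2 i hi), fun i hi => hlift i (i3 i hi)⟩
      · obtain ⟨h1, h2, -, h4⟩ := sampling_of_packet inp G ω hs hy
        obtain ⟨-, u, -, hu⟩ := sampling_reception inp G ω hy
        have hnew : ∀ i : ℕ, i ∈ (p.msgs.map fun m => (cfg (r + 1) v).known.idxOf m) →
            ∃ m ∈ epochMessages E inp (r / P), (cfg (r + 1) v).known[i]? = some m := by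
          intro i hi
          obtain ⟨m, hm, rfl⟩ := List.mem_map.1 hi
          have hmem : m ∈ (cfg (r + 1) v).known := by rw [h1]; exact mem_learn.2 (Or.inr hm)
          refine ⟨m, ?_, getElem?_idxOf_of_mem hmem⟩
          rw [hu] at hm
          obtain ⟨j, hj, hj'⟩ := List.mem_filterMap.1 hm
          obtain ⟨m', hm', hjm'⟩ := (ih hP u).2.2 j (List.mem_of_mem_take hj)
          rw [hj'] at hjm'
          exact Option.some.inj hjm' ▸ hm'
        rw [h2, h4]
        refine ⟨nodup_learn i1 _, fun i hi => ?_, fun i hi => ?_⟩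
        · rcases mem_learn.1 hi with h | h
          exacts [hlift i (i2 i h), hnew i h]
        · split_ifs at hi
          exacts [hnew i hi, hlift i (i3 i hi)]

/-- Different handles in a pool name different messages of the epoch, so the load of the epoch
bounds every pool. -/
theorem sampling_currentPool_length_le (hsel : ∀ r, P ∣ r → sel r) (hinp : ∀ v, (inp v).Nodup)
    {r b : ℕ} (hb : ∀ l : List M, l.Nodup → (∀ m ∈ l, m ∈ epochMessages E inp (r / P)) →
      l.length ≤ b) (v : Fin n) : ((cfg r v).st.currentPool P E).length ≤ b := by
  obtain ⟨h1, h2⟩ := sampling_currentPool_valid_of (c := c) (Θ := Θ) (sel := sel) inp G ω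
    (r := r) (v := v) fun hP => ⟨(sampling_pool_valid inp G ω hsel r hP v).1,
      (sampling_pool_valid inp G ω hsel r hP v).2.1⟩
  choose f hf hf' using h2
  have h3 := hb (((cfg r v).st.currentPool P E).attach.map fun i => f i.1 i.2) ?_ ?_
  · rwa [List.length_map, List.length_attach] at h3
  · refine (List.nodup_attach.2 h1).map_on fun i _ j _ hij => Subtype.ext ?_
    have hi := hf' i.1 i.2
    rw [hij, ← hf' j.1 j.2] at hi
    have hlt : i.1 < (cfg r v).known.length := (List.getElem?_eq_some_iff.1 (hf' i.1 i.2)).1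
    exact (List.getElem?_inj hlt (run_known_nodup alg inp G ω hinp r v)).1 hi
  · intro m hm
    obtain ⟨i, -, rfl⟩ := List.mem_map.1 hm
    exact hf i.1 i.2

/-- With `g = 0` the whole pool is one chunk. A single message at position `a` of the pool is in
chunk `a / c`. -/
theorem Covers.exists_chunk {M : Type} {known : List M} {l : List ℕ} {X : Set M}
    (h : Covers known l X) (hl : l.length ≤ c * (g + 1)) (hX : g = 0 ∨ X.Subsingleton) :
    ∃ j : Fin (g + 1), Covers known ((l.drop (j * c)).take c) X := by
  rcases X.eq_empty_or_nonempty with rfl | ⟨m, hm⟩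
  · exact ⟨0, fun m hm => absurd hm (Set.notMem_empty m)⟩
  rcases hX with rfl | hX
  · refine ⟨0, ?_⟩
    rw [List.take_of_length_le (by simpa using hl)]
    simpa using h
  · obtain ⟨i, hi, him⟩ := h m hm
    obtain ⟨a, ha, rfl⟩ := List.getElem_of_mem hi
    have hc : 0 < c := Nat.pos_of_ne_zero fun h0 => by rw [h0, zero_mul] at hl; omega
    have hac : a / c < g + 1 := by
      rw [Nat.div_lt_iff_lt_mul hc, mul_comm]; omega
    refine ⟨⟨a / c, hac⟩, fun m' hm' => ⟨l[a], ?_, hX hm' hm ▸ him⟩⟩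
    have hdm := Nat.div_add_mod' a c
    have hmod := Nat.mod_lt a hc
    rw [List.mem_iff_getElem]
    refine ⟨a % c, ?_, ?_⟩
    · rw [List.length_take, List.length_drop]
      simp only
      omega
    · simp only [List.getElem_take, List.getElem_drop, hdm]

/-- The nodes whose pool covers `X`. -/
def coveredBy (P E : ℕ) (X : Set M) (conf : Fin n → NodeConfig SamplingState M) : Set (Fin n) :=
  {v | Covers (conf v).known ((conf v).st.currentPool P E) X}

theorem sampling_currentPool_of_not_dvd {r : ℕ} (hr : ¬ P ∣ r) (v : Fin n) :
    (cfg r v).st.currentPool P E = (cfg r v).st.pool := by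
  rw [SamplingState.currentPool, sampling_round, if_neg hr]

/-- Within an epoch pools only grow. At the start of the next one they are reset, hence the
condition on `r + 1`. -/
theorem sampling_coveredBy_succ (hsel : ∀ r, P ∣ r → sel r) {r : ℕ} (hr : ¬ P ∣ r + 1) (X : Set M) :
    coveredBy P E X (cfg r) ⊆ coveredBy P E X (cfg (r + 1)) := by
  intro v hv
  have hpre := run_known_prefix alg inp G ω (show r ≤ r + 1 by omega) v
  rw [coveredBy, Set.mem_ofPred_eq, sampling_currentPool_of_not_dvd inp G ω hr]
  refine Covers.mono hv hpre ?_
  by_cases hs : sel r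
  · rw [(sampling_of_sel inp G ω hs v).2.1]
    exact List.Subset.refl _
  · rw [sampling_currentPool_of_not_dvd inp G ω fun h => hs (hsel r h)]
    exact sampling_pool_subset inp G ω hs v

theorem sampling_coveredBy_mono (hsel : ∀ r, P ∣ r → sel r) {r r' : ℕ} (hrr : r ≤ r')
    (hr : ∀ a, r < a → a ≤ r' → ¬ P ∣ a) (X : Set M) :
    coveredBy P E X (cfg r) ⊆ coveredBy P E X (cfg r') := by
  induction r', hrr using Nat.le_induction with
  | base => exact subset_rfl
  | succ r' hrr ih =>
    exact (ih fun a h1 h2 => hr a h1 (by omega)).trans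
      (sampling_coveredBy_succ inp G ω hsel (hr _ (by omega) le_rfl) X)

theorem sampling_coveredBy_start {e : ℕ} (hP : 0 < P) {X : Set M} {u : Fin n}
    (hX : ∀ m ∈ X, ∃ j, (inp u)[j]? = some m ∧ j % E = e) :
    u ∈ coveredBy P E X (cfg (e * P)) := by
  intro m hm
  obtain ⟨j, hj, hje⟩ := hX m hm
  obtain ⟨hround, hcount⟩ := sampling_round_count (c := c) (P := P) (E := E) (Θ := Θ)
    (sel := sel) inp G ω (e * P) u
  refine ⟨j, ?_, getElem?_of_prefix (run_known_prefix alg inp G ω (Nat.zero_le _) u) hj⟩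
  rw [SamplingState.currentPool, hround, hcount, if_pos (Dvd.intro_left e rfl),
    Nat.mul_div_cancel _ hP]
  simp only [List.mem_filter, List.mem_range, decide_eq_true_eq]
  exact ⟨(List.getElem?_eq_some_iff.1 hj).1, hje⟩

end Sampling

/-! ### One broadcast from a lone source -/

section SingleBroadcast

variable {n c g P E N Θ : ℕ} [NeZero N] {sel : ℕ → Prop} {M : Type} [DecidableEq M]
  (inp : Fin n → List M) (G : ℕ → SimpleGraph (Fin n))
  (ω : ℕ → Fin n → SlotCoin 1 N (Fin (2 * n + 1) × Fin (g + 1)))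

local notation "alg" => samplingBroadcast n c g P E N Θ sel

local notation "cfg" => run (samplingBroadcast n c g P E N Θ sel) inp G ω

/-- After the selection round `t₀` with the only source `u`, all awake nodes know the messages
chosen by `u`. -/
theorem sampling_awake_covers {t₀ T : ℕ} (hs : sel t₀) (hns : ∀ r, t₀ < r → r < T → ¬ sel r)
    {u : Fin n} (hu : ∀ v, v ≠ u → (ω t₀ v).2.1 ≠ 0) {X : Set M}
    (hX : Covers (cfg t₀ u).known
      ((((cfg t₀ u).st.currentPool P E).drop ((ω t₀ u).2.2 * c)).take c) X)
    {r : ℕ} (hr : t₀ + 1 ≤ r) (hrT : r < T) (v : Fin n) (hv : (cfg r v).st.act ≠ none) :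
    Covers (cfg r v).known ((cfg r v).st.bundle.take c) X ∧
      Covers (cfg r v).known (cfg r v).st.pool X := by
  induction r, hr using Nat.le_induction generalizing v with
  | base =>
    obtain ⟨h1, h2, h3, h4⟩ := sampling_of_sel (c := c) (P := P) (E := E) (Θ := Θ) inp G ω hs v
    obtain rfl : v = u := by
      by_contra hne
      rw [h3, if_neg (hu v hne)] at hv
      exact hv rfl
    rw [h1, h2, h4, List.take_take, min_self]
    exact ⟨hX, hX.mono (List.prefix_refl _)
      fun i hi => List.mem_of_mem_drop (List.mem_of_mem_take hi)⟩
  | succ r hr ih =>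
    have hnr := hns r (by omega) (by omega)
    have hpre := run_known_prefix alg inp G ω (show r ≤ r + 1 by omega) v
    have ih := fun v hv => ih (by omega) v hv
    rcases hy : reception (G r) (transmission alg (cfg r) (ω r)) v with _ | p
    · obtain ⟨h1, h2, h3, h4⟩ := sampling_of_silence inp G ω hnr hy
      rw [h3] at hv
      rw [h1, h2, h4]
      exact ih v hv
    · obtain ⟨h1, h2, h3, h4⟩ := sampling_of_packet inp G ω hnr hy
      -- A sleeping node adopts the packet, which contains `X` by induction on the sender. A node
      -- already awake keeps its bundle and can only enlarge its pool.
      by_cases hact : (cfg r v).st.act = none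
      · obtain ⟨-, w, hw, hpw⟩ := sampling_reception inp G ω hy
        have hmem : ∀ m ∈ X, m ∈ p.msgs := by
          intro m hm
          obtain ⟨i, hi, him⟩ := (ih w hw).1 m hm
          rw [hpw]
          exact List.mem_filterMap.2 ⟨i, hi, him⟩
        have hsub : p.msgs ⊆ (cfg (r + 1) v).known := by
          rw [h1]
          exact fun m hm => mem_learn.2 (Or.inr hm)
        have hcov := covers_map_idxOf hsub hmem
        have hlen : p.msgs.length ≤ c := by
          rw [hpw]
          exact (List.length_filterMap_le _ _).trans (List.length_take_le _ _)
        rw [h4, if_pos hact, h2, List.take_of_length_le (by rwa [List.length_map])]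
        exact ⟨hcov, hcov.mono (List.prefix_refl _) fun i hi => mem_learn.2 (Or.inr hi)⟩
      · rw [h4, if_neg hact]
        exact ⟨(ih v hact).1.mono hpre (List.Subset.refl _),
          (ih v hact).2.mono hpre (sampling_pool_subset inp G ω hnr v)⟩

theorem sampling_isWake {t₀ T : ℕ} (hs : sel t₀) (hns : ∀ r, t₀ < r → r < T → ¬ sel r)
    (v : Fin n) : IsWake (fun r => (cfg r v).st.act) (t₀ + 1) T := by
  refine ⟨?_, fun r w h1 h2 hw => ?_, fun r h1 h2 hr => ?_⟩
  · simp only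
    rw [(sampling_of_sel inp G ω hs v).2.2.1]
    split_ifs
    exacts [Or.inr rfl, Or.inl rfl]
  · rw [sampling_act_ne_none_succ inp G ω (hns r (by omega) (by omega))]
    · exact hw
    · rw [hw]; exact Option.some_ne_none w
  · have hnr := hns r (by omega) (by omega)
    rcases hy : reception (G r) (transmission alg (cfg r) (ω r)) v with _ | p
    · exact Or.inl ((sampling_of_silence inp G ω hnr hy).2.2.1.trans hr)
    · right
      rw [(sampling_of_packet inp G ω hnr hy).2.2.1, hr]
      rfl

/-- Receiving any packet wakes a sleeping node and leaves an awake one awake. -/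
theorem sampling_awake_of_onlyFires {r : ℕ} (hr : ¬ sel r) {u v : Fin n}
    (hfire : OnlyFires Θ (fun u (_ : Fin 1) => (cfg r u).st.act) r v 0 (ω r))
    (huv : (G r).Adj u v) : (cfg (r + 1) u).st.act ≠ none := by
  have hround := sampling_round (c := c) (P := P) (E := E) (Θ := Θ) (sel := sel) inp G ω r
  have hsend : transmission alg (cfg r) (ω r) v =
      some ⟨((cfg r v).st.bundle.take c).filterMap fun i => (cfg r v).known[i]?, []⟩ := by
    refine (transmission_eq_some _).2 ⟨⟨(cfg r v).st.bundle.take c, []⟩, ?_, rfl⟩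
    refine if_pos ?_
    rw [hround]
    exact ⟨hr, (hfire v 0).2 ⟨rfl, rfl⟩⟩
  have hsole : ∀ w, w ≠ v → transmission alg (cfg r) (ω r) w = none := by
    intro w hw
    rw [transmission_eq_none]
    refine if_neg ?_
    rw [hround]
    rintro ⟨-, hi⟩
    exact hw ((hfire w 0).1 hi).1
  rw [(sampling_of_packet inp G ω hr (reception_of_sole_transmitter hsend hsole huv)).2.2.1]
  exact Option.some_ne_none _

/-- A broadcast from a single source that covers `X` reaches many nodes: the window is too long
for `k` awake nodes. -/
theorem sampling_broadcast_reaches {H : SimpleGraph (Fin n)} (hH : H.Connected)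
    (hHG : ∀ r u v, H.Adj u v → (G r).Adj u v) (hΘ : 0 < Θ) (hsel : ∀ r, P ∣ r → sel r)
    {t₀ T m : ℕ} (hs : sel t₀) (hns : ∀ r, t₀ < r → r < T → ¬ sel r) (htT : t₀ + 1 < T)
    (hTm : T ≤ t₀ + 1 + Θ * m) {u : Fin n} (hu0 : (ω t₀ u).2.1 = 0)
    (hu : ∀ v, v ≠ u → (ω t₀ v).2.1 ≠ 0) {X : Set M}
    (hX : Covers (cfg t₀ u).known
      ((((cfg t₀ u).st.currentPool P E).drop ((ω t₀ u).2.2 * c)).take c) X)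
    (hgood : ∀ v w e, t₀ + 1 ≤ w → w < e → e ≤ T →
      (∀ r, w ≤ r → r < e → (cfg r v).st.act = some w) →
      (∀ r, t₀ + 1 ≤ r → r < w → (cfg r v).st.act = none) →
      ∑ r ∈ Finset.Ico w e, score N Θ (fun u (_ : Fin 1) => (cfg r u).st.act) r ≤ 0 →
      ∃ r, w ≤ r ∧ r < e ∧ OnlyFires Θ (fun u (_ : Fin 1) => (cfg r u).st.act) r v 0 (ω r))
    {k : ℕ} (hlong : 4 * (k * (Θ * (harmonic m : ℚ))) < ((T - (t₀ + 1) : ℕ) : ℝ)) :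
    min (k + 1) n ≤ (coveredBy P E X (cfg (T - 1))).ncard := by
  classical
  have hwake := sampling_isWake (c := c) (P := P) (E := E) (Θ := Θ) inp G ω hs hns
  have hdvd : ¬ P ∣ T - 1 := fun h => hns (T - 1) (by omega) (by omega) (hsel _ h)
  let awake : Finset (Fin n) := {v | (cfg (T - 1) v).st.act ≠ none}
  have hsub : (awake : Set (Fin n)) ⊆ coveredBy P E X (cfg (T - 1)) := by
    intro v hv
    rw [Finset.mem_coe, Finset.mem_filter] at hv
    rw [coveredBy, Set.mem_ofPred_eq, sampling_currentPool_of_not_dvd inp G ω hdvd]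
    exact (sampling_awake_covers inp G ω hs hns hu hX (by omega) (by omega) v hv.2).2
  refine le_trans ?_ (Set.ncard_le_ncard hsub (Set.toFinite _))
  rw [Set.ncard_coe_finset]
  by_contra hcon
  rw [not_le, lt_min_iff] at hcon
  obtain ⟨hk, hn⟩ := hcon
  -- The next selection resets `act`, so having been awake by round `r` within the window is
  -- recorded cumulatively; this makes `I` monotone.
  let I : ℕ → Set (Fin n) := fun r =>
    {v | ∃ r', r' ≤ r ∧ t₀ + 1 ≤ r' ∧ r' ≤ T ∧ (cfg r' v).st.act ≠ none}
  have hI : Monotone I := fun r r' h v ⟨a, h1, h2⟩ => ⟨a, h1.trans h, h2⟩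
  have hself : ∀ v w, t₀ + 1 ≤ w → w < T → v ∈ I w → (w = t₀ + 1 ∨ v ∉ I (w - 1)) →
      (cfg w v).st.act = some w := by
    intro v w hw hwT ⟨a, h1, h2, h3, h4⟩ hfirst
    have haw : a = w := by
      by_contra hne
      exact (hfirst.resolve_left (by omega)) ⟨a, by omega, h2, h3, h4⟩
    subst haw
    refine (hwake v).self_of_first h2 hwT h4 ?_
    by_cases h0 : a = t₀ + 1
    · exact Or.inl h0
    · refine Or.inr ?_
      by_contra hne
      exact (hfirst.resolve_left h0) ⟨a - 1, le_rfl, by omega, by omega, hne⟩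
  have hlast : ∀ v r, t₀ + 1 ≤ r → r < T → (cfg r v).st.act ≠ none → v ∈ awake := by
    intro v r h1 h2 h3
    refine Finset.mem_filter.2 ⟨Finset.mem_univ v, fun h => h3 ?_⟩
    exact (hwake v).eq_none h1 (by omega) (by omega) h
  -- If at most `k` nodes are ever awake, the window is long enough for their mass, so the broadcast
  -- reaches everyone; but then there are `n` awake nodes.
  have huniv : I (T - 1) = Set.univ := by
    refine informed_eq_univ_of_long_window (N := N) (NeZero.ne N) hΘ htT hTm hH hI
      ⟨u, t₀ + 1, le_rfl, le_rfl, htT.le, ?_⟩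
      (W := fun r u (_ : Fin 1) => (cfg r u).st.act) (fun _ => 0) hself ?_
      (awake ×ˢ Finset.univ) ?_ (fun v _ => (hwake v).exists_wake) ?_
    · rw [(sampling_of_sel inp G ω hs u).2.2.1, if_pos hu0]
      exact Option.some_ne_none _
    · intro v w e h1 hwe heT hv hfirst hsc x hvx
      have hw := hself v w h1 (by omega) hv hfirst
      obtain ⟨r, h2, h3, h4⟩ := hgood v w e h1 hwe heT
        (fun r h2 h3 => (hwake v).eq_some h1 h2 (by omega) hw)
        (fun r h2 h3 => by
          by_contra hne
          exact (hfirst.resolve_left (by omega)) ⟨r, by omega, h2, by omega, hne⟩) hsc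
      exact ⟨r + 1, by omega, by omega, by omega, sampling_awake_of_onlyFires inp G ω
        (hns r (by omega) (by omega)) h4 (hHG r x v hvx.symm)⟩
    · intro v i hv r h1 h2
      by_contra hne
      exact hv (Finset.mem_product.2 ⟨hlast v r h1 h2 hne, Finset.mem_univ i⟩)
    · refine lt_of_le_of_lt ?_ hlong
      rw [Finset.card_product, Finset.card_univ, Fintype.card_fin, mul_one]
      have h1 : (awake.card : ℝ) ≤ k := by exact_mod_cast (by omega : awake.card ≤ k)
      have h2 : (0 : ℝ) ≤ (harmonic m : ℚ) := by
        rw [harmonic]; push_cast; positivity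
      gcongr
  have : awake = Finset.univ := Finset.eq_univ_of_forall fun v => by
    obtain ⟨a, h1, h2, h3, h4⟩ := (huniv ▸ Set.mem_univ v : v ∈ I (T - 1))
    exact hlast v a h2 (by omega) h4
  rw [this, Finset.card_univ, Fintype.card_fin] at hn
  exact lt_irrefl _ hn

end SingleBroadcast

/-! ### Stages, epochs and the union bound -/

section Stage

variable {n c g P E N Θ : ℕ} [NeZero N] {sel : ℕ → Prop} {M : Type} [DecidableEq M]
  (inp : Fin n → List M)

local notation "alg" => samplingBroadcast n c g P E N Θ sel

open Classical in
/-- A chunk of the pool that covers `X`, if there is one. -/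
noncomputable def chunkIndex {M : Type} (c g P E : ℕ) (X : Set M)
    (nc : NodeConfig SamplingState M) : Fin (g + 1) :=
  if h : ∃ j : Fin (g + 1),
      Covers nc.known (((nc.st.currentPool P E).drop (j * c)).take c) X then h.choose else 0

theorem covers_chunkIndex {M : Type} {X : Set M} {nc : NodeConfig SamplingState M}
    (h : Covers nc.known (nc.st.currentPool P E) X)
    (hl : (nc.st.currentPool P E).length ≤ c * (g + 1)) (hX : g = 0 ∨ X.Subsingleton) :
    Covers nc.known
      (((nc.st.currentPool P E).drop (chunkIndex c g P E X nc * c)).take c) X := by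
  have hex := h.exists_chunk hl hX
  rw [chunkIndex, dif_pos hex]
  exact hex.choose_spec

/-- In round `r` there is a single source, and it chooses a chunk that covers `X`. -/
def LoneSource {M : Type} (c g P E : ℕ) (X : Set M) (conf : Fin n → NodeConfig SamplingState M)
    (x : Fin n → SlotCoin 1 N (Fin (2 * n + 1) × Fin (g + 1))) : Prop :=
  ∃ v ∈ coveredBy P E X conf, (x v).2 = (0, chunkIndex c g P E X (conf v)) ∧
    ∀ u, u ≠ v → (x u).2.1 ≠ 0

/-- For each node that covers `X`, one suitable chunk is prescribed by the past, so
`le_roundProb_lone_source` applies. -/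
theorem ncard_div_le_roundProb_loneSource {M : Type} (X : Set M)
    (conf : Fin n → NodeConfig SamplingState M) :
    ((coveredBy P E X conf).ncard : ℝ) / (2 * (2 * n + 1) * (g + 1)) ≤
      roundProb (PMF.uniformOfFintype (SlotCoin 1 N (Fin (2 * n + 1) × Fin (g + 1)))) n
        {x | LoneSource c g P E X conf x} := by
  classical
  rw [Set.ncard_eq_toFinset_card']
  refine (le_roundProb_lone_source n g _ fun v => chunkIndex c g P E X (conf v)).trans
    (roundProb_mono _ _ ?_)
  rintro x ⟨v, hv, hx⟩
  exact ⟨v, Set.mem_toFinset.1 hv, hx⟩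

open Classical in
/-- The set of coins for which no lone source covers `X` in the selection rounds from `R` on until
the probabilities of this have added up to `lam`, by round `T`. -/
def selectionFailure (c g P E N Θ : ℕ) [NeZero N] (sel : ℕ → Prop) (inp : Fin n → List M)
    (adv : (ℕ → Fin n → SlotCoin 1 N (Fin (2 * n + 1) × Fin (g + 1))) → ℕ → SimpleGraph (Fin n))
    (R T : ℕ) (X : Set M) (lam : ℝ) :
    Set (ℕ → Fin n → SlotCoin 1 N (Fin (2 * n + 1) × Fin (g + 1))) :=
  {ω | ∃ t ≤ T, (∀ r < t, ¬ ((R ≤ r ∧ sel r) ∧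
      LoneSource c g P E X (run (samplingBroadcast n c g P E N Θ sel) inp (adv ω) ω r) (ω r))) ∧
    lam ≤ ∑ r ∈ Finset.range t, if R ≤ r ∧ sel r then
      ((coveredBy P E X (run (samplingBroadcast n c g P E N Θ sel) inp (adv ω) ω r)).ncard : ℝ) /
        (2 * (2 * n + 1) * (g + 1)) else 0}

/-- The number of nodes that cover `X` is random but known before the selection, so it may serve as
the adapted bound `q`. -/
theorem measure_selectionFailure_le
    {adv : (ℕ → Fin n → SlotCoin 1 N (Fin (2 * n + 1) × Fin (g + 1))) → ℕ → SimpleGraph (Fin n)}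
    (hadv : IsOblivious adv 0) (R T : ℕ) (X : Set M) (lam : ℝ) :
    coinMeasure alg (selectionFailure c g P E N Θ sel inp adv R T X lam) ≤
      ENNReal.ofReal (Real.exp (-lam)) := by
  classical
  have hdep := run_dependsOn alg inp hadv
  refine coinMeasure_no_success_le alg
    (fun ω r => if R ≤ r ∧ sel r then
      ((coveredBy P E X (run alg inp (adv ω) ω r)).ncard : ℝ) /
        (2 * (2 * n + 1) * (g + 1)) else 0)
    (fun ω r => (R ≤ r ∧ sel r) ∧ LoneSource c g P E X (run alg inp (adv ω) ω r) (ω r))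
    ?_ ?_ ?_ ?_ lam T
  · intro r ω ω' h
    have := hdep r h
    simp only at this ⊢
    rw [this]
  · intro r ω ω' h
    have h1 := hdep r fun i hi => h i (lt_trans (Set.mem_Iio.1 hi) (Nat.lt_succ_self r))
    have h2 := h r (Nat.lt_succ_self r)
    simp only at h1 ⊢
    rw [h1, h2]
  · intro ω r
    split_ifs <;> positivity
  · intro ω r
    have h1 : ∀ x, run alg inp (adv (Function.update ω r x)) (Function.update ω r x) r =
        run alg inp (adv ω) ω r := fun x =>
      hdep r fun i hi => Function.update_of_ne (Set.mem_Iio.1 hi).ne _ _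
    simp only [h1, Function.update_self]
    split_ifs with h
    · simp only [h, true_and, and_self]
      exact ncard_div_le_roundProb_loneSource X _
    · exact roundProb_nonneg _ _ _

theorem div_eq_div_of_forall_not_dvd {P R r : ℕ} (hRr : R ≤ r)
    (h : ∀ x, R < x → x ≤ r → ¬ P ∣ x) : r / P = R / P := by
  induction r, hRr using Nat.le_induction with
  | base => rfl
  | succ r hr ih =>
    rw [Nat.succ_div, if_neg (h _ (by omega) le_rfl), add_zero]
    exact ih fun x h1 h2 => h x h1 (by omega)

/-- In a stage, that is a sequence of `k` broadcasts of length `len`, the number of nodes that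
cover `X` grows from `a` to more than `b`. -/
theorem sampling_stage
    {adv : (ℕ → Fin n → SlotCoin 1 N (Fin (2 * n + 1) × Fin (g + 1))) → ℕ → SimpleGraph (Fin n)}
    {ω : ℕ → Fin n → SlotCoin 1 N (Fin (2 * n + 1) × Fin (g + 1))}
    (hconn : IntervalConnected (adv ω) ⊤) (hinp : ∀ v, (inp v).Nodup) (hΘ : 0 < Θ)
    (hsel : ∀ r, P ∣ r → sel r) {R k len a b m : ℕ} {X : Set M} {lam : ℝ}
    (hload : ∀ l : List M, l.Nodup → (∀ m ∈ l, m ∈ epochMessages E inp (R / P)) →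
      l.length ≤ c * (g + 1))
    (hX : g = 0 ∨ X.Subsingleton) (hR : len ∣ R)
    (hstage : ∀ r, R ≤ r → r < R + k * len → (sel r ↔ len ∣ r))
    (hP : ∀ r, R < r → r < R + k * len → ¬ P ∣ r)
    (hlen : 1 < len) (hm : len ≤ 1 + Θ * m)
    (hlong : 4 * (b * (Θ * (harmonic m : ℚ))) < ((len - 1 : ℕ) : ℝ))
    (hlam : lam * (2 * (2 * n + 1) * (g + 1)) ≤ k * a)
    (hfail : ω ∉ selectionFailure c g P E N Θ sel inp adv R (R + k * len) X lam)
    (hiso : ∀ t₀ v, R ≤ t₀ → t₀ < R + k * len → ω ∉ notIsolated Θ (t₀ + 1) (t₀ + len)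
      (fun ω r u (_ : Fin 1) => (run alg inp (adv ω) ω r u).st.act) v 0)
    (ha : a ≤ (coveredBy P E X (run alg inp (adv ω) ω R)).ncard) :
    min (b + 1) n ≤
      (coveredBy P E X (run alg inp (adv ω) ω (R + k * len - 1))).ncard := by
  classical
  have hmono : ∀ r r', R ≤ r → r ≤ r' → r' < R + k * len →
      (coveredBy P E X (run alg inp (adv ω) ω r)).ncard ≤
        (coveredBy P E X (run alg inp (adv ω) ω r')).ncard := fun r r' h1 h2 h3 =>
    Set.ncard_le_ncard (sampling_coveredBy_mono inp (adv ω) ω hsel h2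
      (fun x hx hx' => hP x (by omega) (by omega)) X) (Set.toFinite _)
  -- Within the stage the number of nodes that cover `X` does not drop below `a`, so the `k`
  -- selection rounds contribute at least `lam` in total and one of them has to succeed.
  obtain ⟨r, hrT, ⟨hRr, hselr⟩, v, hv, hcoin, hothers⟩ : ∃ r < R + k * len, (R ≤ r ∧ sel r) ∧
      LoneSource c g P E X (run alg inp (adv ω) ω r) (ω r) := by
    by_contra hno
    push Not at hno
    refine hfail ⟨R + k * len, le_rfl, fun r hr h => hno r hr h.1 h.2, ?_⟩
    have hinj : Set.InjOn (fun j => R + j * len) (Finset.range k : Finset ℕ) := by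
      intro i _ j _ hij
      exact Nat.eq_of_mul_eq_mul_right (by omega) (Nat.add_left_cancel hij)
    refine le_trans ?_ (Finset.sum_le_sum_of_subset_of_nonneg
      (s := (Finset.range k).image fun j => R + j * len) ?_ fun _ _ _ => ?_)
    · rw [Finset.sum_image hinj]
      have hden : (0 : ℝ) < 2 * (2 * n + 1) * (g + 1) := by positivity
      have hle : lam ≤ k * ((a : ℝ) / (2 * (2 * n + 1) * (g + 1))) := by
        rw [← mul_div_assoc, le_div_iff₀ hden]
        exact hlam
      refine hle.trans ?_
      have := Finset.card_nsmul_le_sum (Finset.range k) (fun j =>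
        if R ≤ R + j * len ∧ sel (R + j * len) then
          ((coveredBy P E X (run alg inp (adv ω) ω (R + j * len))).ncard : ℝ) /
            (2 * (2 * n + 1) * (g + 1)) else 0) ((a : ℝ) / (2 * (2 * n + 1) * (g + 1))) ?_
      · rwa [Finset.card_range, nsmul_eq_mul] at this
      · intro j hj
        have hjk : R + j * len < R + k * len := by
          have := Nat.mul_lt_mul_of_pos_right (Finset.mem_range.1 hj) (by omega : 0 < len)
          omega
        have hs : sel (R + j * len) :=
          (hstage _ (by omega) hjk).2 (Nat.dvd_add hR (Dvd.intro_left j rfl))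
        simp only [hs, Nat.le_add_right, and_self, if_true]
        gcongr
        exact ha.trans (hmono _ _ le_rfl (by omega) hjk)
    · intro x hx
      obtain ⟨j, hj, rfl⟩ := Finset.mem_image.1 hx
      have := Nat.mul_lt_mul_of_pos_right (Finset.mem_range.1 hj) (by omega : 0 < len)
      rw [Finset.mem_range]
      omega
    · split_ifs <;> positivity
  have hdvd := (hstage r hRr hrT).1 hselr
  -- Selections occur at multiples of `len`, so the whole broadcast fits into the stage.
  have hend : r + len ≤ R + k * len := by
    obtain ⟨x, rfl⟩ := hdvd
    obtain ⟨y, rfl⟩ := hR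
    have h1 : len * x < len * (y + k) := by rw [mul_add, mul_comm len k]; exact hrT
    have h2 : len * (x + 1) ≤ len * (y + k) :=
      Nat.mul_le_mul_left _ (Nat.lt_of_mul_lt_mul_left h1)
    rw [mul_add, mul_add, mul_comm len k] at h2
    omega
  have hns : ∀ r', r < r' → r' < r + len → ¬ sel r' := by
    intro r' h1 h2 h3
    have h4 := (hstage r' (by omega) (by omega)).1 h3
    have h5 := Nat.le_of_dvd (by omega) (Nat.dvd_sub h4 hdvd)
    omega
  have hdiv : r / P = R / P :=
    div_eq_div_of_forall_not_dvd hRr fun x h1 h2 => hP x h1 (by omega)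
  have hpool : ((run alg inp (adv ω) ω r v).st.currentPool P E).length ≤ c * (g + 1) :=
    sampling_currentPool_length_le inp (adv ω) ω hsel hinp (hdiv ▸ hload) v
  refine (sampling_broadcast_reaches inp (adv ω) ω (hconn 0) (fun r u v h => stableGraph_adj h r)
    hΘ hsel hselr hns (by omega) (by omega : r + len ≤ r + 1 + Θ * m) (u := v)
    (congrArg Prod.fst hcoin) hothers (X := X) ?_ ?_ ?_).trans
    (hmono (r + len - 1) _ (by omega) (by omega) (by omega))
  · rw [congrArg Prod.snd hcoin]
    exact covers_chunkIndex hv hpool hX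
  · intro u w e h1 h2 h3 h4 h5 h6
    by_contra hno
    push Not at hno
    exact hiso r u hRr hrT ⟨w, e, h1, h2, h3, h4, h5, h6, hno⟩
  · rwa [show r + len - (r + 1) = len - 1 by omega]

/-- By the end of an epoch, all nodes cover `X`: the number of nodes that do doubles in each
stage. -/
theorem sampling_epoch
    {adv : (ℕ → Fin n → SlotCoin 1 N (Fin (2 * n + 1) × Fin (g + 1))) → ℕ → SimpleGraph (Fin n)}
    {ω : ℕ → Fin n → SlotCoin 1 N (Fin (2 * n + 1) × Fin (g + 1))}
    (hconn : IntervalConnected (adv ω) ⊤) (hinp : ∀ v, (inp v).Nodup) (hΘ : 0 < Θ)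
    {ℓ K L Q m e : ℕ} {X : Set M} {lam : ℝ} (hℓ : 0 < ℓ) (hK : 0 < K) (hQ : Q = 2 ^ ℓ * K * L)
    (hP : P = ℓ * Q) (hsel : ∀ r, sel r ↔ 2 ^ (r / Q % ℓ) * L ∣ r)
    (hload : ∀ l : List M, l.Nodup → (∀ m ∈ l, m ∈ epochMessages E inp e) →
      l.length ≤ c * (g + 1))
    (hX : g = 0 ∨ X.Subsingleton) {u : Fin n}
    (hu : ∀ m ∈ X, ∃ j, (inp u)[j]? = some m ∧ j % E = e)
    (hnℓ : n ≤ 2 ^ ℓ) (hm : 2 ^ ℓ * L ≤ Θ * m) (hL : 8 * (Θ * (harmonic m : ℚ)) ≤ (L : ℝ))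
    (hL1 : 1 < L)
    (hlam : lam * (2 * (2 * n + 1) * (g + 1)) ≤ n * K)
    (hfail : ∀ i < ℓ, ω ∉ selectionFailure c g P E N Θ sel inp adv ((e * ℓ + i) * Q)
      ((e * ℓ + i) * Q + Q) X lam)
    (hiso : ∀ t₀ v, t₀ < (e + 1) * P → ω ∉ notIsolated Θ (t₀ + 1) (t₀ + 2 ^ (t₀ / Q % ℓ) * L)
      (fun ω r u (_ : Fin 1) => (run alg inp (adv ω) ω r u).st.act) v 0) :
    coveredBy P E X (run alg inp (adv ω) ω ((e + 1) * P - 1)) = Set.univ := by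
  have hQ0 : 0 < Q := by rw [hQ]; positivity
  have hP0 : 0 < P := by rw [hP]; positivity
  have hQdvd : ∀ i, i ≤ ℓ → 2 ^ i * L ∣ Q := by
    intro i hi
    rw [hQ, mul_right_comm]
    exact Dvd.dvd.mul_right (Nat.mul_dvd_mul_right (pow_dvd_pow 2 hi) L) K
  have hselP : ∀ r, P ∣ r → sel r := fun r hr => (hsel r).2
    (((hQdvd _ (Nat.mod_lt _ hℓ).le).trans (hP ▸ Dvd.intro_left ℓ rfl)).trans hr)
  have hmod : ∀ i < ℓ, ∀ r, (e * ℓ + i) * Q ≤ r → r < (e * ℓ + i) * Q + Q → r / Q % ℓ = i := by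
    intro i hi r h1 h2
    have : r / Q = e * ℓ + i := by
      rw [Nat.div_eq_iff hQ0]
      omega
    rw [this, Nat.add_comm, Nat.add_mul_mod_self_right, Nat.mod_eq_of_lt hi]
  have hmP : 1 ≤ m := by
    rcases Nat.eq_zero_or_pos m with rfl | h
    · have : 0 < 2 ^ ℓ * L := by positivity
      omega
    · exact h
  have hH : (1 : ℝ) ≤ Θ * (harmonic m : ℚ) := by
    have h1 : (1 : ℝ) ≤ Θ := by exact_mod_cast hΘ
    have h2 : (1 : ℝ) ≤ (harmonic m : ℚ) := by
      have : (1 : ℚ) ≤ harmonic m := by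
        rw [harmonic]
        refine le_trans (by simp) (Finset.single_le_sum (f := fun i : ℕ => ((i + 1 : ℕ) : ℚ)⁻¹)
          (fun _ _ => by positivity) (Finset.mem_range.2 hmP))
      exact_mod_cast this
    nlinarith
  have hstep : ∀ i < ℓ, min (2 ^ i) n ≤
      (coveredBy P E X (run alg inp (adv ω) ω ((e * ℓ + i) * Q))).ncard →
      min (2 ^ (i + 1)) n ≤
      (coveredBy P E X (run alg inp (adv ω) ω ((e * ℓ + i) * Q + Q - 1))).ncard := by
    intro i hi hai
    -- Number of broadcasts times their length: every stage takes `Q` rounds.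
    have hkl : 2 ^ (ℓ - i) * K * (2 ^ i * L) = Q := by
      rw [hQ, ← Nat.sub_add_cancel hi.le, pow_add, Nat.add_sub_cancel]
      ring
    have hRP : (e * ℓ + i) * Q / P = e := by
      rw [hP, Nat.mul_div_mul_right _ _ hQ0, mul_comm, Nat.mul_add_div hℓ, Nat.div_eq_of_lt hi,
        add_zero]
    have h2i : (1 : ℕ) ≤ 2 ^ i := Nat.one_le_two_pow
    have hlen1 : 1 < 2 ^ i * L := hL1.trans_le (Nat.le_mul_of_pos_left _ h2i)
    have hstage := sampling_stage (c := c) (E := E) (sel := sel) (lam := lam) inp hconn hinp hΘ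
      hselP (R := (e * ℓ + i) * Q) (k := 2 ^ (ℓ - i) * K) (len := 2 ^ i * L) (a := min (2 ^ i) n)
      (b := 2 ^ (i + 1) - 1) (m := m) (X := X) (by rwa [hRP]) hX
      (Dvd.dvd.mul_left (hQdvd i hi.le) _)
      (fun r h1 h2 => by rw [hsel, hmod i hi r h1 (by rwa [hkl] at h2)]) ?_ hlen1 ?_ ?_ ?_
      (by rw [hkl]; exact hfail i hi) ?_ hai
    · rwa [hkl, Nat.sub_add_cancel Nat.one_le_two_pow] at hstage
    · rw [hkl]
      intro r h1 h2 h3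
      have h4 : Q ∣ r := (hP ▸ Dvd.intro_left ℓ rfl : Q ∣ P).trans h3
      have h5 := Nat.le_of_dvd (by omega) (Nat.dvd_sub h4 (Dvd.intro_left (e * ℓ + i) rfl))
      omega
    · have : 2 ^ i * L ≤ 2 ^ ℓ * L :=
        Nat.mul_le_mul_right _ (Nat.pow_le_pow_right (by norm_num) hi.le)
      omega
    -- `4 * (2 ^ (i + 1) - 1) * Θ * H_m` is at most `2 ^ i * L - 4 * Θ * H_m`. By `hH` this leaves
    -- room for the selection round that is missing from the window.
    · rw [Nat.cast_sub hlen1.le, Nat.cast_sub Nat.one_le_two_pow]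
      push_cast
      have h3 : (1 : ℝ) ≤ 2 ^ i := one_le_pow₀ (by norm_num)
      rw [pow_succ]
      nlinarith
    · refine hlam.trans ?_
      have : n * K ≤ 2 ^ (ℓ - i) * K * min (2 ^ i) n := by
        rcases le_total (2 ^ i) n with h | h
        · rw [min_eq_left h]
          calc n * K ≤ 2 ^ ℓ * K := Nat.mul_le_mul_right _ hnℓ
            _ = 2 ^ (ℓ - i) * K * 2 ^ i := by
              rw [← Nat.sub_add_cancel hi.le, pow_add, Nat.add_sub_cancel]
              ring
        · rw [min_eq_right h, mul_assoc, mul_comm n K]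
          exact Nat.le_mul_of_pos_left _ (by positivity)
      exact_mod_cast this
    · rw [hkl]
      intro t₀ v h1 h2
      have h3 := hiso t₀ v (by
        have h4 : (e * ℓ + i + 1) * Q ≤ (e * ℓ + ℓ) * Q := Nat.mul_le_mul_right _ (by omega)
        have h5 : (e + 1) * P = (e * ℓ + ℓ) * Q := by rw [hP]; ring
        rw [h5]
        rw [add_mul _ 1, one_mul] at h4
        omega)
      rwa [hmod i hi t₀ h1 h2] at h3
  have hall : ∀ i < ℓ, min (2 ^ i) n ≤
      (coveredBy P E X (run alg inp (adv ω) ω ((e * ℓ + i) * Q))).ncard := by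
    intro i
    induction i with
    | zero =>
      intro _
      have hmem := sampling_coveredBy_start (c := c) (Θ := Θ) (sel := sel) inp (adv ω) ω hP0 hu
      refine (min_le_left _ _).trans ?_
      rw [pow_zero, add_zero, mul_assoc, ← hP]
      exact (Set.ncard_pos (Set.toFinite _)).2 ⟨u, hmem⟩
    | succ i ih =>
      intro hi
      refine (hstep i (by omega) (ih (by omega))).trans ?_
      have heq : (e * ℓ + (i + 1)) * Q = (e * ℓ + i) * Q + Q := by ring
      rw [heq]
      refine Set.ncard_le_ncard (sampling_coveredBy_mono inp (adv ω) ω hselP (Nat.sub_le _ _)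
        (fun x h1 h2 h3 => ?_) X) (Set.toFinite _)
      -- Only the first round of the next stage needs checking; it does not start an epoch because
      -- `i + 1 < ℓ`.
      obtain rfl : x = (e * ℓ + i) * Q + Q := by omega
      rw [← heq, hP] at h3
      have h4 := Nat.dvd_of_mul_dvd_mul_right hQ0 h3
      have h5 := Nat.le_of_dvd (by omega) ((Nat.dvd_add_right (Dvd.intro_left e rfl)).1 h4)
      omega
  have hfin := hstep (ℓ - 1) (by omega) (hall (ℓ - 1) (by omega))
  have heq : (e * ℓ + (ℓ - 1)) * Q + Q = (e + 1) * P := by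
    rw [hP, ← Nat.succ_mul, Nat.succ_eq_add_one, add_assoc, Nat.sub_add_cancel hℓ]
    ring
  rw [heq, Nat.sub_add_cancel hℓ, min_eq_right hnℓ] at hfin
  refine Set.eq_of_subset_of_ncard_le (Set.subset_univ _) ?_ (Set.toFinite _)
  rwa [Set.ncard_univ, Nat.card_eq_fintype_card, Fintype.card_fin]

/-- Every message lies in a class that, in its epoch, starts at a single node and is covered as a
whole. Failures to isolate an agent are summed over start rounds and nodes, failures to select over
classes and stages. A start round before `E * P` has a window ending by `E * P + Q`, which is why
`N` needs divisors up to there. -/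
theorem sampling_solves {ℓ K L Q m s B κ : ℕ} {lam ε : ℝ} (hΘ : 0 < Θ) (hℓ : 0 < ℓ) (hK : 0 < K)
    (hQ : Q = 2 ^ ℓ * K * L) (hP : P = ℓ * Q) (hsel : ∀ r, sel r ↔ 2 ^ (r / Q % ℓ) * L ∣ r)
    (hnℓ : n ≤ 2 ^ ℓ) (hm : 2 ^ ℓ * L ≤ Θ * m) (hL : 8 * (Θ * (harmonic m : ℚ)) ≤ (L : ℝ))
    (hL1 : 1 < L) (hlam : lam * (2 * (2 * n + 1) * (g + 1)) ≤ n * K)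
    (hdvd : ∀ j, 1 ≤ j → j ≤ E * P + Q → j ∣ N)
    (hload : ∀ inp : Fin n → List (BitVec B), IsInput inp s → ∀ e < E, ∀ l : List (BitVec B),
      l.Nodup → (∀ m ∈ l, m ∈ epochMessages E inp e) → l.length ≤ c * (g + 1))
    (hclass : ∀ inp : Fin n → List (BitVec B), IsInput inp s →
      ∃ classes : Finset (ℕ × Set (BitVec B)), classes.card ≤ κ ∧
        (∀ p ∈ classes, p.1 < E ∧ (g = 0 ∨ p.2.Subsingleton) ∧
          ∃ u, ∀ m ∈ p.2, ∃ j, (inp u)[j]? = some m ∧ j % E = p.1) ∧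
        ∀ u, ∀ m ∈ inp u, ∃ p ∈ classes, m ∈ p.2)
    (hε : E * P * n * Real.exp (-(Θ / 8)) + κ * ℓ * Real.exp (-lam) ≤ ε) :
    Solves alg ⊤ 0 s B (E * P) (1 - ε) := by
  intro inp adv hinp hobl hconn
  obtain ⟨classes, hcard, hprop, hcover⟩ := hclass inp hinp
  let W : (ℕ → Fin n → SlotCoin 1 N (Fin (2 * n + 1) × Fin (g + 1))) → ℕ → Fin n → Fin 1 →
    Option ℕ := fun ω r u _ => (run alg inp (adv ω) ω r u).st.act
  have hW : ∀ r, DependsOn (fun ω => W ω r) (Set.Iio r) := by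
    intro r ω ω' h
    have := run_dependsOn alg inp hobl r h
    simp only at this
    simp only [W, this]
  refine le_coinMeasure_of_compl_subset _ (le_trans (by positivity) hε)
    (bad := (⋃ a ∈ Finset.range (E * P) ×ˢ (Finset.univ : Finset (Fin n)),
        notIsolated Θ (a.1 + 1) (a.1 + 2 ^ (a.1 / Q % ℓ) * L) W a.2 0) ∪
      ⋃ a ∈ classes ×ˢ Finset.range ℓ, selectionFailure c g P E N Θ sel inp adv
        ((a.1.1 * ℓ + a.2) * Q) ((a.1.1 * ℓ + a.2) * Q + Q) a.1.2 lam)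
    (fun ω hω => ?_) ?_
  · intro u v msg hmsg
    obtain ⟨⟨e, X⟩, hp, hmX⟩ := hcover u msg hmsg
    obtain ⟨he, hX, w, hw⟩ := hprop _ hp
    have hend : (e + 1) * P ≤ E * P := Nat.mul_le_mul_right _ he
    have huniv := sampling_epoch (c := c) (sel := sel) inp (hconn ω) hinp.nodup hΘ hℓ hK hQ hP
      hsel (hload inp hinp e he) hX hw hnℓ hm hL hL1 hlam
      (fun i hi hmem => hω (Or.inr (Set.mem_biUnion (x := ((e, X), i))
        (Finset.mem_product.2 ⟨hp, Finset.mem_range.2 hi⟩) hmem)))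
      (fun t₀ v ht hmem => hω (Or.inl (Set.mem_biUnion (x := (t₀, v))
        (Finset.mem_product.2 ⟨Finset.mem_range.2 (ht.trans_le hend), Finset.mem_univ v⟩) hmem)))
    have hv : v ∈ coveredBy P E X (run alg inp (adv ω) ω ((e + 1) * P - 1)) :=
      huniv ▸ Set.mem_univ v
    obtain ⟨i, -, hi⟩ := hv msg hmX
    exact (run_known_prefix alg inp (adv ω) ω ((Nat.sub_le _ _).trans hend) v).subset
      (List.mem_of_getElem? hi)
  · refine (measure_union_le _ _).trans ((add_le_add
      ((measure_biUnion_finset_le _ _).trans (Finset.sum_le_card_nsmul _ _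
        (ENNReal.ofReal (Real.exp (-(Θ / 8)))) fun a ha => ?_))
      ((measure_biUnion_finset_le _ _).trans (Finset.sum_le_card_nsmul _ _
        (ENNReal.ofReal (Real.exp (-lam))) fun a _ =>
          measure_selectionFailure_le inp hobl _ _ _ _))).trans ?_)
    · refine measure_notIsolated_le Θ _ (fun j h1 h2 => hdvd j h1 (h2.trans ?_)) W hW _ _
      have h3 := Finset.mem_range.1 (Finset.mem_product.1 ha).1
      have h4 : 2 ^ (a.1 / Q % ℓ) * L ≤ Q := by
        rw [hQ, mul_right_comm]
        refine (Nat.mul_le_mul_right L (Nat.pow_le_pow_right (by norm_num)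
          (Nat.mod_lt _ hℓ).le)).trans (Nat.le_mul_of_pos_right _ hK)
      omega
    · rw [Finset.card_product, Finset.card_product, Finset.card_range, Finset.card_range,
        Finset.card_univ, Fintype.card_fin, nsmul_eq_mul, nsmul_eq_mul, ← ENNReal.ofReal_natCast,
        ← ENNReal.ofReal_natCast, ← ENNReal.ofReal_mul (Nat.cast_nonneg _),
        ← ENNReal.ofReal_mul (Nat.cast_nonneg _),
        ← ENNReal.ofReal_add (by positivity) (by positivity)]
      refine ENNReal.ofReal_le_ofReal (le_trans ?_ hε)
      push_cast
      gcongr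

end Stage

/-! ### Choice of parameters -/

section Parameters

theorem clog_two_bounds {n : ℕ} (hn : 2 ≤ n) :
    1 ≤ Nat.clog 2 n ∧ n ≤ 2 ^ Nat.clog 2 n ∧ 2 ^ Nat.clog 2 n ≤ 2 * n ∧
      Real.log n ≤ Nat.clog 2 n ∧ (Nat.clog 2 n : ℝ) ≤ 3 * Real.log n ∧ 1 / 2 ≤ Real.log n := by
  have h1 : 1 ≤ Nat.clog 2 n := Nat.clog_pos (by norm_num) hn
  have h2 : n ≤ 2 ^ Nat.clog 2 n := Nat.le_pow_clog (by norm_num) n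
  have h3 : 2 ^ (Nat.clog 2 n - 1) < n := Nat.pow_pred_clog_lt_self (by norm_num) hn
  have hn0 : (0 : ℝ) < n := by exact_mod_cast (by omega : 0 < n)
  have hlog2 := Real.log_two_gt_d9
  have hlog2' := Real.log_two_lt_d9
  have hlog : Real.log 2 ≤ Real.log n :=
    Real.log_le_log (by norm_num) (by exact_mod_cast hn)
  refine ⟨h1, h2, ?_, ?_, ?_, by linarith⟩
  · have : 2 ^ Nat.clog 2 n = 2 ^ (Nat.clog 2 n - 1) * 2 := by
      rw [← pow_succ, Nat.sub_add_cancel h1]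
    omega
  · have h4 : Real.log n ≤ Nat.clog 2 n * Real.log 2 := by
      rw [← Real.log_pow]
      exact Real.log_le_log hn0 (by exact_mod_cast h2)
    have h5 : (0 : ℝ) ≤ Nat.clog 2 n := Nat.cast_nonneg _
    nlinarith
  · have h4 : ((Nat.clog 2 n - 1 : ℕ) : ℝ) * Real.log 2 ≤ Real.log n := by
      rw [← Real.log_pow]
      exact Real.log_le_log (by positivity) (by exact_mod_cast h3.le)
    rw [Nat.cast_sub h1] at h4
    push_cast at h4
    nlinarith

theorem natCast_le_exp_clog {n : ℕ} (hn : 2 ≤ n) : (n : ℝ) ≤ Real.exp (Nat.clog 2 n) := by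
  have hn0 : (0 : ℝ) < n := by exact_mod_cast (by omega : 0 < n)
  rw [← Real.log_le_iff_le_exp hn0]
  exact (clog_two_bounds hn).2.2.2.1

theorem exp_neg_le_rpow {n a : ℕ} (hn : 2 ≤ n) {γ : ℝ} (ha : γ ≤ a) :
    Real.exp (-(a * Nat.clog 2 n)) ≤ (n : ℝ) ^ (-γ) := by
  have hn0 : (0 : ℝ) < n := by exact_mod_cast (by omega : 0 < n)
  rw [Real.rpow_def_of_pos hn0]
  refine Real.exp_le_exp.2 ?_
  obtain ⟨-, -, -, h1, -, h2⟩ := clog_two_bounds hn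
  have := mul_le_mul ha h1 (by linarith) (Nat.cast_nonneg a)
  linarith

/-- The failure probability of polynomially many events of probability `exp (-D * l)` each. -/
theorem failure_le {n a : ℕ} (hn : 2 ≤ n) :
    (2 : ℝ) ^ 15 * (2 * (a + 25 : ℕ)) ^ 2 * n ^ 3 * (Nat.clog 2 n : ℝ) ^ 4 *
      Real.exp (-((2 * (a + 25) : ℕ) * Nat.clog 2 n)) ≤ Real.exp (-(a * Nat.clog 2 n)) := by
  have hl1 : (1 : ℝ) ≤ Nat.clog 2 n := by exact_mod_cast (clog_two_bounds hn).1
  have hnexp := natCast_le_exp_clog hn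
  set l : ℝ := (Nat.clog 2 n : ℝ) with hl
  set d : ℝ := ((a + 25 : ℕ) : ℝ) with hd
  have hd0 : 0 ≤ d := Nat.cast_nonneg _
  -- Half of the exponent `2 * d * l` absorbs the square of `2 * d`; the shift `25 = 3 + 4 + 18`
  -- pays for `n ^ 3`, `l ^ 4` and the numerical factor.
  have h1 : (2 * d) ^ 2 ≤ 8 * Real.exp (d * l) := by
    have h2 := Real.quadratic_le_exp_of_nonneg hd0
    have h3 : Real.exp d ≤ Real.exp (d * l) := Real.exp_le_exp.2 (by nlinarith)
    nlinarith
  have h2 : (n : ℝ) ^ 3 ≤ Real.exp (3 * l) := by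
    rw [show (3 : ℝ) * l = (3 : ℕ) * l by norm_num, Real.exp_nat_mul]
    gcongr
  have h3 : l ^ 4 ≤ Real.exp (4 * l) := by
    rw [show (4 : ℝ) * l = (4 : ℕ) * l by norm_num, Real.exp_nat_mul]
    have := Real.add_one_le_exp l
    gcongr
    linarith
  have h4 : (2 : ℝ) ^ 18 ≤ Real.exp (18 * l) := by
    rw [show (18 : ℝ) * l = (18 : ℕ) * l by norm_num, Real.exp_nat_mul]
    have := Real.add_one_le_exp l
    gcongr
    linarith
  calc (2 : ℝ) ^ 15 * (2 * d) ^ 2 * n ^ 3 * l ^ 4 * Real.exp (-((2 * (a + 25) : ℕ) * l))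
      ≤ 2 ^ 15 * (8 * Real.exp (d * l)) * Real.exp (3 * l) * Real.exp (4 * l) *
        Real.exp (-((2 * (a + 25) : ℕ) * l)) := by gcongr
    _ = 2 ^ 18 * (Real.exp (d * l) * Real.exp (3 * l) * Real.exp (4 * l) *
        Real.exp (-((2 * (a + 25) : ℕ) * l))) := by ring
    _ ≤ Real.exp (18 * l) * (Real.exp (d * l) * Real.exp (3 * l) * Real.exp (4 * l) *
        Real.exp (-((2 * (a + 25) : ℕ) * l))) := by gcongr
    _ = Real.exp (-(a * l)) := by
      rw [← Real.exp_add, ← Real.exp_add, ← Real.exp_add, ← Real.exp_add, hd]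
      congr 1
      push_cast
      ring

/-- Harmonic numbers of polynomial index. -/
theorem harmonic_mul_clog_le {n k q : ℕ} (hn : 2 ≤ n) (hq : q ≠ 0) (hqn : q ≤ n ^ 2 * 2) :
    ((harmonic (2 ^ k * q * Nat.clog 2 n) : ℚ) : ℝ) ≤ (5 + k) * Nat.clog 2 n := by
  obtain ⟨h1, h2, -, h3, -, -⟩ := clog_two_bounds hn
  have hl1 : (1 : ℝ) ≤ Nat.clog 2 n := by exact_mod_cast h1
  have hlog2 := Real.log_two_lt_d9
  have hlog0 := Real.log_two_gt_d9
  have hn0 : (0 : ℝ) < n := by exact_mod_cast (by omega : 0 < n)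
  have hq0 : (0 : ℝ) < q := by exact_mod_cast Nat.pos_of_ne_zero hq
  refine (harmonic_le_one_add_log _).trans ?_
  push_cast
  rw [Real.log_mul (by positivity) (by positivity), Real.log_mul (by positivity) (by positivity),
    Real.log_pow]
  have h4 : Real.log q ≤ 2 * Real.log n + Real.log 2 := by
    refine (Real.log_le_log hq0 (by exact_mod_cast hqn : (q : ℝ) ≤ n ^ 2 * 2)).trans ?_
    rw [Real.log_mul (by positivity) (by norm_num), Real.log_pow]
    push_cast
    rfl
  have h5 : Real.log (Nat.clog 2 n) ≤ Nat.clog 2 n - 1 := Real.log_le_sub_one_of_pos (by linarith)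
  have h6 : (k : ℝ) * Real.log 2 ≤ k * Nat.clog 2 n :=
    mul_le_mul_of_nonneg_left (by linarith) (Nat.cast_nonneg k)
  linarith

theorem exists_harmonicMulti_solves (a : ℕ) {n s : ℕ} (B b : ℕ) (hn : 2 ≤ n) (hs : 1 ≤ s)
    (hsn : s ≤ n) {ε : ℝ} (hε : Real.exp (-(a * Nat.clog 2 n)) ≤ ε) :
    ∃ (A : Algorithm n) (t : ℕ), A.HasCapacity 1 b ∧
      t = 16 * (a + 25) * Nat.clog 2 n * (64 * (n * s) * Nat.clog 2 n) ∧
      Solves A ⊤ 0 s B t (1 - ε) := by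
  obtain ⟨h1, -, -, -, -, -⟩ := clog_two_bounds hn
  have hl1 : (1 : ℝ) ≤ Nat.clog 2 n := by exact_mod_cast h1
  have hfail := failure_le (a := a) hn
  have hH := harmonic_mul_clog_le (k := 6) (q := n * s) hn (Nat.mul_ne_zero (by omega) (by omega))
    (by nlinarith)
  set l := Nat.clog 2 n with hl
  have hn0 : 0 < n := by omega
  -- The factorial makes `N` a common multiple of all denominators, so the transmission
  -- probabilities are exact.
  have hne : NeZero (16 * (a + 25) * l * (64 * (n * s) * l)).factorial :=
    ⟨Nat.factorial_ne_zero _⟩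
  refine ⟨harmonicMulti n s (16 * (a + 25) * l * (64 * (n * s) * l)).factorial
    (16 * (a + 25) * l), _, harmonicMulti_hasCapacity _ _ _ _ _, rfl,
    multi_solves (by positivity) (by positivity) (fun j h1 h2 => Nat.dvd_factorial h1 h2) ?_ ?_⟩
  -- Here `H_m ≤ 11 * l`, and `4 * 11 < 64`.
  · rw [show (64 : ℕ) = 2 ^ 6 by norm_num]
    have hns : (0 : ℝ) < n * s := by exact_mod_cast Nat.mul_pos hn0 hs
    refine lt_of_le_of_lt (mul_le_mul_of_nonneg_left (mul_le_mul_of_nonneg_left hH hns.le)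
      (by norm_num)) ?_
    push_cast
    nlinarith [mul_pos hns (by linarith : (0 : ℝ) < l)]
  · refine le_trans ?_ (hfail.trans hε)
    have hexp : -(((16 * (a + 25) * l : ℕ) : ℝ) / 8) = -((2 * (a + 25) : ℕ) * (l : ℝ)) := by
      push_cast; ring
    rw [hexp]
    refine mul_le_mul_of_nonneg_right ?_ (Real.exp_pos _).le
    have h2 : (s : ℝ) ≤ n := by exact_mod_cast hsn
    have h3 : (1 : ℝ) ≤ n := by exact_mod_cast hn0
    have h4 : (1 : ℝ) ≤ (2 * (a + 25 : ℕ)) ^ 2 := by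
      refine one_le_pow₀ ?_
      push_cast
      linarith [(Nat.cast_nonneg a : (0 : ℝ) ≤ a)]
    have h5 : (1 : ℝ) ≤ (l : ℝ) ^ 4 := one_le_pow₀ hl1
    calc (n : ℝ) * s ≤ n * n := by gcongr
      _ = 1 * 1 * (n * n * 1) * 1 := by ring
      _ ≤ 2 ^ 15 * (2 * (a + 25 : ℕ)) ^ 2 * (n * n * n) * l ^ 4 := by gcongr; norm_num
      _ = 2 ^ 15 * (2 * (a + 25 : ℕ)) ^ 2 * n ^ 3 * l ^ 4 := by ring

theorem exists_samplingBroadcast_solves (a : ℕ) {n s c g E B κ : ℕ} (b : ℕ) (hn : 2 ≤ n)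
    (hEg : E * (g + 1) ≤ 2 * n) (hκ : κ ≤ 2 * n ^ 2)
    (hload : ∀ inp : Fin n → List (BitVec B), IsInput inp s → ∀ e < E, ∀ l : List (BitVec B),
      l.Nodup → (∀ m ∈ l, m ∈ epochMessages E inp e) → l.length ≤ c * (g + 1))
    (hclass : ∀ inp : Fin n → List (BitVec B), IsInput inp s →
      ∃ classes : Finset (ℕ × Set (BitVec B)), classes.card ≤ κ ∧
        (∀ p ∈ classes, p.1 < E ∧ (g = 0 ∨ p.2.Subsingleton) ∧
          ∃ u, ∀ m ∈ p.2, ∃ j, (inp u)[j]? = some m ∧ j % E = p.1) ∧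
        ∀ u, ∀ m ∈ inp u, ∃ p ∈ classes, m ∈ p.2)
    {ε : ℝ} (hε : Real.exp (-(a * Nat.clog 2 n)) ≤ ε) :
    ∃ (A : Algorithm n) (t : ℕ), A.HasCapacity c b ∧
      t ≤ 6144 * (2 * (a + 25)) ^ 2 * (E * (g + 1)) * (2 * n) * Nat.clog 2 n ^ 4 ∧
      Solves A ⊤ 0 s B t (1 - ε) := by
  obtain ⟨h1, hnl, h2n, -, -, -⟩ := clog_two_bounds hn
  have hl1 : (1 : ℝ) ≤ Nat.clog 2 n := by exact_mod_cast h1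
  have hfail := failure_le (a := a) hn
  have hH := harmonic_mul_clog_le (k := 7) (q := 2 ^ Nat.clog 2 n) hn (by positivity)
    (h2n.trans (by nlinarith))
  have hn0 : 0 < n := by omega
  generalize Nat.clog 2 n = l at *
  obtain ⟨D, hD⟩ : ∃ D, D = 2 * (a + 25) := ⟨_, rfl⟩
  have hD0 : 1 ≤ D := by omega
  have hcast : (2 * ((a + 25 : ℕ) : ℝ)) = D := by rw [hD]; push_cast; ring
  rw [hcast, ← hD] at hfail
  rw [← hD]
  -- `8 * D * l` is `Θ`. The other factor dominates `8 * H_m`, because `H_m ≤ 12 * l` and `8 * 12 ≤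
  -- 128`.
  obtain ⟨L, hL⟩ : ∃ L, L = 8 * D * l * (128 * l) := ⟨_, rfl⟩
  -- The middle factor is `K`: it makes `n * K` at least `lam * 2 * (2 * n + 1) * (g + 1)` with `lam
  -- = D * l`, since `4 * n + 2 ≤ 6 * n`.
  obtain ⟨Q, hQ⟩ : ∃ Q, Q = 2 ^ l * (6 * (g + 1) * D * l) * L := ⟨_, rfl⟩
  have ht : E * (l * Q) ≤ 6144 * D ^ 2 * (E * (g + 1)) * (2 * n) * l ^ 4 := by
    rw [hQ, hL]
    calc E * (l * (2 ^ l * (6 * (g + 1) * D * l) * (8 * D * l * (128 * l))))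
        = 6144 * D ^ 2 * (E * (g + 1)) * 2 ^ l * l ^ 4 := by ring
      _ ≤ 6144 * D ^ 2 * (E * (g + 1)) * (2 * n) * l ^ 4 := by gcongr
  have hne : NeZero (E * (l * Q) + Q).factorial := ⟨Nat.factorial_ne_zero _⟩
  refine ⟨samplingBroadcast n c g (l * Q) E (E * (l * Q) + Q).factorial (8 * D * l)
    (fun r => 2 ^ (r / Q % l) * L ∣ r), E * (l * Q),
    samplingBroadcast_hasCapacity _ _ _ _ _ _ _ _ _, ht, ?_⟩
  refine sampling_solves (lam := D * l) (m := 2 ^ 7 * 2 ^ l * l) (by positivity) h1 (by positivity)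
    hQ rfl (fun r => Iff.rfl) hnl ?_ ?_ ?_ ?_ (fun j h1 h2 => Nat.dvd_factorial h1 h2)
    hload hclass ?_
  · rw [hL]
    exact le_of_eq (by ring)
  · rw [hL]
    have h3 : (0 : ℝ) < ((8 * D * l : ℕ) : ℝ) := by exact_mod_cast (by positivity)
    calc 8 * (((8 * D * l : ℕ) : ℝ) * ((harmonic (2 ^ 7 * 2 ^ l * l) : ℚ) : ℝ))
        ≤ 8 * (((8 * D * l : ℕ) : ℝ) * ((5 + (7 : ℕ)) * l)) := by gcongr
      _ ≤ ((8 * D * l * (128 * l) : ℕ) : ℝ) := by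
        rw [Nat.cast_mul (8 * D * l)]
        push_cast at h3 ⊢
        nlinarith
  · have : 0 < D * l * l := by positivity
    rw [hL]
    nlinarith
  · push_cast
    have h3 : (0 : ℝ) ≤ (g + 1) * D * l := by positivity
    have h4 : (1 : ℝ) ≤ n := by exact_mod_cast hn0
    nlinarith
  · refine le_trans ?_ (hfail.trans hε)
    have hexp : -(((8 * D * l : ℕ) : ℝ) / 8) = -(D * (l : ℝ)) := by push_cast; ring
    rw [hexp, ← add_mul]
    refine mul_le_mul_of_nonneg_right ?_ (Real.exp_pos _).le
    have hN : E * (l * Q) * n + κ * l ≤ 2 ^ 15 * D ^ 2 * n ^ 3 * l ^ 4 := by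
      calc E * (l * Q) * n + κ * l
          ≤ 6144 * D ^ 2 * (E * (g + 1)) * (2 * n) * l ^ 4 * n + 2 * n ^ 2 * l := by gcongr
        _ ≤ 6144 * D ^ 2 * (2 * n) * (2 * n) * l ^ 4 * n + 2 * (D ^ 2 * n ^ 3) * l ^ 4 := by
          have h3 : n ^ 2 ≤ D ^ 2 * n ^ 3 :=
            (Nat.pow_le_pow_right hn0 (by norm_num)).trans
              (Nat.le_mul_of_pos_left _ (by positivity))
          have h4 : l ≤ l ^ 4 := Nat.le_self_pow (by norm_num) l
          gcongr
        _ = 24578 * (D ^ 2 * n ^ 3 * l ^ 4) := by ring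
        _ ≤ 2 ^ 15 * (D ^ 2 * n ^ 3 * l ^ 4) := by gcongr; norm_num
        _ = 2 ^ 15 * D ^ 2 * n ^ 3 * l ^ 4 := by ring
    exact_mod_cast hN

end Parameters

/-! ### Classes of messages -/

section Classes

variable {n s : ℕ} {M : Type} [DecidableEq M] {inp : Fin n → List M}

theorem exists_singleton_classes (hinp : IsInput inp s) :
    ∃ classes : Finset (ℕ × Set M), classes.card ≤ s ∧
      (∀ p ∈ classes, p.1 < 1 ∧ p.2.Subsingleton ∧
        ∃ u, ∀ m ∈ p.2, ∃ j, (inp u)[j]? = some m ∧ j % 1 = p.1) ∧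
      ∀ u, ∀ m ∈ inp u, ∃ p ∈ classes, m ∈ p.2 := by
  classical
  refine ⟨(Finset.univ.biUnion fun u => (inp u).toFinset).image fun m => (0, {m}), ?_, ?_, ?_⟩
  · refine Finset.card_image_le.trans (Finset.card_biUnion_le.trans ?_)
    rw [← hinp.card]
    exact Finset.sum_le_sum fun u _ => List.toFinset_card_le _
  · intro p hp
    obtain ⟨m, hm, rfl⟩ := Finset.mem_image.1 hp
    obtain ⟨u, -, hu⟩ := Finset.mem_biUnion.1 hm
    obtain ⟨j, hj⟩ := List.mem_iff_getElem?.1 (List.mem_toFinset.1 hu)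
    refine ⟨one_pos, Set.subsingleton_singleton, u, fun m' hm' => ⟨j, ?_, Nat.mod_one j⟩⟩
    rw [Set.mem_singleton_iff.1 hm']
    exact hj
  · intro u m hm
    exact ⟨(0, {m}), Finset.mem_image.2 ⟨m, Finset.mem_biUnion.2 ⟨u, Finset.mem_univ u,
      List.mem_toFinset.2 hm⟩, rfl⟩, Set.mem_singleton m⟩

/-- Messages with the same origin and epoch share one event. The number of classes is then
independent of `s`, which need not be polynomial in `n` when `c` is large. -/
theorem exists_origin_classes {M : Type} (inp : Fin n → List M) {E : ℕ} (hE : 0 < E) :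
    ∃ classes : Finset (ℕ × Set M), classes.card ≤ n * E ∧
      (∀ p ∈ classes, p.1 < E ∧
        ∃ u, ∀ m ∈ p.2, ∃ j, (inp u)[j]? = some m ∧ j % E = p.1) ∧
      ∀ u, ∀ m ∈ inp u, ∃ p ∈ classes, m ∈ p.2 := by
  classical
  refine ⟨((Finset.univ : Finset (Fin n)) ×ˢ Finset.range E).image fun a =>
    (a.2, {m | ∃ j, (inp a.1)[j]? = some m ∧ j % E = a.2}), ?_, ?_, ?_⟩
  · refine Finset.card_image_le.trans ?_
    rw [Finset.card_product, Finset.card_univ, Fintype.card_fin, Finset.card_range]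
  · intro p hp
    obtain ⟨⟨u, e⟩, ha, rfl⟩ := Finset.mem_image.1 hp
    exact ⟨Finset.mem_range.1 (Finset.mem_product.1 ha).2, u, fun m hm => hm⟩
  · intro u m hm
    obtain ⟨j, hj⟩ := List.mem_iff_getElem?.1 hm
    exact ⟨_, Finset.mem_image.2 ⟨(u, j % E), Finset.mem_product.2 ⟨Finset.mem_univ u,
      Finset.mem_range.2 (Nat.mod_lt j hE)⟩, rfl⟩, j, hj, rfl⟩

theorem card_filter_mod_le (E e k : ℕ) :
    ((Finset.range k).filter fun j => j % E = e).card ≤ k / E + 1 := by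
  rw [← Finset.card_range (k / E + 1)]
  refine Finset.card_le_card_of_injOn (fun j => j / E) (fun j hj => ?_) fun i hi j hj hij => ?_
  · rw [Finset.mem_coe, Finset.mem_filter, Finset.mem_range] at hj
    rw [Finset.mem_coe, Finset.mem_range, Nat.lt_succ_iff]
    exact Nat.div_le_div_right hj.1.le
  · rw [Finset.mem_coe, Finset.mem_filter] at hi hj
    rw [← Nat.div_add_mod i E, ← Nat.div_add_mod j E, hi.2, hj.2]
    exact congrArg (E * · + e) hij

/-- Each origin splits its own messages evenly among the `E` epochs; rounding costs at most one
message per origin, hence the summand `n`. -/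
theorem length_le_of_subset_epochMessages (hinp : IsInput inp s) (E e : ℕ) {l : List M}
    (hl : l.Nodup) (hmem : ∀ m ∈ l, m ∈ epochMessages E inp e) : l.length ≤ s / E + n := by
  classical
  have hsub : l.toFinset ⊆ (Finset.univ : Finset (Fin n)).biUnion fun u =>
      ((Finset.range (inp u).length).filter fun j => j % E = e).biUnion fun j =>
        ((inp u)[j]?).toFinset := by
    intro m hm
    obtain ⟨u, j, hj, hje⟩ := hmem m (List.mem_toFinset.1 hm)
    refine Finset.mem_biUnion.2 ⟨u, Finset.mem_univ u, Finset.mem_biUnion.2 ⟨j, ?_, ?_⟩⟩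
    · exact Finset.mem_filter.2 ⟨Finset.mem_range.2 (List.getElem?_eq_some_iff.1 hj).1, hje⟩
    · rw [hj]; simp
  rw [← List.toFinset_card_of_nodup hl]
  refine (Finset.card_le_card hsub).trans (Finset.card_biUnion_le.trans ?_)
  calc ∑ u : Fin n, (((Finset.range (inp u).length).filter fun j => j % E = e).biUnion fun j =>
        ((inp u)[j]?).toFinset).card
      ≤ ∑ u : Fin n, ((inp u).length / E + 1) := Finset.sum_le_sum fun u _ => by
        refine Finset.card_biUnion_le.trans
          ((Finset.sum_le_card_nsmul _ _ 1 fun j _ => ?_).trans ?_)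
        · cases (inp u)[j]? <;> simp
        · rw [smul_eq_mul, mul_one]
          exact card_filter_mod_le E e _
    _ ≤ s / E + n := by
      rw [Finset.sum_add_distrib, Finset.sum_const, Finset.card_univ, Fintype.card_fin,
        smul_eq_mul, mul_one, ← hinp.card]
      gcongr
      rcases Nat.eq_zero_or_pos E with rfl | hE
      · simp
      · rw [Nat.le_div_iff_mul_le hE, Finset.sum_mul]
        exact Finset.sum_le_sum fun u _ => Nat.div_mul_le_self _ _

end Classes

/-! ### Combining the algorithms -/

theorem solves_zero {n : ℕ} (A : Algorithm n) (T : ℕ∞) (τ s B t : ℕ) : Solves A T τ s B t 0 :=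
  fun _ _ _ _ _ => ENNReal.toReal_nonneg

theorem exists_unit_capacity_solves (a : ℕ) {n s : ℕ} (B b : ℕ) (hn : 2 ≤ n) (hs : 1 ≤ s)
    {ε : ℝ} (hε : Real.exp (-(a * Nat.clog 2 n)) ≤ ε) :
    ∃ (A : Algorithm n) (t : ℕ), A.HasCapacity 1 b ∧
      (t : ℝ) ≤ 9216 * (a + 25) * (n * s * Real.log n ^ 2) ∧ Solves A ⊤ 0 s B t (1 - ε) := by
  obtain ⟨-, -, -, -, hl, hlog⟩ := clog_two_bounds hn
  -- For `s ≤ n` the number of agents is polynomial in `n`. For `s > n` the pipeline takes at most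
  -- `2 * n * s` rounds, and `1 / 2 ≤ Real.log n` absorbs the missing logarithms.
  rcases le_or_gt s n with hsn | hsn
  · obtain ⟨A, t, hA, ht, hsol⟩ := exists_harmonicMulti_solves a B b hn hs hsn hε
    refine ⟨A, t, hA, ?_, hsol⟩
    rw [ht]
    push_cast
    calc (16 : ℝ) * (a + 25) * Nat.clog 2 n * (64 * (n * s) * Nat.clog 2 n)
        = 1024 * (a + 25) * (n * s * (Nat.clog 2 n : ℝ) ^ 2) := by ring
      _ ≤ 1024 * (a + 25) * (n * s * (3 * Real.log n) ^ 2) := by gcongr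
      _ = 9216 * (a + 25) * (n * s * Real.log n ^ 2) := by ring
  · refine ⟨pipeline n 1, n * (n + s / 1), pipeline_hasCapacity n 1 b, ?_,
      pipeline_solves le_rfl (by linarith [Real.exp_pos (-(a * Nat.clog 2 n : ℝ))])⟩
    have h1 : (n : ℝ) ≤ s := by exact_mod_cast hsn.le
    rw [Nat.div_one]
    push_cast
    calc (n : ℝ) * (n + s) ≤ n * (s + s) := by gcongr
      _ = 8 * (n * s * (1 / 2) ^ 2) := by ring
      _ ≤ 9216 * (a + 25) * (n * s * Real.log n ^ 2) := by
        gcongr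
        linarith [(Nat.cast_nonneg a : (0 : ℝ) ≤ a)]

theorem exists_capacity_solves (a : ℕ) {n s c : ℕ} (B b : ℕ) (hn : 2 ≤ n) (hs : 1 ≤ s)
    (hc : 1 ≤ c) {ε : ℝ} (hε : Real.exp (-(a * Nat.clog 2 n)) ≤ ε) :
    ∃ (A : Algorithm n) (t : ℕ), A.HasCapacity c b ∧
      (t : ℝ) ≤ 7962624 * (a + 25) ^ 2 * ((1 + (s : ℝ) / c) * n * Real.log n ^ 4) ∧
      Solves A ⊤ 0 s B t (1 - ε) := by
  obtain ⟨-, -, -, -, hl, hlog⟩ := clog_two_bounds hn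
  have hdiv : ((s / c : ℕ) : ℝ) ≤ (s : ℝ) / c := Nat.cast_div_le
  rcases le_or_gt (c * n) s with hcs | hcs
  · refine ⟨pipeline n c, n * (n + s / c), pipeline_hasCapacity n c b, ?_,
      pipeline_solves hc (by linarith [Real.exp_pos (-(a * Nat.clog 2 n : ℝ))])⟩
    have h1 : (n : ℝ) ≤ (s / c : ℕ) := by
      exact_mod_cast (Nat.le_div_iff_mul_le hc).2 (by rwa [mul_comm])
    push_cast at h1 hdiv ⊢
    calc (n : ℝ) * (n + (s / c : ℕ)) ≤ n * (2 * (1 + (s : ℝ) / c)) := by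
          gcongr
          linarith
      _ = 32 * ((1 + (s : ℝ) / c) * n * (1 / 2) ^ 4) := by ring
      _ ≤ 7962624 * (a + 25) ^ 2 * ((1 + (s : ℝ) / c) * n * Real.log n ^ 4) := by
        gcongr
        nlinarith [(Nat.cast_nonneg a : (0 : ℝ) ≤ a)]
  have hscn : s / c + 1 ≤ n := Nat.succ_le_of_lt ((Nat.div_lt_iff_lt_mul hc).2 (by rwa [mul_comm]))
  have hslt : s < c * (s / c + 1) := by
    have := Nat.div_add_mod s c
    have := Nat.mod_lt s hc
    rw [mul_add]
    omega
  have htime : ∀ t w : ℕ, w ≤ 2 * (s / c + 1) →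
      t ≤ 6144 * (2 * (a + 25)) ^ 2 * w * (2 * n) * Nat.clog 2 n ^ 4 →
      (t : ℝ) ≤ 7962624 * (a + 25) ^ 2 * ((1 + (s : ℝ) / c) * n * Real.log n ^ 4) := by
    intro t w hw ht
    have hw' : (w : ℝ) ≤ 2 * (1 + (s : ℝ) / c) := by
      refine (by exact_mod_cast hw : (w : ℝ) ≤ ((2 * (s / c + 1) : ℕ) : ℝ)).trans ?_
      push_cast at hdiv ⊢
      linarith
    calc (t : ℝ) ≤ 6144 * (2 * (a + 25)) ^ 2 * w * (2 * n) * (Nat.clog 2 n : ℝ) ^ 4 := by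
          exact_mod_cast ht
      _ ≤ 6144 * (2 * (a + 25)) ^ 2 * (2 * (1 + (s : ℝ) / c)) * (2 * n) *
          (3 * Real.log n) ^ 4 := by gcongr
      _ = 7962624 * (a + 25) ^ 2 * ((1 + (s : ℝ) / c) * n * Real.log n ^ 4) := by ring
  -- If `2 * n ≤ c`, the messages of one of `2 * (s / c + 1)` epochs number at most `c / 2 + n ≤ c`,
  -- so a pool fits into one packet and classes may be large. If `c < 2 * n`, then `s < 2 * n ^ 2`,
  -- so a union bound over single messages is affordable and one epoch with `s / c + 1` chunks
  -- suffices.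
  rcases le_or_gt (2 * n) c with hnc | hnc
  · have hE : 0 < 2 * (s / c + 1) := by positivity
    have hex := exists_samplingBroadcast_solves a (s := s) (c := c) (g := 0)
      (E := 2 * (s / c + 1)) (B := B) (κ := n * (2 * (s / c + 1))) b hn (by omega)
      (by nlinarith) ?_ ?_ hε
    · obtain ⟨A, t, hA, ht, hsol⟩ := hex
      exact ⟨A, t, hA, htime t _ (by omega) ht, hsol⟩
    · intro inp hinp e _ l hl hmem
      refine (length_le_of_subset_epochMessages hinp _ e hl hmem).trans ?_
      have : s / (2 * (s / c + 1)) ≤ c / 2 := by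
        have h1 : s / (2 * (s / c + 1)) * (2 * (s / c + 1)) < c * (s / c + 1) :=
          (Nat.div_mul_le_self _ _).trans_lt hslt
        rw [← mul_assoc] at h1
        have h2 := Nat.lt_of_mul_lt_mul_right h1
        omega
      omega
    · intro inp _
      obtain ⟨classes, h1, h2, h3⟩ := exists_origin_classes inp hE
      exact ⟨classes, h1, fun p hp => ⟨(h2 p hp).1, Or.inl rfl, (h2 p hp).2⟩, h3⟩
  · have hex := exists_samplingBroadcast_solves a (s := s) (c := c) (g := s / c)
      (E := 1) (B := B) (κ := s) b hn (by omega) (by nlinarith) ?_ ?_ hε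
    · obtain ⟨A, t, hA, ht, hsol⟩ := hex
      exact ⟨A, t, hA, htime t _ (by omega) ht, hsol⟩
    · intro inp hinp e _ l hl hmem
      refine le_trans (nodup_length_le_of_subset_inp hinp hl fun m hm => ?_) hslt.le
      obtain ⟨u, j, hj, -⟩ := hmem m hm
      exact ⟨u, List.mem_of_getElem? hj⟩
    · intro inp hinp
      obtain ⟨classes, h1, h2, h3⟩ := exists_singleton_classes hinp
      exact ⟨classes, h1, fun p hp => ⟨(h2 p hp).1, Or.inr (h2 p hp).2.1, (h2 p hp).2.2⟩, h3⟩

end RadioNetwork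

open RadioNetwork in
theorem theorem1 :
    ∃ K : ℕ, ∀ γ : ℝ, 0 < γ → ∃ C : ℝ, 0 < C ∧
      ∀ n s B : ℕ, 1 ≤ n → 1 ≤ s → 1 ≤ B →
        (∃ (A : Algorithm n) (t : ℕ), A.HasCapacity 1 (K * B) ∧
          (t : ℝ) ≤ C * (n * s * Real.log n ^ 2) ∧
          Solves A ⊤ 0 s B t (1 - (n : ℝ) ^ (-γ))) ∧
        (∀ c : ℕ, 1 ≤ c →
          ∃ (A : Algorithm n) (t : ℕ), A.HasCapacity c (K * (c * B)) ∧
            (t : ℝ) ≤ C * ((1 + (s : ℝ) / c) * n * Real.log n ^ 4) ∧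
            Solves A ⊤ 0 s B t (1 - (n : ℝ) ^ (-γ))) := by
  -- `K = 0`: all packets have empty control strings. The exponent `γ` is rounded up to a natural
  -- number.
  refine ⟨0, fun γ _ => ⟨7962624 * (⌈γ⌉₊ + 25) ^ 2, by positivity, fun n s B hn hs _ => ?_⟩⟩
  -- For `n = 1` the time bound is `0` since `Real.log 1 = 0`, but the required probability is `0`
  -- as well.
  rcases eq_or_lt_of_le hn with rfl | hn
  · have hp : 1 - ((1 : ℕ) : ℝ) ^ (-γ) = 0 := by simp
    rw [hp]
    exact ⟨⟨pipeline 1 1, 0, pipeline_hasCapacity 1 1 _, by simp, solves_zero _ _ _ _ _ _⟩,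
      fun c _ => ⟨pipeline 1 c, 0, pipeline_hasCapacity 1 c _, by simp, solves_zero _ _ _ _ _ _⟩⟩
  · have hε := exp_neg_le_rpow hn (Nat.le_ceil γ)
    refine ⟨?_, fun c hc => exists_capacity_solves _ B _ hn hs hc hε⟩
    obtain ⟨A, t, hA, ht, hsol⟩ := exists_unit_capacity_solves ⌈γ⌉₊ B (0 * B) hn hs hε
    refine ⟨A, t, hA, ht.trans ?_, hsol⟩
    gcongr ?_ * _
    nlinarith [(Nat.cast_nonneg ⌈γ⌉₊ : (0 : ℝ) ≤ ⌈γ⌉₊)]
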